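/- Let $(M,J)$ be a connected complex manifold of complex dimension $n$, and let $\lambda<\mu$ be real numbers with $\lambda\mu>0$. There is a one-to-one correspondence $g\leftrightarrow(\widetilde g,\bar J)$ between (a) Kähler metrics $g$ on $(M,J)$ whose Ricci tensor has, at every point, exactly the two eigenvalues $\lambda$ and $\mu$; and (b) pairs $(\widetilde g,\bar J)$, where $\widetilde g$ is a Kähler–Einstein metric on $(M,J)$ of scalar curvature $2n\lambda$ and $\bar J$ is an almost complex structure such that $(\widetilde g,\bar J)$ is almost Kähler (i.e. $\bar J$ is $\widetilde g$-orthogonal and the 2-form $\widetilde g(\bar J\cdot,\cdot)$ is closed), $\bar J$ commutes with $J$, and $\bar J\neq\pm J$. In this correspondence, let $E_\lambda,E_\mu$ be the eigenspaces of the Ricci tensor of $g$. Then $\bar J$ equals $J$ on $E_\lambda$ and $-J$ on $E_\mu$, more precisely $E_\lambda=\{v:\bar Jv=Jv\}=:E_+$ and $E_\mu=\{v:\bar Jv=-Jv\}=:E_-$. The metrics are related by $$\widetilde g=g|_{E_+}+\tfrac{\mu}{\lambda}\,g|_{E_-},\qquad g=\widetilde g|_{E_+}+\tfrac{\lambda}{\mu}\,\widetilde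 g|_{E_-},$$ and $(g,\bar J)$ is almost Kähler as well. Moreover, the following are equivalent: 1. $\bar J$ is integrable in the sense that its Nijenhuis tensor vanishes; 2. $\bar J$ is integrable in the sense that it is locally induced by complex coordinates; 3. the Riemannian metric $g$ is locally a product of two Kähler–Einstein metrics (on manifolds of positive dimension); 4. both $g$ and $\widetilde g$ are locally products of two Kähler–Einstein metrics (on manifolds of positive dimension); 5. $(M,g,J)$ is locally a product of two Kähler–Einstein manifolds, with factors tangent to $E_+$ and $E_-$; 6. $(M,\widetilde g,J)$ is locally a product of two Kähler–Einstein manifolds, with factors tangent to $E_+$ and $E_-$. -/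

import Mathlib

open Set Manifold ContDiff

set_option maxSynthPendingDepth 3

noncomputable section

/-! ### Riemannian geometry on open subsets of a vector space

A Riemannian metric in coordinates is a map `h : E → E →L[ℝ] E →L[ℝ] ℝ`, whose value `h y v w` is
the inner product of the vectors `v`, `w` at the point `y`. -/

namespace CoordMetric

variable {E : Type*} [NormedAddCommGroup E] [NormedSpace ℝ E]

/-- The lowered Christoffel symbols (Koszul formula):
`koszul h y v w u = (D_v h (w, u) + D_w h (v, u) - D_u h (v, w)) / 2` at the point `y`. -/
def koszul (h : E → E →L[ℝ] E →L[ℝ] ℝ) (y : E) : E →L[ℝ] E →L[ℝ] E →L[ℝ] ℝ :=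
  let D : E →L[ℝ] E →L[ℝ] E →L[ℝ] ℝ := fderiv ℝ h y
  let flip : (E →L[ℝ] E →L[ℝ] ℝ) →L[ℝ] E →L[ℝ] E →L[ℝ] ℝ :=
    (ContinuousLinearMap.flipₗᵢ ℝ E E ℝ).toContinuousLinearEquiv
  (1 / 2 : ℝ) • (D + D.flip - flip.comp D.flip)

theorem koszul_apply (h : E → E →L[ℝ] E →L[ℝ] ℝ) (y v w u : E) :
    koszul h y v w u =
      (1 / 2 : ℝ) * (fderiv ℝ h y v w u + fderiv ℝ h y w v u - fderiv ℝ h y u v w) := by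
  simp [koszul]

/-- The Christoffel symbols `Γ(v, w)` of the Levi-Civita connection, i.e. the vector with
`h (Γ(v, w), u) = koszul h y v w u` for all `u`; so `∇_v W = D_v W + Γ(v, W)`. -/
def christoffel (h : E → E →L[ℝ] E →L[ℝ] ℝ) (y : E) : E →L[ℝ] E →L[ℝ] E :=
  (ContinuousLinearMap.compL ℝ E (E →L[ℝ] ℝ) E (h y).inverse).comp (koszul h y)

/-- The linear map `u ↦ R(u, v) w`, where
`R(u, v) w = D_u Γ(v, w) - D_v Γ(u, w) + Γ(u, Γ(v, w)) - Γ(v, Γ(u, w))` is the curvature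
`∇_u ∇_v w - ∇_v ∇_u w` for constant vector fields. -/
def curvature (h : E → E →L[ℝ] E →L[ℝ] ℝ) (y v w : E) : E →L[ℝ] E :=
  ((fderiv ℝ (christoffel h) y).flip v).flip w - (fderiv ℝ (christoffel h) y v).flip w
    + (christoffel h y).flip (christoffel h y v w)
    - (christoffel h y v).comp ((christoffel h y).flip w)

theorem curvature_apply (h : E → E →L[ℝ] E →L[ℝ] ℝ) (y u v w : E) :
    curvature h y v w u =
      fderiv ℝ (christoffel h) y u v w - fderiv ℝ (christoffel h) y v u w
        + christoffel h y u (christoffel h y v w) - christoffel h y v (christoffel h y u w) := by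
  simp [curvature]

/-- The Ricci tensor `Ric(v, w) = trace (u ↦ R(u, v) w)`. -/
def ricci [FiniteDimensional ℝ E] (h : E → E →L[ℝ] E →L[ℝ] ℝ) (y : E) : E →L[ℝ] E →L[ℝ] ℝ :=
  LinearMap.toContinuousLinearMap
    (LinearMap.toContinuousLinearMap.toLinearMap.comp
      (LinearMap.mk₂ ℝ
        (fun v w => LinearMap.trace ℝ E (curvature h y v w).toLinearMap)
        (fun v v' w => by
          rw [← map_add]; congr 1; ext u; simp [curvature_apply]; abel)
        (fun c v w => by
          rw [← map_smul]; congr 1; ext u; simp [curvature_apply, smul_sub, smul_add])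
        (fun v w w' => by
          rw [← map_add]; congr 1; ext u; simp [curvature_apply]; abel)
        (fun c v w => by
          rw [← map_smul]; congr 1; ext u; simp [curvature_apply, smul_sub, smul_add])))

theorem ricci_apply [FiniteDimensional ℝ E] (h : E → E →L[ℝ] E →L[ℝ] ℝ) (y v w : E) :
    ricci h y v w = LinearMap.trace ℝ E (curvature h y v w).toLinearMap := rfl

/-- The 2-form `σ` (in coordinates) is closed at `y`:
`(dσ)(u, v, w) = D_u σ(v, w) + D_v σ(w, u) + D_w σ(u, v) = 0`. -/
def ClosedAt (σ : E → E →L[ℝ] E →L[ℝ] ℝ) (y : E) : Prop :=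
  ∀ u v w : E, fderiv ℝ σ y u v w + fderiv ℝ σ y v w u + fderiv ℝ σ y w u v = 0

/-- Multiplication by `i` on `ℂⁿ`, as a real linear map. -/
def mulI (n : ℕ) : EuclideanSpace ℂ (Fin n) →L[ℝ] EuclideanSpace ℂ (Fin n) :=
  Complex.I • ContinuousLinearMap.id ℝ (EuclideanSpace ℂ (Fin n))

/-- `h` is a Kähler–Einstein metric on the open subset `U` of `ℂⁿ`, with respect to the standard
complex structure of `ℂⁿ`. -/
structure IsKahlerEinsteinOn {n : ℕ}
    (h : EuclideanSpace ℂ (Fin n) →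
      EuclideanSpace ℂ (Fin n) →L[ℝ] EuclideanSpace ℂ (Fin n) →L[ℝ] ℝ)
    (U : Set (EuclideanSpace ℂ (Fin n))) : Prop where
  smooth : ContDiffOn ℝ ∞ h U
  symm : ∀ y ∈ U, ∀ v w, h y v w = h y w v
  pos : ∀ y ∈ U, ∀ v, v ≠ 0 → 0 < h y v v
  hermitian : ∀ y ∈ U, ∀ v w, h y (mulI n v) (mulI n w) = h y v w
  closed : ∀ y ∈ U, ClosedAt (fun z => (h z).comp (mulI n)) y
  einstein : ∃ c : ℝ, ∀ y ∈ U, ricci h y = c • h y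

end CoordMetric

/-! ### Complex manifolds and their real tangent bundle -/

namespace ComplexManifold

/-- A complex manifold is a smooth real manifold. -/
instance isManifold_real {n : ℕ} {M : Type*} [TopologicalSpace M]
    [ChartedSpace (EuclideanSpace ℂ (Fin n)) M]
    [IsManifold 𝓘(ℂ, EuclideanSpace ℂ (Fin n)) ω M] :
    IsManifold 𝓘(ℝ, EuclideanSpace ℂ (Fin n)) ∞ M := by
  refine isManifold_of_contDiffOn _ _ _ fun e e' he he' => ?_
  have h := (contDiffGroupoid ω 𝓘(ℂ, EuclideanSpace ℂ (Fin n))).compatible he he'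
  rw [contDiffGroupoid, mem_groupoid_of_pregroupoid] at h
  exact (h.1.restrict_scalars ℝ).of_le le_top

variable {n : ℕ} {M : Type*} [TopologicalSpace M] [ChartedSpace (EuclideanSpace ℂ (Fin n)) M]

/-- The real tangent space `T_x M`. By definition it is the model space `ℂⁿ`, identified with the
tangent space through the preferred holomorphic chart `chartAt _ x`. -/
abbrev Tan (n : ℕ) {M : Type*} [TopologicalSpace M] [ChartedSpace (EuclideanSpace ℂ (Fin n)) M]
    (x : M) : Type :=
  TangentSpace 𝓘(ℝ, EuclideanSpace ℂ (Fin n)) x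

/-- Smooth Riemannian metrics on the underlying real manifold. -/
abbrev Metric (n : ℕ) (M : Type*) [TopologicalSpace M] [ChartedSpace (EuclideanSpace ℂ (Fin n)) M]
    [IsManifold 𝓘(ℂ, EuclideanSpace ℂ (Fin n)) ω M] :=
  Bundle.ContMDiffRiemannianMetric 𝓘(ℝ, EuclideanSpace ℂ (Fin n)) ∞ (EuclideanSpace ℂ (Fin n))
    (fun x : M => Tan n x)

/-- Fields of (real) endomorphisms of the tangent spaces. -/
abbrev EndField (n : ℕ) (M : Type*) [TopologicalSpace M]
    [ChartedSpace (EuclideanSpace ℂ (Fin n)) M] :=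
  (x : M) → Tan n x →L[ℝ] Tan n x

/-- Fields of bilinear forms on the tangent spaces. -/
abbrev BilinField (n : ℕ) (M : Type*) [TopologicalSpace M]
    [ChartedSpace (EuclideanSpace ℂ (Fin n)) M] :=
  (x : M) → Tan n x →L[ℝ] Tan n x →L[ℝ] ℝ

/-- The complex structure `J` of the complex manifold `M`: multiplication by `i` in
holomorphic charts. -/
def cplx : EndField n M := fun _ => CoordMetric.mulI n

/-- The expression of a field of bilinear forms in the chart `chartAt _ x₀`: the pullback by the
inverse chart. -/
def coord (B : BilinField n M) (x₀ : M) (y : EuclideanSpace ℂ (Fin n)) :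
    EuclideanSpace ℂ (Fin n) →L[ℝ] EuclideanSpace ℂ (Fin n) →L[ℝ] ℝ :=
  let e := chartAt (EuclideanSpace ℂ (Fin n)) x₀
  let b : EuclideanSpace ℂ (Fin n) →L[ℝ] EuclideanSpace ℂ (Fin n) →L[ℝ] ℝ := B (e.symm y)
  let d : EuclideanSpace ℂ (Fin n) →L[ℝ] EuclideanSpace ℂ (Fin n) :=
    mfderiv 𝓘(ℝ, EuclideanSpace ℂ (Fin n)) 𝓘(ℝ, EuclideanSpace ℂ (Fin n)) e.symm y
  b.bilinearComp d d

/-- A field of 2-forms is closed: its expressions in charts are closed. -/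
def IsClosedForm (B : BilinField n M) : Prop :=
  ∀ x₀ : M, ∀ y ∈ (chartAt (EuclideanSpace ℂ (Fin n)) x₀).target,
    CoordMetric.ClosedAt (coord B x₀) y

/-- The fundamental form `g (A ·, ·)`. -/
def fundamentalForm (b : BilinField n M) (A : EndField n M) : BilinField n M :=
  fun x => (b x).comp (A x)

/-- The field of endomorphisms `A` is smooth. -/
def IsSmoothEnd [IsManifold 𝓘(ℂ, EuclideanSpace ℂ (Fin n)) ω M] (A : EndField n M) : Prop :=
  ContMDiff 𝓘(ℝ, EuclideanSpace ℂ (Fin n))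
    (𝓘(ℝ, EuclideanSpace ℂ (Fin n)).prod
      𝓘(ℝ, EuclideanSpace ℂ (Fin n) →L[ℝ] EuclideanSpace ℂ (Fin n))) ∞
    (fun x => Bundle.TotalSpace.mk' (EuclideanSpace ℂ (Fin n) →L[ℝ] EuclideanSpace ℂ (Fin n))
      (E := fun x : M => Tan n x →L[ℝ] Tan n x) x (A x))

/-- `A` is an almost complex structure. -/
structure IsAlmostComplex [IsManifold 𝓘(ℂ, EuclideanSpace ℂ (Fin n)) ω M] (A : EndField n M) :
    Prop where
  smooth : IsSmoothEnd A
  sq : ∀ x v, A x (A x v) = -v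

/-- Vanishing of the Nijenhuis tensor
`N(X, Y) = [A X, A Y] - [X, Y] - A [A X, Y] - A [X, A Y]`. -/
def IsIntegrable [IsManifold 𝓘(ℂ, EuclideanSpace ℂ (Fin n)) ω M] (A : EndField n M) : Prop :=
  ∀ (x : M) (X Y : (x : M) → Tan n x),
    ContMDiffAt 𝓘(ℝ, EuclideanSpace ℂ (Fin n)) 𝓘(ℝ, EuclideanSpace ℂ (Fin n)).tangent ∞
      (fun y => (⟨y, X y⟩ : TangentBundle 𝓘(ℝ, EuclideanSpace ℂ (Fin n)) M)) x →
    ContMDiffAt 𝓘(ℝ, EuclideanSpace ℂ (Fin n)) 𝓘(ℝ, EuclideanSpace ℂ (Fin n)).tangent ∞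
      (fun y => (⟨y, Y y⟩ : TangentBundle 𝓘(ℝ, EuclideanSpace ℂ (Fin n)) M)) x →
    VectorField.mlieBracket 𝓘(ℝ, EuclideanSpace ℂ (Fin n))
        (fun y => A y (X y)) (fun y => A y (Y y)) x
      - VectorField.mlieBracket 𝓘(ℝ, EuclideanSpace ℂ (Fin n)) X Y x
      - A x (VectorField.mlieBracket 𝓘(ℝ, EuclideanSpace ℂ (Fin n)) (fun y => A y (X y)) Y x)
      - A x (VectorField.mlieBracket 𝓘(ℝ, EuclideanSpace ℂ (Fin n)) X (fun y => A y (Y y)) x) = 0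

/-- `A` is locally induced by complex coordinates: around each point there is a smooth chart with
values in `ℂⁿ` whose differential carries `A` to multiplication by `i`. -/
def HasComplexCharts (A : EndField n M) : Prop :=
  ∀ x : M, ∃ Ψ : OpenPartialHomeomorph M (EuclideanSpace ℂ (Fin n)),
    x ∈ Ψ.source ∧
    ContMDiffOn 𝓘(ℝ, EuclideanSpace ℂ (Fin n)) 𝓘(ℝ, EuclideanSpace ℂ (Fin n)) ∞ Ψ Ψ.source ∧
    ContMDiffOn 𝓘(ℝ, EuclideanSpace ℂ (Fin n)) 𝓘(ℝ, EuclideanSpace ℂ (Fin n)) ∞ Ψ.symm Ψ.target ∧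
    ∀ y ∈ Ψ.source, ∀ v : Tan n y,
      mfderiv 𝓘(ℝ, EuclideanSpace ℂ (Fin n)) 𝓘(ℝ, EuclideanSpace ℂ (Fin n)) Ψ y (A y v)
        = CoordMetric.mulI n
          (mfderiv 𝓘(ℝ, EuclideanSpace ℂ (Fin n)) 𝓘(ℝ, EuclideanSpace ℂ (Fin n)) Ψ y v)

/-- The differential of a map from (an open subset of) `M` to `ℂᵖ × ℂ^q`. -/
def diff {p q : ℕ}
    (Φ : OpenPartialHomeomorph M (EuclideanSpace ℂ (Fin p) × EuclideanSpace ℂ (Fin q))) (y : M)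
    (v : Tan n y) : EuclideanSpace ℂ (Fin p) × EuclideanSpace ℂ (Fin q) :=
  mfderiv 𝓘(ℝ, EuclideanSpace ℂ (Fin n))
    𝓘(ℝ, EuclideanSpace ℂ (Fin p) × EuclideanSpace ℂ (Fin q)) Φ y v

section Metrics

variable [IsManifold 𝓘(ℂ, EuclideanSpace ℂ (Fin n)) ω M]

/-- `(g, A)` is an almost Kähler structure: `A` is a `g`-orthogonal almost complex structure and
the fundamental form `g (A ·, ·)` is closed. -/
structure IsAlmostKahler (g : Metric n M) (A : EndField n M) : Prop where
  almostComplex : IsAlmostComplex A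
  orthogonal : ∀ x v w, g.inner x (A x v) (A x w) = g.inner x v w
  closed : IsClosedForm (fundamentalForm g.inner A)

/-- `g` is a Kähler metric on the complex manifold `M`. -/
structure IsKahler (g : Metric n M) : Prop where
  orthogonal : ∀ x v w, g.inner x (cplx x v) (cplx x w) = g.inner x v w
  closed : IsClosedForm (fundamentalForm g.inner cplx)

/-- The Ricci tensor of `g` at `x`, computed in the chart `chartAt _ x` through which `T_x M` is
identified with `ℂⁿ`. -/
def ricci (g : Metric n M) : BilinField n M := fun x =>
  CoordMetric.ricci (coord g.inner x) (chartAt (EuclideanSpace ℂ (Fin n)) x x)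

/-- The Ricci tensor as an endomorphism: `g (Ric v, w) = Ric (v, w)`. -/
def ricciEnd (g : Metric n M) : EndField n M := fun x => (g.inner x).inverse.comp (ricci g x)

/-- The scalar curvature, the trace of the Ricci endomorphism. -/
def scalarCurvature (g : Metric n M) (x : M) : ℝ :=
  LinearMap.trace ℝ (Tan n x) (ricciEnd g x).toLinearMap

/-- `g` is a Kähler–Einstein metric on the complex manifold `M`. -/
structure IsKahlerEinstein (g : Metric n M) : Prop where
  kahler : IsKahler g
  einstein : ∃ c : ℝ, ∀ x, ricci g x = c • g.inner x

/-- The eigenspace `E_c` of the Ricci tensor at `x`. -/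
def ricciEigenspace (g : Metric n M) (c : ℝ) (x : M) : Submodule ℝ (Tan n x) :=
  Module.End.eigenspace (ricciEnd g x).toLinearMap c

/-- At every point the set of eigenvalues of the Ricci tensor is `{lam, mu}`. -/
def HasRicciEigenvalues (g : Metric n M) (lam mu : ℝ) : Prop :=
  ∀ (x : M) (c : ℝ), Module.End.HasEigenvalue (ricciEnd g x).toLinearMap c ↔ c = lam ∨ c = mu

/-- The projection `(v + Q v) / 2`, where `Q = - J A`, onto the subspace `E₊ = {A v = J v}` along
`E₋ = {A v = - J v}` (for `A` an almost complex structure commuting with `J`). -/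
def projPlus (A : EndField n M) (x : M) (v : Tan n x) : Tan n x :=
  (1 / 2 : ℝ) • (v - cplx x (A x v))

/-- The projection `(v - Q v) / 2`, where `Q = - J A`, onto `E₋` along `E₊`. -/
def projMinus (A : EndField n M) (x : M) (v : Tan n x) : Tan n x :=
  (1 / 2 : ℝ) • (v + cplx x (A x v))

/-- `g' = g|E₊ + t g|E₋`. -/
def IsRescaling (A : EndField n M) (t : ℝ) (g g' : Metric n M) : Prop :=
  ∀ x (v w : Tan n x), g'.inner x v w =
    g.inner x (projPlus A x v) (projPlus A x w) +
      t * g.inner x (projMinus A x v) (projMinus A x w)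

/-- `Φ` is a local diffeomorphism from an open subset of `M` onto the product of the open sets
`U₁ ⊆ ℂᵖ` and `U₂ ⊆ ℂ^q`, with `p, q > 0`, identifying `g` with the product of
Kähler–Einstein metrics `h₁` on `U₁` and `h₂` on `U₂`. -/
structure IsKEProductChart (g : Metric n M) {p q : ℕ}
    (Φ : OpenPartialHomeomorph M (EuclideanSpace ℂ (Fin p) × EuclideanSpace ℂ (Fin q)))
    (U₁ : Set (EuclideanSpace ℂ (Fin p))) (U₂ : Set (EuclideanSpace ℂ (Fin q)))
    (h₁ : EuclideanSpace ℂ (Fin p) →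
      EuclideanSpace ℂ (Fin p) →L[ℝ] EuclideanSpace ℂ (Fin p) →L[ℝ] ℝ)
    (h₂ : EuclideanSpace ℂ (Fin q) →
      EuclideanSpace ℂ (Fin q) →L[ℝ] EuclideanSpace ℂ (Fin q) →L[ℝ] ℝ) : Prop where
  pos₁ : 0 < p
  pos₂ : 0 < q
  open₁ : IsOpen U₁
  open₂ : IsOpen U₂
  target_eq : Φ.target = U₁ ×ˢ U₂
  smooth : ContMDiffOn 𝓘(ℝ, EuclideanSpace ℂ (Fin n))
    𝓘(ℝ, EuclideanSpace ℂ (Fin p) × EuclideanSpace ℂ (Fin q)) ∞ Φ Φ.source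
  smooth_symm : ContMDiffOn 𝓘(ℝ, EuclideanSpace ℂ (Fin p) × EuclideanSpace ℂ (Fin q))
    𝓘(ℝ, EuclideanSpace ℂ (Fin n)) ∞ Φ.symm Φ.target
  kahlerEinstein₁ : CoordMetric.IsKahlerEinsteinOn h₁ U₁
  kahlerEinstein₂ : CoordMetric.IsKahlerEinsteinOn h₂ U₂
  isometry : ∀ y ∈ Φ.source, ∀ v w : Tan n y,
    g.inner y v w = h₁ (Φ y).1 (diff Φ y v).1 (diff Φ y w).1
      + h₂ (Φ y).2 (diff Φ y v).2 (diff Φ y w).2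

/-- `g` is locally a product of two Kähler–Einstein metrics (as a Riemannian metric). -/
def IsLocallyKEProduct (g : Metric n M) : Prop :=
  ∀ x : M, ∃ (p q : ℕ)
    (Φ : OpenPartialHomeomorph M (EuclideanSpace ℂ (Fin p) × EuclideanSpace ℂ (Fin q)))
    (U₁ : Set (EuclideanSpace ℂ (Fin p))) (U₂ : Set (EuclideanSpace ℂ (Fin q)))
    (h₁ : EuclideanSpace ℂ (Fin p) →
      EuclideanSpace ℂ (Fin p) →L[ℝ] EuclideanSpace ℂ (Fin p) →L[ℝ] ℝ)
    (h₂ : EuclideanSpace ℂ (Fin q) →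
      EuclideanSpace ℂ (Fin q) →L[ℝ] EuclideanSpace ℂ (Fin q) →L[ℝ] ℝ),
    x ∈ Φ.source ∧ IsKEProductChart g Φ U₁ U₂ h₁ h₂

/-- `(M, g, J)` is locally a product of two Kähler–Einstein manifolds, with factors tangent to
`E₊ = {A v = J v}` and `E₋ = {A v = - J v}`: the product charts `Φ` can be chosen holomorphic,
with `E₊` tangent to the first factor and `E₋` tangent to the second factor. -/
def IsLocallyKEProductAlong (g : Metric n M) (A : EndField n M) : Prop :=
  ∀ x : M, ∃ (p q : ℕ)
    (Φ : OpenPartialHomeomorph M (EuclideanSpace ℂ (Fin p) × EuclideanSpace ℂ (Fin q)))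
    (U₁ : Set (EuclideanSpace ℂ (Fin p))) (U₂ : Set (EuclideanSpace ℂ (Fin q)))
    (h₁ : EuclideanSpace ℂ (Fin p) →
      EuclideanSpace ℂ (Fin p) →L[ℝ] EuclideanSpace ℂ (Fin p) →L[ℝ] ℝ)
    (h₂ : EuclideanSpace ℂ (Fin q) →
      EuclideanSpace ℂ (Fin q) →L[ℝ] EuclideanSpace ℂ (Fin q) →L[ℝ] ℝ),
    x ∈ Φ.source ∧ IsKEProductChart g Φ U₁ U₂ h₁ h₂ ∧
    ∀ y ∈ Φ.source, ∀ v : Tan n y,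
      (diff Φ y (cplx y v)).1 = CoordMetric.mulI p (diff Φ y v).1 ∧
      (diff Φ y (cplx y v)).2 = CoordMetric.mulI q (diff Φ y v).2 ∧
      (A y v = cplx y v ↔ (diff Φ y v).2 = 0) ∧
      (A y v = -cplx y v ↔ (diff Φ y v).1 = 0)

end Metrics

end ComplexManifold

end

noncomputable section

open scoped Topology

/-! ### Metrics in coordinates -/

namespace CoordMetric

section Calculus

variable {E F F' G : Type*} [NormedAddCommGroup E] [NormedSpace ℝ E]
  [NormedAddCommGroup F] [NormedSpace ℝ F] [NormedAddCommGroup F'] [NormedSpace ℝ F']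
  [NormedAddCommGroup G] [NormedSpace ℝ G]

/-! Everything is encoded in one field of endomorphisms, the orthogonal projection P onto E₋. It is
related to the almost complex structure by J̄ = J(1 - 2P), P = (1 + JJ̄)/2 (`twist`, `projEnd`). Let
ω be the Kähler form of a Kähler metric g and ω_P = g(JP·,·). Since g(J̄·,·) = ω - 2ω_P, the pair
(g, J̄) is almost Kähler with J̄ commuting with J exactly when P is a smooth J-linear orthogonal
projection with ω_P closed (`IsSplitting`). The fundamental form of g|ker P + t g|im P is ω + (t -
1)ω_P, so rescaling with a constant t > 0 preserves both the Kähler condition and the splitting.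

Two facts about the Ricci form ρ drive the correspondence. First, ρ is closed. If the Ricci
endomorphism has the two eigenvalues λ and μ, then P = (Ric - λ)/(μ - λ) is a projection and ω_P =
(ρ - λω)/(μ - λ) is closed (`isSplitting_ricciProj`). Second, ρ depends only on the logarithmic
derivative of the volume density, that is, on the trace τ of the Christoffel symbols: 2ρ = d(τ∘J)
(`IsKahlerOn.ricci_J_eq`). Rescaling on the two summands multiplies the volume density by a locally
constant factor, hence leaves the Ricci tensor unchanged as a bilinear form
(`IsKahlerOn.ricci_rescale`). With t = μ/λ, the tensor that is λg on E₊ and μg on E₋ is λ times the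
new metric. With the factor λ/μ the same computation runs backwards. The condition λμ > 0 makes both
factors positive. The hypothesis J̄ ≠ ±J excludes equality only globally; connectedness makes both
eigenspaces nonzero at every point, because the trace of P is a continuous integer.

The hub of the equivalences is the holomorphic local product along E₊ and E₋. If the Nijenhuis
tensor of J̄ vanishes, then P is holomorphic (`IsClosedSplitting.fderiv_holomorphic`). The
subbundles E₊ and E₋ are the kernels of the closed forms ω_P and ω - ω_P, so they are tangent to
holomorphic foliations. Their leaves are traced by the differential equation c' = P(c)z, whose
dependence on parameters is controlled by the inverse function theorem in a Banach space of curves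
(`CurveSpace.exists_leaf_flow`). A closed form annihilated by the leaf directions is pulled back
from a transversal (`apply_eq_of_radial`). This yields first integrals, two of them form a product
chart, and the same homotopy argument splits ω, and with it g, in that chart
(`exists_product_chart`).

Conversely, on a product of Einstein metrics the Ricci endomorphism is a constant multiple of the
identity on each factor. Hence P is parallel, and so is J̄. An almost complex structure parallel for
a torsion-free connection has vanishing Nijenhuis tensor (`nijenhuis_eq_zero_of_prod`). The
remaining implications rescale, or complex conjugate, the second factor of a product chart. -/

theorem fderiv_apply_apply {c : E → F →L[ℝ] G} {f : E → F} {y : E}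
    (hc : DifferentiableAt ℝ c y) (hf : DifferentiableAt ℝ f y) (v : E) :
    fderiv ℝ (fun z => c z (f z)) y v = fderiv ℝ c y v (f y) + c y (fderiv ℝ f y v) := by
  rw [fderiv_clm_apply hc hf]; simp [add_comm]

theorem fderiv_apply_const {c : E → F →L[ℝ] G} {y : E}
    (hc : DifferentiableAt ℝ c y) (w : F) (v : E) :
    fderiv ℝ (fun z => c z w) y v = fderiv ℝ c y v w := by
  rw [fderiv_clm_apply hc (differentiableAt_const _)]; simp

theorem fderiv_apply₂ {b : E → F →L[ℝ] F' →L[ℝ] G} {f : E → F} {f' : E → F'} {y : E}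
    (hb : DifferentiableAt ℝ b y) (hf : DifferentiableAt ℝ f y) (hf' : DifferentiableAt ℝ f' y)
    (v : E) :
    fderiv ℝ (fun z => b z (f z) (f' z)) y v =
      fderiv ℝ b y v (f y) (f' y) + b y (fderiv ℝ f y v) (f' y) + b y (f y) (fderiv ℝ f' y v) := by
  rw [fderiv_apply_apply (hb.clm_apply hf) hf', fderiv_apply_apply hb hf]
  simp

theorem fderiv_apply₂_const {b : E → F →L[ℝ] F' →L[ℝ] G} {y : E}
    (hb : DifferentiableAt ℝ b y) (w : F) (w' : F') (v : E) :
    fderiv ℝ (fun z => b z w w') y v = fderiv ℝ b y v w w' := by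
  rw [fderiv_apply₂ hb (differentiableAt_const _) (differentiableAt_const _)]; simp

theorem fderiv_fderiv_symm {f : E → F} {y : E} (hf : ContDiffAt ℝ ∞ f y) (v w : E) :
    fderiv ℝ (fderiv ℝ f) y v w = fderiv ℝ (fderiv ℝ f) y w v :=
  (hf.isSymmSndFDerivAt (by simpa using ENat.LEInfty.out)) v w

theorem _root_.ContDiffAt.fderiv_infty {f : E → F} {y : E} (hf : ContDiffAt ℝ ∞ f y) :
    ContDiffAt ℝ ∞ (fderiv ℝ f) y :=
  hf.fderiv_right (m := ∞) (by simp)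

theorem _root_.ContDiffAt.differentiableAt_infty {f : E → F} {y : E} (hf : ContDiffAt ℝ ∞ f y) :
    DifferentiableAt ℝ f y :=
  hf.differentiableAt (by simp)

end Calculus

/-! ### Riemannian metrics on open sets and their Levi-Civita connections -/

/-- `h` is a Riemannian metric on the open set `U`. -/
structure IsMetricOn {V : Type*} [NormedAddCommGroup V] [NormedSpace ℝ V]
    (h : V → V →L[ℝ] V →L[ℝ] ℝ) (U : Set V) : Prop where
  isOpen : IsOpen U
  smooth : ContDiffOn ℝ ∞ h U
  symm : ∀ y ∈ U, ∀ v w, h y v w = h y w v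
  pos : ∀ y ∈ U, ∀ v, v ≠ 0 → 0 < h y v v

section

variable {V : Type*} [NormedAddCommGroup V] [NormedSpace ℝ V]
  {h : V → V →L[ℝ] V →L[ℝ] ℝ} {U : Set V} {y : V}

theorem IsMetricOn.mono (H : IsMetricOn h U) {U' : Set V} (hU' : IsOpen U') (hs : U' ⊆ U) :
    IsMetricOn h U' :=
  ⟨hU', H.smooth.mono hs, fun y hy => H.symm y (hs hy), fun y hy => H.pos y (hs hy)⟩

theorem IsMetricOn.contDiffAt (H : IsMetricOn h U) (hy : y ∈ U) : ContDiffAt ℝ ∞ h y :=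
  (H.smooth y hy).contDiffAt (H.isOpen.mem_nhds hy)

theorem IsMetricOn.differentiableAt (H : IsMetricOn h U) (hy : y ∈ U) : DifferentiableAt ℝ h y :=
  (H.contDiffAt hy).differentiableAt_infty

/-- Nondegeneracy, from positivity on `v - w`. Identities between vectors are proved throughout by
pairing with every `u`. -/
theorem IsMetricOn.ext_left (H : IsMetricOn h U) (hy : y ∈ U) {v w : V}
    (hvw : ∀ u, h y v u = h y w u) : v = w := by
  by_contra hne
  have := H.pos y hy (v - w) (sub_ne_zero.2 hne)
  simp only [map_sub, sub_apply] at this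
  have h1 := hvw v; have h2 := hvw w
  linarith

theorem IsMetricOn.fderiv_symm (H : IsMetricOn h U) (hy : y ∈ U) (u v w : V) :
    fderiv ℝ h y u v w = fderiv ℝ h y u w v := by
  rw [← fderiv_apply₂_const (H.differentiableAt hy), ← fderiv_apply₂_const (H.differentiableAt hy)]
  have : (fun z => h z v w) =ᶠ[𝓝 y] fun z => h z w v := by
    filter_upwards [H.isOpen.mem_nhds hy] with z hz using H.symm z hz v w
  rw [this.fderiv_eq]

theorem contDiffAt_koszul (hh : ContDiffAt ℝ ∞ h y) : ContDiffAt ℝ ∞ (koszul h) y := by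
  have hD := hh.fderiv_infty
  unfold koszul
  refine (contDiffAt_const (c := (1 / 2 : ℝ))).smul ((hD.add ?_).sub ?_)
  · exact ((ContinuousLinearMap.flipₗᵢ ℝ V V (V →L[ℝ] ℝ)).toContinuousLinearEquiv
      |>.contDiff.contDiffAt.comp y hD)
  · refine contDiffAt_const.clm_comp ?_
    exact ((ContinuousLinearMap.flipₗᵢ ℝ V V (V →L[ℝ] ℝ)).toContinuousLinearEquiv
      |>.contDiff.contDiffAt.comp y hD)

theorem curvature_antisymm (u v w : V) : curvature h y v w u = -curvature h y u w v := by
  simp only [curvature_apply]; abel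

variable [FiniteDimensional ℝ V]

/-- Positivity makes `h y` injective, and `V` and its dual have equal dimension.
`ContinuousLinearMap.inverse` has a default value off the invertible maps, so this is what gives
`christoffel` its meaning and its smoothness. -/
theorem IsMetricOn.exists_equiv (H : IsMetricOn h U) (hy : y ∈ U) :
    ∃ e : V ≃L[ℝ] (V →L[ℝ] ℝ), (e : V →L[ℝ] V →L[ℝ] ℝ) = h y := by
  have hinj : Function.Injective (h y).toLinearMap := by
    intro v w hvw
    exact H.ext_left hy fun u => congrArg (fun f : V →L[ℝ] ℝ => f u) hvw
  have hrank : Module.finrank ℝ V = Module.finrank ℝ (V →L[ℝ] ℝ) := by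
    rw [← (LinearMap.toContinuousLinearMap : (V →ₗ[ℝ] ℝ) ≃ₗ[ℝ] _).finrank_eq]
    exact (Subspace.dual_finrank_eq).symm
  refine ⟨(LinearEquiv.ofInjectiveOfFinrankEq (h y).toLinearMap hinj
    hrank).toContinuousLinearEquiv, ?_⟩
  ext v w
  rfl

theorem IsMetricOn.apply_inverse (H : IsMetricOn h U) (hy : y ∈ U) (l : V →L[ℝ] ℝ) :
    h y ((h y).inverse l) = l := by
  obtain ⟨e, he⟩ := H.exists_equiv hy
  rw [← he, ContinuousLinearMap.inverse_equiv]; simp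

theorem IsMetricOn.inverse_apply (H : IsMetricOn h U) (hy : y ∈ U) (v : V) :
    (h y).inverse (h y v) = v := by
  obtain ⟨e, he⟩ := H.exists_equiv hy
  rw [← he, ContinuousLinearMap.inverse_equiv]; simp

theorem IsMetricOn.contDiffAt_inverse (H : IsMetricOn h U) (hy : y ∈ U) :
    ContDiffAt ℝ ∞ (fun z => (h z).inverse) y := by
  obtain ⟨e, he⟩ := H.exists_equiv hy
  have := contDiffAt_map_inverse (𝕜 := ℝ) (n := ∞) e
  rw [he] at this
  exact this.comp y (H.contDiffAt hy)

theorem IsMetricOn.christoffel_spec (H : IsMetricOn h U) (hy : y ∈ U) (v w u : V) :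
    h y (christoffel h y v w) u = koszul h y v w u := by
  have : christoffel h y v w = (h y).inverse (koszul h y v w) := by simp [christoffel]
  rw [this, H.apply_inverse hy]

theorem IsMetricOn.contDiffAt_christoffel (H : IsMetricOn h U) (hy : y ∈ U) :
    ContDiffAt ℝ ∞ (christoffel h) y := by
  unfold christoffel
  refine ContDiffAt.clm_comp ?_ (contDiffAt_koszul (H.contDiffAt hy))
  exact (ContinuousLinearMap.contDiff _).contDiffAt.comp y (H.contDiffAt_inverse hy)

theorem IsMetricOn.differentiableAt_christoffel (H : IsMetricOn h U) (hy : y ∈ U) :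
    DifferentiableAt ℝ (christoffel h) y :=
  (H.contDiffAt_christoffel hy).differentiableAt_infty

theorem IsMetricOn.christoffel_symm (H : IsMetricOn h U) (hy : y ∈ U) (v w : V) :
    christoffel h y v w = christoffel h y w v := by
  refine H.ext_left hy fun u => ?_
  rw [H.christoffel_spec hy, H.christoffel_spec hy, koszul_apply, koszul_apply,
    H.fderiv_symm hy u v w]
  ring

/-- Metric compatibility `∇h = 0`: in the sum of the two Koszul expressions only the `u`-derivative
survives. -/
theorem IsMetricOn.fderiv_metric (H : IsMetricOn h U) (hy : y ∈ U) (u v w : V) :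
    fderiv ℝ h y u v w = h y (christoffel h y u v) w + h y v (christoffel h y u w) := by
  rw [H.symm y hy v, H.christoffel_spec hy, H.christoffel_spec hy, koszul_apply, koszul_apply,
    H.fderiv_symm hy u w v]
  ring

theorem IsMetricOn.fderiv_christoffel_symm (H : IsMetricOn h U) (hy : y ∈ U) (u v w : V) :
    fderiv ℝ (christoffel h) y u v w = fderiv ℝ (christoffel h) y u w v := by
  have hd := H.differentiableAt_christoffel hy
  rw [← fderiv_apply₂_const hd, ← fderiv_apply₂_const hd]
  have : (fun z => christoffel h z v w) =ᶠ[𝓝 y] fun z => christoffel h z w v := by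
    filter_upwards [H.isOpen.mem_nhds hy] with z hz using H.christoffel_symm hz v w
  rw [this.fderiv_eq]

/-- The connection is torsion-free, so the derivatives of the Christoffel symbols and the quadratic
terms cancel in pairs. -/
theorem IsMetricOn.bianchi (H : IsMetricOn h U) (hy : y ∈ U) (u v w : V) :
    curvature h y v w u + curvature h y w u v + curvature h y u v w = 0 := by
  simp only [curvature_apply]
  rw [H.fderiv_christoffel_symm hy u w v, H.fderiv_christoffel_symm hy v u w,
    H.fderiv_christoffel_symm hy w v u, H.christoffel_symm hy w v, H.christoffel_symm hy w u,
    H.christoffel_symm hy v u]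
  abel

/-- Metric compatibility is differentiated once more (`key`) and antisymmetrised in `u`, `v`. Second
derivatives of `h` commute and the products of two Christoffel symbols in separate slots of `h` are
symmetric in `u`, `v`, so only curvature remains. -/
theorem IsMetricOn.curvature_skew (H : IsMetricOn h U) (hy : y ∈ U) (u v w z : V) :
    h y (curvature h y v w u) z = -h y w (curvature h y v z u) := by
  have hd := H.differentiableAt hy
  have hΓ := H.differentiableAt_christoffel hy
  have key : ∀ u v : V, fderiv ℝ (fderiv ℝ h) y u v w z =
      h y (fderiv ℝ (christoffel h) y u v w) z + h y (christoffel h y u (christoffel h y v w)) z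
      + h y (christoffel h y v w) (christoffel h y u z)
      + (h y w (fderiv ℝ (christoffel h) y u v z) + h y w (christoffel h y u (christoffel h y v z))
      + h y (christoffel h y u w) (christoffel h y v z)) := by
    intro u v
    have hdd := (H.contDiffAt hy).fderiv_infty.differentiableAt_infty
    have e1 : fderiv ℝ (fun x => fderiv ℝ h x v w z) y u = fderiv ℝ (fderiv ℝ h) y u v w z := by
      rw [fderiv_apply₂ (hdd.clm_apply (differentiableAt_const _)) (differentiableAt_const _)
        (differentiableAt_const _), fderiv_apply_const hdd]
      simp
    have e2 : (fun x => fderiv ℝ h x v w z) =ᶠ[𝓝 y]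
        fun x => h x (christoffel h x v w) z + h x w (christoffel h x v z) := by
      filter_upwards [H.isOpen.mem_nhds hy] with x hx using H.fderiv_metric hx v w z
    have dw : ∀ w : V, DifferentiableAt ℝ (fun x => christoffel h x v w) y := fun w =>
      (hΓ.clm_apply (differentiableAt_const v)).clm_apply (differentiableAt_const w)
    have c := fun w : V => differentiableAt_const (𝕜 := ℝ) (E := V) (x := y) w
    rw [← e1, e2.fderiv_eq, fderiv_fun_add ((hd.clm_apply (dw w)).clm_apply (c z))
      ((hd.clm_apply (c w)).clm_apply (dw z)), add_apply,
      fderiv_apply₂ hd (dw w) (c z), fderiv_apply₂ hd (c w) (dw z),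
      fderiv_apply₂_const hΓ, fderiv_apply₂_const hΓ, H.fderiv_metric hy, H.fderiv_metric hy]
    simp
    ring
  have h1 := key u v
  have h2 := key v u
  rw [fderiv_fderiv_symm (H.contDiffAt hy)] at h1
  simp only [curvature_apply, map_add, map_sub, add_apply,
    sub_apply]
  linarith

theorem IsMetricOn.curvature_pair_symm (H : IsMetricOn h U) (hy : y ∈ U) (u v w z : V) :
    h y (curvature h y v w u) z = h y (curvature h y z u w) v := by
  have A : ∀ u v w z : V, h y (curvature h y v w u) z = -h y (curvature h y u w v) z := by
    intro u v w z; rw [curvature_antisymm]; simp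
  have S : ∀ u v w z : V, h y (curvature h y v w u) z = -h y (curvature h y v z u) w := by
    intro u v w z; rw [H.curvature_skew hy, H.symm y hy]
  have B : ∀ u v w z : V, h y (curvature h y v w u) z + h y (curvature h y w u v) z
      + h y (curvature h y u v w) z = 0 := by
    intro u v w z
    have := congrArg (fun x => h y x z) (H.bianchi hy u v w)
    simpa using this
  -- The octahedron argument: four Bianchi identities are added with signs and their terms matched
  -- by the two skew symmetries, whose instances are listed below.
  have b1 := B u v w z; have b2 := B v w z u; have b3 := B w z u v; have b4 := B z u v w
  have := S u v w z; have := S v w u z; have := S w u v z; have := S v w z u; have := S w z v u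
  have := S z v w u; have := S w z u v; have := S z u w v; have := S u w z v
  have := S z u v w; have := S u v z w; have := S v z u w
  have := A u v w z; have := A v w u z; have := A w u v z; have := A v w z u; have := A w z v u
  have := A z v w u; have := A w z u v; have := A z u w v; have := A u w z v
  have := A z u v w; have := A u v z w; have := A v z u w
  linarith

end

end CoordMetric

/-! ### Christoffel symbols and curvature under isometries, rescaling and products -/

namespace CoordMetric

section

variable {V W : Type*} [NormedAddCommGroup V] [NormedSpace ℝ V]
  [NormedAddCommGroup W] [NormedSpace ℝ W]
  {h : V → V →L[ℝ] V →L[ℝ] ℝ} {U : Set V} {y : V}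

theorem koszul_congr {h' : V → V →L[ℝ] V →L[ℝ] ℝ} (hh : h =ᶠ[𝓝 y] h') :
    koszul h =ᶠ[𝓝 y] koszul h' := by
  filter_upwards [hh.eventuallyEq_nhds] with z hz
  simp only [koszul, hz.fderiv_eq]

theorem christoffel_congr {h' : V → V →L[ℝ] V →L[ℝ] ℝ} (hh : h =ᶠ[𝓝 y] h') :
    christoffel h =ᶠ[𝓝 y] christoffel h' := by
  filter_upwards [hh, koszul_congr hh] with z hz hz'
  simp only [christoffel, hz, hz']

theorem curvature_congr_christoffel {h' : V → V →L[ℝ] V →L[ℝ] ℝ}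
    (hh : christoffel h =ᶠ[𝓝 y] christoffel h') : curvature h y = curvature h' y := by
  ext v w u
  simp only [curvature_apply, hh.fderiv_eq, hh.self_of_nhds]

theorem ricci_congr_christoffel [FiniteDimensional ℝ V] {h' : V → V →L[ℝ] V →L[ℝ] ℝ}
    (hh : christoffel h =ᶠ[𝓝 y] christoffel h') : ricci h y = ricci h' y := by
  ext v w
  rw [ricci_apply, ricci_apply, curvature_congr_christoffel hh]

theorem ricci_congr [FiniteDimensional ℝ V] {h' : V → V →L[ℝ] V →L[ℝ] ℝ} (hh : h =ᶠ[𝓝 y] h') :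
    ricci h y = ricci h' y :=
  ricci_congr_christoffel (christoffel_congr hh)

theorem contDiffAt_clm_apply_iff {F G : Type*} [NormedAddCommGroup F] [NormedSpace ℝ F]
    [NormedAddCommGroup G] [NormedSpace ℝ G] [FiniteDimensional ℝ V] {n : WithTop ℕ∞}
    {f : F → V →L[ℝ] G} {y : F} :
    ContDiffAt ℝ n f y ↔ ∀ v, ContDiffAt ℝ n (fun z => f z v) y := by
  refine ⟨fun h v => h.clm_apply contDiffAt_const, fun h => ?_⟩
  let d := Module.finrank ℝ V
  have hd : d = Module.finrank ℝ (Fin d → ℝ) := (Module.finrank_fin_fun ℝ).symm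
  let e₁ := ContinuousLinearEquiv.ofFinrankEq hd
  let e₂ := (e₁.arrowCongr (1 : G ≃L[ℝ] G)).trans (ContinuousLinearEquiv.piRing (Fin d))
  rw [← Function.id_comp f, ← e₂.symm_comp_self]
  exact e₂.symm.contDiff.contDiffAt.comp y (contDiffAt_pi.2 fun i => h _)

/-- A bilinear form-valued map is smooth if its values on all pairs of vectors are. -/
theorem contDiffAt_bilin_iff [FiniteDimensional ℝ V] {n : WithTop ℕ∞}
    {b : W → V →L[ℝ] V →L[ℝ] ℝ} {y : W} :
    ContDiffAt ℝ n b y ↔ ∀ v w, ContDiffAt ℝ n (fun z => b z v w) y := by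
  refine ⟨fun hb v w => (hb.clm_apply contDiffAt_const).clm_apply contDiffAt_const, fun hb => ?_⟩
  rw [contDiffAt_clm_apply_iff]
  intro v
  rw [contDiffAt_clm_apply_iff]
  exact hb v

theorem contDiffAt_ricci [FiniteDimensional ℝ V] (H : IsMetricOn h U) (hy : y ∈ U) :
    ContDiffAt ℝ ∞ (ricci h) y := by
  rw [contDiffAt_bilin_iff]
  intro v w
  have hΓ := H.contDiffAt_christoffel hy
  have hdΓ := hΓ.fderiv_infty
  have : ContDiffAt ℝ ∞ (fun z => curvature h z v w) y := by
    rw [contDiffAt_clm_apply_iff]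
    intro u
    simp only [curvature_apply]
    have c := fun u : V => contDiffAt_const (𝕜 := ℝ) (E := V) (n := ∞) (x := y) (c := u)
    have g := fun v w => (hΓ.clm_apply (c v)).clm_apply (c w)
    have g' := fun u v w => ((hdΓ.clm_apply (c u)).clm_apply (c v)).clm_apply (c w)
    exact (((g' u v w).sub (g' v u w)).add ((hΓ.clm_apply (c u)).clm_apply (g v w))).sub
      ((hΓ.clm_apply (c v)).clm_apply (g u w))
  let T : (V →L[ℝ] V) →ₗ[ℝ] ℝ :=
    (LinearMap.trace ℝ V).comp (ContinuousLinearMap.coeLM ℝ)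
  exact (LinearMap.toContinuousLinearMap T).contDiff.contDiffAt.comp y this

/-- By the Bianchi identity, `R(u, v) w = R(w, v) u - R(w, u) v`. With `B = J` this expresses the
trace of `J ∘ R(u, v)` through the Ricci tensor. -/
theorem IsMetricOn.trace_curvature [FiniteDimensional ℝ V] (H : IsMetricOn h U) (hy : y ∈ U)
    (B : V →L[ℝ] V) (u v : V) :
    LinearMap.trace ℝ V (LinearMap.comp B.toLinearMap
      ((fderiv ℝ (christoffel h) y u v - fderiv ℝ (christoffel h) y v u
        + (christoffel h y u).comp (christoffel h y v)
        - (christoffel h y v).comp (christoffel h y u)).toLinearMap)) =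
    LinearMap.trace ℝ V (B.toLinearMap.comp (curvature h y v u).toLinearMap)
      - LinearMap.trace ℝ V (B.toLinearMap.comp (curvature h y u v).toLinearMap) := by
  rw [← map_sub]
  congr 1
  ext w
  have := H.bianchi hy w u v
  rw [curvature_antisymm (h := h) (y := y) v w u] at this
  have e : curvature h y v w u = curvature h y v u w - curvature h y u v w := by
    rw [← sub_eq_zero, ← this]; abel
  simp only [LinearMap.comp_apply, LinearMap.sub_apply, ContinuousLinearMap.coe_coe, ← map_sub, ← e]
  simp [curvature_apply]

/-- The isomorphism of `V` with its dual given by `h y` conjugates `S` to the transpose of `T`. -/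
theorem IsMetricOn.trace_adjoint [FiniteDimensional ℝ V] (H : IsMetricOn h U) (hy : y ∈ U)
    {S T : V →L[ℝ] V} (hST : ∀ u z, h y (S u) z = h y u (T z)) :
    LinearMap.trace ℝ V S.toLinearMap = LinearMap.trace ℝ V T.toLinearMap := by
  obtain ⟨e, he⟩ := H.exists_equiv hy
  let e' : V ≃ₗ[ℝ] Module.Dual ℝ V :=
    e.toLinearEquiv.trans (LinearMap.toContinuousLinearMap : (V →ₗ[ℝ] ℝ) ≃ₗ[ℝ] _).symm
  have hv : ∀ v w, e' v w = h y v w := by intro v w; rw [← he]; rfl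
  have : e'.conj S.toLinearMap = Module.Dual.transpose (R := ℝ) T.toLinearMap := by
    ext l z
    obtain ⟨v, rfl⟩ := e'.surjective l
    rw [LinearEquiv.conj_apply_apply, e'.symm_apply_apply, hv]
    simp [Module.Dual.transpose_apply, hv, hST]
  rw [← LinearMap.trace_conj' _ e', this, LinearMap.trace_transpose']

/-- By the pair symmetry of the curvature, `u ↦ R(u, v) w` and `u ↦ R(u, w) v` are adjoint to each
other. -/
theorem IsMetricOn.ricci_symm [FiniteDimensional ℝ V] (H : IsMetricOn h U) (hy : y ∈ U) (v w : V) :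
    ricci h y v w = ricci h y w v := by
  refine H.trace_adjoint hy fun u z => ?_
  rw [H.curvature_pair_symm hy, H.symm y hy u, curvature_antisymm, map_neg,
    neg_apply, H.curvature_skew hy, neg_neg, H.symm y hy]

/-! ### Naturality of connection and curvature under local isometries -/

section Pullback

variable {k : W → W →L[ℝ] W →L[ℝ] ℝ} {U' : Set W} {φ : V → W}

/-- `φ` is a local isometry from `(U, h)` to `(U', k)`. -/
structure IsLocalIsometryOn (φ : V → W) (h : V → V →L[ℝ] V →L[ℝ] ℝ) (U : Set V)
    (k : W → W →L[ℝ] W →L[ℝ] ℝ) (U' : Set W) : Prop where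
  smooth : ContDiffOn ℝ ∞ φ U
  mapsTo : MapsTo φ U U'
  pullback : ∀ y ∈ U, ∀ v w, h y v w = k (φ y) (fderiv ℝ φ y v) (fderiv ℝ φ y w)
  surjective : ∀ y ∈ U, Function.Surjective (fderiv ℝ φ y)

variable [FiniteDimensional ℝ V] [FiniteDimensional ℝ W]

/-- The derivative of the pulled-back metric is inserted in the Koszul formula, and the identity is
tested against the vectors `Dφ u`, which are all of `W` by surjectivity. -/
theorem IsLocalIsometryOn.christoffel_eq (Φ : IsLocalIsometryOn φ h U k U') (H : IsMetricOn h U)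
    (K : IsMetricOn k U') (hy : y ∈ U) (v w : V) :
    fderiv ℝ φ y (christoffel h y v w) = fderiv ℝ (fderiv ℝ φ) y v w
      + christoffel k (φ y) (fderiv ℝ φ y v) (fderiv ℝ φ y w) := by
  have hy' := Φ.mapsTo hy
  have hφ : ContDiffAt ℝ ∞ φ y := (Φ.smooth y hy).contDiffAt (H.isOpen.mem_nhds hy)
  have dφ := hφ.differentiableAt_infty
  have ddφ := hφ.fderiv_infty.differentiableAt_infty
  have hD : ∀ u v w : V, fderiv ℝ h y u v w =
      fderiv ℝ k (φ y) (fderiv ℝ φ y u) (fderiv ℝ φ y v) (fderiv ℝ φ y w)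
      + k (φ y) (fderiv ℝ (fderiv ℝ φ) y u v) (fderiv ℝ φ y w)
      + k (φ y) (fderiv ℝ φ y v) (fderiv ℝ (fderiv ℝ φ) y u w) := by
    intro u v w
    have e : (fun z => h z v w) =ᶠ[𝓝 y]
        fun z => k (φ z) (fderiv ℝ φ z v) (fderiv ℝ φ z w) := by
      filter_upwards [H.isOpen.mem_nhds hy] with z hz using Φ.pullback z hz v w
    have hk : DifferentiableAt ℝ (fun z => k (φ z)) y := (K.differentiableAt hy').comp y dφ
    rw [← fderiv_apply₂_const (H.differentiableAt hy), e.fderiv_eq,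
      fderiv_apply₂ hk (ddφ.clm_apply (differentiableAt_const _))
        (ddφ.clm_apply (differentiableAt_const _)), fderiv_apply_const ddφ,
      fderiv_apply_const ddφ]
    congr 3
    have := fderiv_comp y (K.differentiableAt hy') dφ
    rw [show (fun z => k (φ z)) = k ∘ φ from rfl, this]
    simp
  refine K.ext_left hy' fun u' => ?_
  obtain ⟨u, rfl⟩ := Φ.surjective y hy u'
  rw [← Φ.pullback y hy, H.christoffel_spec hy, koszul_apply, hD, hD, hD, map_add,
    add_apply, K.christoffel_spec hy', koszul_apply, fderiv_fderiv_symm hφ u v,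
    fderiv_fderiv_symm hφ u w, fderiv_fderiv_symm hφ w v,
    K.symm _ hy' (fderiv ℝ φ y v), K.symm _ hy' (fderiv ℝ φ y w) ]
  ring

/-- Differentiating the transformation law of the Christoffel symbols and antisymmetrising in `u`,
`v` eliminates the second and third derivatives of `φ`. -/
theorem IsLocalIsometryOn.curvature_eq (Φ : IsLocalIsometryOn φ h U k U') (H : IsMetricOn h U)
    (K : IsMetricOn k U') (hy : y ∈ U) (u v w : V) :
    fderiv ℝ φ y (curvature h y v w u) =
      curvature k (φ y) (fderiv ℝ φ y v) (fderiv ℝ φ y w) (fderiv ℝ φ y u) := by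
  have hy' := Φ.mapsTo hy
  have hφ : ContDiffAt ℝ ∞ φ y := (Φ.smooth y hy).contDiffAt (H.isOpen.mem_nhds hy)
  have dφ := hφ.differentiableAt_infty
  have ddφ := hφ.fderiv_infty.differentiableAt_infty
  have d3φ := hφ.fderiv_infty.fderiv_infty.differentiableAt_infty
  have dΓ := H.differentiableAt_christoffel hy
  have dΓk := K.differentiableAt_christoffel hy'
  have c := fun w : V => differentiableAt_const (𝕜 := ℝ) (E := V) (x := y) w
  have key : ∀ u v : V, fderiv ℝ (fderiv ℝ φ) y u (christoffel h y v w)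
      + fderiv ℝ φ y (fderiv ℝ (christoffel h) y u v w) =
      fderiv ℝ (fderiv ℝ (fderiv ℝ φ)) y u v w
      + (fderiv ℝ (christoffel k) (φ y) (fderiv ℝ φ y u) (fderiv ℝ φ y v) (fderiv ℝ φ y w)
      + christoffel k (φ y) (fderiv ℝ (fderiv ℝ φ) y u v) (fderiv ℝ φ y w)
      + christoffel k (φ y) (fderiv ℝ φ y v) (fderiv ℝ (fderiv ℝ φ) y u w)) := by
    intro u v
    have e : (fun z => fderiv ℝ φ z (christoffel h z v w)) =ᶠ[𝓝 y]
        fun z => fderiv ℝ (fderiv ℝ φ) z v w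
          + christoffel k (φ z) (fderiv ℝ φ z v) (fderiv ℝ φ z w) := by
      filter_upwards [H.isOpen.mem_nhds hy] with z hz using Φ.christoffel_eq H K hz v w
    have hk : DifferentiableAt ℝ (fun z => christoffel k (φ z)) y := dΓk.comp y dφ
    have := congrArg (fun L : V →L[ℝ] W => L u) e.fderiv_eq
    rw [fderiv_apply_apply ddφ ((dΓ.clm_apply (c v)).clm_apply (c w)),
      fderiv_apply₂_const dΓ, fderiv_fun_add ((d3φ.clm_apply (c v)).clm_apply (c w))
      ((hk.clm_apply (ddφ.clm_apply (c v))).clm_apply (ddφ.clm_apply (c w))), add_apply,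
      fderiv_apply₂_const d3φ, fderiv_apply₂ hk (ddφ.clm_apply (c v)) (ddφ.clm_apply (c w)),
      fderiv_apply_const ddφ, fderiv_apply_const ddφ] at this
    rw [this, show (fun z => christoffel k (φ z)) = christoffel k ∘ φ from rfl,
      fderiv_comp y dΓk dφ]
    simp
  have k1 := eq_sub_of_add_eq' (key u v)
  have k2 := eq_sub_of_add_eq' (key v u)
  simp only [curvature_apply, map_add, map_sub, Φ.christoffel_eq H K hy, k1, k2]
  rw [fderiv_fderiv_symm hφ.fderiv_infty u v, fderiv_fderiv_symm hφ u v]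
  abel

theorem IsLocalIsometryOn.ricci_eq (Φ : IsLocalIsometryOn φ h U k U') (H : IsMetricOn h U)
    (K : IsMetricOn k U') (hy : y ∈ U) (v w : V) :
    ricci h y v w = ricci k (φ y) (fderiv ℝ φ y v) (fderiv ℝ φ y w) := by
  have hinj : Function.Injective (fderiv ℝ φ y) := by
    rw [injective_iff_map_eq_zero]
    intro v hv
    by_contra hne
    have := H.pos y hy v hne
    rw [Φ.pullback y hy, hv] at this
    simp at this
  let e : V ≃ₗ[ℝ] W := LinearEquiv.ofBijective (fderiv ℝ φ y).toLinearMap ⟨hinj, Φ.surjective y hy⟩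
  rw [ricci_apply, ricci_apply, ← LinearMap.trace_conj' _ e]
  congr 1
  ext z
  obtain ⟨u, rfl⟩ := e.surjective z
  rw [LinearEquiv.conj_apply_apply, e.symm_apply_apply]
  exact Φ.curvature_eq H K hy u v w

end Pullback

/-! ### Multiplication of a metric by a constant -/

section Scaling

theorem IsMetricOn.const_smul (H : IsMetricOn h U) {t : ℝ} (ht : 0 < t) :
    IsMetricOn (fun z => t • h z) U where
  isOpen := H.isOpen
  smooth := contDiffOn_const (c := t) |>.smul H.smooth
  symm y hy v w := by simp [H.symm y hy v w]
  pos y hy v hv := by simpa using mul_pos ht (H.pos y hy v hv)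

variable [FiniteDimensional ℝ V]

theorem IsMetricOn.christoffel_const_smul (H : IsMetricOn h U) {t : ℝ} (ht : 0 < t) (hy : y ∈ U) :
    christoffel (fun z => t • h z) y = christoffel h y := by
  ext v w
  refine H.ext_left hy fun u => ?_
  have := (H.const_smul ht).christoffel_spec hy v w u
  rw [koszul_apply, fderiv_fun_const_smul (H.differentiableAt hy)] at this
  rw [H.christoffel_spec hy, koszul_apply]
  simp only [smul_apply, smul_eq_mul] at this
  refine mul_left_cancel₀ ht.ne' ?_
  rw [this]; ring

theorem IsMetricOn.ricci_const_smul (H : IsMetricOn h U) {t : ℝ} (ht : 0 < t) (hy : y ∈ U) :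
    ricci (fun z => t • h z) y = ricci h y := by
  refine ricci_congr_christoffel ?_
  filter_upwards [H.isOpen.mem_nhds hy] with z hz using H.christoffel_const_smul ht hz

end Scaling

/-! ### Products of metrics -/

section Product

/-- The product of two metrics. -/
def prodMetric (h₁ : V → V →L[ℝ] V →L[ℝ] ℝ) (h₂ : W → W →L[ℝ] W →L[ℝ] ℝ) (z : V × W) :
    (V × W) →L[ℝ] (V × W) →L[ℝ] ℝ :=
  (h₁ z.1).bilinearComp (ContinuousLinearMap.fst ℝ V W) (ContinuousLinearMap.fst ℝ V W)
    + (h₂ z.2).bilinearComp (ContinuousLinearMap.snd ℝ V W) (ContinuousLinearMap.snd ℝ V W)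

@[simp] theorem prodMetric_apply (h₁ : V → V →L[ℝ] V →L[ℝ] ℝ) (h₂ : W → W →L[ℝ] W →L[ℝ] ℝ)
    (z v w : V × W) : prodMetric h₁ h₂ z v w = h₁ z.1 v.1 w.1 + h₂ z.2 v.2 w.2 := by
  simp [prodMetric]

variable [FiniteDimensional ℝ V] [FiniteDimensional ℝ W]
  {k : W → W →L[ℝ] W →L[ℝ] ℝ} {U' : Set W}

theorem IsMetricOn.prod (H : IsMetricOn h U) (K : IsMetricOn k U') :
    IsMetricOn (prodMetric h k) (U ×ˢ U') where
  isOpen := H.isOpen.prod K.isOpen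
  smooth z hz := by
    refine ContDiffAt.contDiffWithinAt ?_
    rw [contDiffAt_bilin_iff]
    intro v w
    simp only [prodMetric_apply]
    exact ((contDiffAt_bilin_iff.1 (H.contDiffAt hz.1) v.1 w.1).comp z contDiffAt_fst).add
      ((contDiffAt_bilin_iff.1 (K.contDiffAt hz.2) v.2 w.2).comp z contDiffAt_snd)
  symm z hz v w := by simp [H.symm _ hz.1 v.1, K.symm _ hz.2 v.2]
  pos z hz v hv := by
    rw [prodMetric_apply]
    by_cases h1 : v.1 = 0
    · have h2 : v.2 ≠ 0 := fun h2 => hv (Prod.ext h1 h2)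
      simpa [h1] using K.pos _ hz.2 _ h2
    · by_cases h2 : v.2 = 0
      · simpa [h2] using H.pos _ hz.1 _ h1
      · exact add_pos (H.pos _ hz.1 _ h1) (K.pos _ hz.2 _ h2)

theorem christoffel_prod (H : IsMetricOn h U) (K : IsMetricOn k U') {z : V × W}
    (hz : z ∈ U ×ˢ U') (v w : V × W) :
    christoffel (prodMetric h k) z v w =
      (christoffel h z.1 v.1 w.1, christoffel k z.2 v.2 w.2) := by
  have HK := H.prod K
  have hD : ∀ u v w : V × W, fderiv ℝ (prodMetric h k) z u v w =
      fderiv ℝ h z.1 u.1 v.1 w.1 + fderiv ℝ k z.2 u.2 v.2 w.2 := by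
    intro u v w
    rw [← fderiv_apply₂_const (HK.differentiableAt hz)]
    have d1 : HasFDerivAt (fun z : V × W => h z.1 v.1 w.1) _ z :=
      ((((H.differentiableAt hz.1).clm_apply (differentiableAt_const v.1)).clm_apply
        (differentiableAt_const w.1)).hasFDerivAt).comp z hasFDerivAt_fst
    have d2 : HasFDerivAt (fun z : V × W => k z.2 v.2 w.2) _ z :=
      ((((K.differentiableAt hz.2).clm_apply (differentiableAt_const v.2)).clm_apply
        (differentiableAt_const w.2)).hasFDerivAt).comp z hasFDerivAt_snd
    simp only [prodMetric_apply]
    rw [(d1.fun_add d2).fderiv]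
    simp [fderiv_apply₂_const (H.differentiableAt hz.1),
      fderiv_apply₂_const (K.differentiableAt hz.2)]
  refine HK.ext_left hz fun u => ?_
  rw [HK.christoffel_spec hz, koszul_apply, hD, hD, hD, prodMetric_apply,
    H.christoffel_spec hz.1, K.christoffel_spec hz.2, koszul_apply, koszul_apply]
  ring

theorem fderiv_christoffel_prod (H : IsMetricOn h U) (K : IsMetricOn k U') {z : V × W}
    (hz : z ∈ U ×ˢ U') (u v w : V × W) :
    fderiv ℝ (christoffel (prodMetric h k)) z u v w =
      (fderiv ℝ (christoffel h) z.1 u.1 v.1 w.1, fderiv ℝ (christoffel k) z.2 u.2 v.2 w.2) := by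
  have HK := H.prod K
  rw [← fderiv_apply₂_const (HK.differentiableAt_christoffel hz)]
  have e : (fun z => christoffel (prodMetric h k) z v w) =ᶠ[𝓝 z]
      fun z => (christoffel h z.1 v.1 w.1, christoffel k z.2 v.2 w.2) := by
    filter_upwards [HK.isOpen.mem_nhds hz] with x hx using christoffel_prod H K hx v w
  have d1 : HasFDerivAt (fun z : V × W => christoffel h z.1 v.1 w.1) _ z :=
    ((((H.differentiableAt_christoffel hz.1).clm_apply (differentiableAt_const v.1)).clm_apply
      (differentiableAt_const w.1)).hasFDerivAt).comp z hasFDerivAt_fst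
  have d2 : HasFDerivAt (fun z : V × W => christoffel k z.2 v.2 w.2) _ z :=
    ((((K.differentiableAt_christoffel hz.2).clm_apply (differentiableAt_const v.2)).clm_apply
      (differentiableAt_const w.2)).hasFDerivAt).comp z hasFDerivAt_snd
  rw [e.fderiv_eq, (d1.prodMk d2).fderiv]
  simp [fderiv_apply₂_const (H.differentiableAt_christoffel hz.1),
    fderiv_apply₂_const (K.differentiableAt_christoffel hz.2)]

theorem ricci_prod (H : IsMetricOn h U) (K : IsMetricOn k U') {z : V × W}
    (hz : z ∈ U ×ˢ U') (v w : V × W) :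
    ricci (prodMetric h k) z v w = ricci h z.1 v.1 w.1 + ricci k z.2 v.2 w.2 := by
  rw [ricci_apply, ricci_apply, ricci_apply, ← LinearMap.trace_prodMap']
  congr 1
  refine LinearMap.ext fun u => ?_
  simp [curvature_apply, fderiv_christoffel_prod H K hz, christoffel_prod H K hz]

end Product

end

end CoordMetric

/-! ### Kähler metrics in coordinates -/

namespace CoordMetric

section

variable {V : Type*} [NormedAddCommGroup V] [NormedSpace ℝ V]
  {J : V →L[ℝ] V} {h : V → V →L[ℝ] V →L[ℝ] ℝ} {U : Set V} {y : V}

/-- `h` is a Kähler metric on the open set `U` with respect to the constant complex structure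
`J`. -/
structure IsKahlerOn {V : Type*} [NormedAddCommGroup V] [NormedSpace ℝ V] (J : V →L[ℝ] V)
    (h : V → V →L[ℝ] V →L[ℝ] ℝ) (U : Set V) : Prop extends IsMetricOn h U where
  sq : ∀ v, J (J v) = -v
  hermitian : ∀ y ∈ U, ∀ v w, h y (J v) (J w) = h y v w
  closed : ∀ y ∈ U, ClosedAt (fun z => (h z).comp J) y

theorem fderiv_comp_const {b : V → V →L[ℝ] V →L[ℝ] ℝ} (hb : DifferentiableAt ℝ b y) (u v w : V) :
    fderiv ℝ (fun z => (b z).comp J) y u v w = fderiv ℝ b y u (J v) w := by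
  have hd : DifferentiableAt ℝ (fun z => (b z).comp J) y :=
    hb.clm_comp (differentiableAt_const _)
  rw [← fderiv_apply₂_const hd, ← fderiv_apply₂_const hb]
  rfl

theorem IsKahlerOn.apply_J_left (H : IsKahlerOn J h U) (hy : y ∈ U) (v w : V) :
    h y (J v) w = -h y v (J w) := by
  rw [← H.hermitian y hy v (J w), H.sq]; simp

theorem IsKahlerOn.fderiv_J_left (H : IsKahlerOn J h U) (hy : y ∈ U) (u v w : V) :
    fderiv ℝ h y u (J v) w = -fderiv ℝ h y u v (J w) := by
  have hd := H.differentiableAt hy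
  rw [← fderiv_apply₂_const hd, ← fderiv_apply₂_const hd]
  have : (fun z => h z (J v) w) =ᶠ[𝓝 y] -fun z => h z v (J w) := by
    filter_upwards [H.isOpen.mem_nhds hy] with z hz using H.apply_J_left hz v w
  rw [this.fderiv_eq, fderiv_neg, neg_apply]

theorem trace_conj_J (hJ : ∀ v, J (J v) = -v) (A : V →L[ℝ] V) :
    LinearMap.trace ℝ V (J.comp (A.comp J)).toLinearMap = -LinearMap.trace ℝ V A.toLinearMap := by
  have h1 := LinearMap.trace_mul_comm ℝ J.toLinearMap (A.comp J).toLinearMap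
  have h2 : (J.comp (A.comp J)).toLinearMap = J.toLinearMap * (A.comp J).toLinearMap := rfl
  rw [h2, h1, ← map_neg]
  congr 1
  ext v
  simp [hJ]

variable [FiniteDimensional ℝ V]

/-- As `J` is constant in these coordinates, this is `∇J = 0`. The pairing of `(∇_v J) w` with `u`
is a combination of `dω(v, w, u)` and `dω(v, Jw, Ju)`, which are `c1` and `c2`. The other instances
express the symmetry of `Dh` and its skew behaviour under `J`. -/
theorem IsKahlerOn.christoffel_J_right (H : IsKahlerOn J h U) (hy : y ∈ U) (v w : V) :
    christoffel h y v (J w) = J (christoffel h y v w) := by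
  have cl : ∀ u v w : V, fderiv ℝ h y u (J v) w + fderiv ℝ h y v (J w) u
      + fderiv ℝ h y w (J u) v = 0 := by
    intro u v w
    have := H.closed y hy u v w
    simpa only [fderiv_comp_const (H.differentiableAt hy)] using this
  refine H.ext_left hy fun u => ?_
  rw [H.apply_J_left hy, H.christoffel_spec hy, H.christoffel_spec hy, koszul_apply, koszul_apply]
  have S := H.fderiv_symm hy
  have A := H.fderiv_J_left hy
  have c1 := cl v w u
  have c2 := cl v (J w) (J u)
  rw [H.sq, H.sq] at c2
  simp only [map_neg, neg_apply] at c2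
  have := A v w u; have := A v u w; have := S v (J w) u; have := S v w (J u)
  have := S w (J u) v; have := S u (J v) w; have := A u v w; have := S u v (J w)
  have := A w u v; have := S w u (J v); have := A (J w) u v; have := A (J u) v w
  have := S (J w) u v; have := S (J u) v w; have := A v w (J u); have := S v (J w) (J u)
  have := A (J w) u (J v); have := A (J u) v (J w)
  have e1 := A (J w) (J u) v; have e2 := A (J u) (J v) w
  rw [H.sq] at e1 e2
  simp only [map_neg, neg_apply] at e1 e2
  linarith

theorem IsKahlerOn.fderiv_christoffel_J (H : IsKahlerOn J h U) (hy : y ∈ U) (u v w : V) :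
    fderiv ℝ (christoffel h) y u v (J w) = J (fderiv ℝ (christoffel h) y u v w) := by
  have hd := H.differentiableAt_christoffel hy
  have hd' : DifferentiableAt ℝ (fun z => christoffel h z v w) y :=
    (hd.clm_apply (differentiableAt_const v)).clm_apply (differentiableAt_const w)
  rw [← fderiv_apply₂_const hd, ← fderiv_apply₂_const hd]
  have : (fun z => christoffel h z v (J w)) =ᶠ[𝓝 y] fun z => J (christoffel h z v w) := by
    filter_upwards [H.isOpen.mem_nhds hy] with z hz using H.christoffel_J_right hz v w
  rw [this.fderiv_eq]
  exact congrArg (fun L : V →L[ℝ] V => L u) (J.hasFDerivAt.comp y hd'.hasFDerivAt).fderiv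

theorem IsKahlerOn.curvature_J (H : IsKahlerOn J h U) (hy : y ∈ U) (v w : V) :
    curvature h y v (J w) = J.comp (curvature h y v w) := by
  ext u
  simp [curvature_apply, H.fderiv_christoffel_J hy, H.christoffel_J_right hy]

/-- The curvature operator commutes with `J`; pair symmetry turns this into `R(Ju, Jv) = R(u, v)`.
-/
theorem IsKahlerOn.curvature_J_J (H : IsKahlerOn J h U) (hy : y ∈ U) (u v w : V) :
    curvature h y (J v) w (J u) = curvature h y v w u := by
  refine H.ext_left hy fun z => ?_
  rw [H.curvature_pair_symm hy, H.curvature_J hy, ContinuousLinearMap.comp_apply,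
    H.hermitian y hy, ← H.curvature_pair_symm hy]

theorem IsKahlerOn.ricci_J_J (H : IsKahlerOn J h U) (hy : y ∈ U) (v w : V) :
    ricci h y (J v) (J w) = ricci h y v w := by
  rw [ricci_apply, ricci_apply, H.curvature_J hy]
  have : curvature h y v w = -(J.comp ((J.comp (curvature h y (J v) w)).comp J)) := by
    ext u
    simp [H.curvature_J_J hy, H.sq]
  rw [this]
  have e := trace_conj_J H.sq (J.comp (curvature h y (J v) w))
  simp only [ContinuousLinearMap.toLinearMap_neg, map_neg, e, neg_neg]

/-! ### The Ricci form and the volume density -/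

/-- The trace of the Christoffel symbols, the logarithmic derivative of the volume density. -/
def christoffelTrace (h : V → V →L[ℝ] V →L[ℝ] ℝ) (y : V) : V →L[ℝ] ℝ :=
  (LinearMap.toContinuousLinearMap
    ((LinearMap.trace ℝ V).comp (ContinuousLinearMap.coeLM ℝ : (V →L[ℝ] V) →ₗ[ℝ] V →ₗ[ℝ] V))).comp
    (christoffel h y)

theorem christoffelTrace_apply (y v : V) :
    christoffelTrace h y v = LinearMap.trace ℝ V (christoffel h y v).toLinearMap := rfl

theorem IsMetricOn.contDiffAt_christoffelTrace (H : IsMetricOn h U) (hy : y ∈ U) :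
    ContDiffAt ℝ ∞ (christoffelTrace h) y :=
  contDiffAt_const.clm_comp (H.contDiffAt_christoffel hy)

theorem IsMetricOn.fderiv_christoffelTrace (H : IsMetricOn h U) (hy : y ∈ U) (u v : V) :
    fderiv ℝ (christoffelTrace h) y u v =
      LinearMap.trace ℝ V (fderiv ℝ (christoffel h) y u v).toLinearMap := by
  have hd := H.differentiableAt_christoffel hy
  unfold christoffelTrace
  rw [fderiv_clm_comp (differentiableAt_const _) hd]
  simp

/-- Take the trace of `J ∘ R(u, v)`. The Christoffel symbols commute with `J`, so the quadratic
terms cancel by cyclicity of the trace. In the derivative terms `J` is absorbed into an argument of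
`Γ`, by its symmetry and `J`-linearity. What remains is `d(τ ∘ J)`, with `τ` the trace of the
Christoffel symbols. This is the classical formula for the Ricci form by second derivatives of the
logarithm of the volume density. -/
theorem IsKahlerOn.ricci_J_eq (H : IsKahlerOn J h U) (hy : y ∈ U) (u v : V) :
    2 * ricci h y (J u) v =
      fderiv ℝ (christoffelTrace h) y u (J v) - fderiv ℝ (christoffelTrace h) y v (J u) := by
  have key := H.trace_curvature hy J u v
  have e1 : LinearMap.trace ℝ V (J.toLinearMap.comp (curvature h y v u).toLinearMap)
      = ricci h y v (J u) := by rw [ricci_apply, H.curvature_J hy]; rfl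
  have e2 : LinearMap.trace ℝ V (J.toLinearMap.comp (curvature h y u v).toLinearMap)
      = ricci h y u (J v) := by rw [ricci_apply, H.curvature_J hy]; rfl
  have e3 : ricci h y u (J v) = -ricci h y v (J u) := by
    rw [← H.ricci_J_J hy u (J v), H.sq, map_neg, H.ricci_symm hy]
  have e4 : ∀ u v, fderiv ℝ (christoffel h) y u (J v) =
      J.comp (fderiv ℝ (christoffel h) y u v) := by
    intro u v
    ext w
    rw [H.fderiv_christoffel_symm hy, H.fderiv_christoffel_J hy, H.fderiv_christoffel_symm hy]
    rfl
  have e5 : LinearMap.trace ℝ V (J.comp ((christoffel h y u).comp (christoffel h y v))).toLinearMap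
      = LinearMap.trace ℝ V
        (J.comp ((christoffel h y v).comp (christoffel h y u))).toLinearMap := by
    have := LinearMap.trace_mul_comm ℝ (christoffel h y u).toLinearMap
      (J.comp (christoffel h y v)).toLinearMap
    convert this using 2
    · ext w
      simp [H.christoffel_J_right hy]
    · rfl
  rw [e1, e2, e3] at key
  rw [H.ricci_symm hy, H.fderiv_christoffelTrace hy, H.fderiv_christoffelTrace hy, e4, e4]
  have : J.toLinearMap.comp ((fderiv ℝ (christoffel h) y u v - fderiv ℝ (christoffel h) y v u
        + (christoffel h y u).comp (christoffel h y v)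
        - (christoffel h y v).comp (christoffel h y u)).toLinearMap) =
      (J.comp (fderiv ℝ (christoffel h) y u v)).toLinearMap
      - (J.comp (fderiv ℝ (christoffel h) y v u)).toLinearMap
      + (J.comp ((christoffel h y u).comp (christoffel h y v))).toLinearMap
      - (J.comp ((christoffel h y v).comp (christoffel h y u))).toLinearMap := by
    ext w; simp
  rw [this, map_sub, map_add, map_sub, e5] at key
  linarith

theorem IsKahlerOn.ricci_congr_trace {h' : V → V →L[ℝ] V →L[ℝ] ℝ} (H : IsKahlerOn J h U)
    (H' : IsKahlerOn J h' U) (hy : y ∈ U)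
    (htr : ∀ z ∈ U, christoffelTrace h z = christoffelTrace h' z) : ricci h y = ricci h' y := by
  have : christoffelTrace h =ᶠ[𝓝 y] christoffelTrace h' := by
    filter_upwards [H.isOpen.mem_nhds hy] with z hz using htr z hz
  have key : ∀ u v, ricci h y (J u) v = ricci h' y (J u) v := by
    intro u v
    have h1 := H.ricci_J_eq hy u v
    rw [this.fderiv_eq, ← H'.ricci_J_eq hy u v] at h1
    linarith
  ext u v
  have := key (-J u) v
  simpa [H.sq] using this

/-- By `ricci_J_eq` the Ricci form is half the differential of `τ ∘ J`, so closedness is the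
symmetry of the second derivatives of `τ`. -/
theorem IsKahlerOn.closedAt_ricci (H : IsKahlerOn J h U) (hy : y ∈ U) :
    ClosedAt (fun z => (ricci h z).comp J) y := by
  intro u v w
  have hR := (contDiffAt_ricci H.toIsMetricOn hy).differentiableAt_infty
  have hτ := H.contDiffAt_christoffelTrace hy
  have dτ := hτ.fderiv_infty.differentiableAt_infty
  have key : ∀ u v w, 2 * fderiv ℝ (ricci h) y u (J v) w =
      fderiv ℝ (fderiv ℝ (christoffelTrace h)) y u v (J w)
      - fderiv ℝ (fderiv ℝ (christoffelTrace h)) y u w (J v) := by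
    intro u v w
    have e : (fun z => 2 * ricci h z (J v) w) =ᶠ[𝓝 y] fun z =>
        fderiv ℝ (christoffelTrace h) z v (J w) - fderiv ℝ (christoffelTrace h) z w (J v) := by
      filter_upwards [H.isOpen.mem_nhds hy] with z hz using H.ricci_J_eq hz v w
    have c := fun w : V => differentiableAt_const (𝕜 := ℝ) (E := V) (x := y) w
    have := congrArg (fun L : V →L[ℝ] ℝ => L u) e.fderiv_eq
    rw [fderiv_const_mul ((hR.clm_apply (c _)).clm_apply (c _)),
      fderiv_fun_sub ((dτ.clm_apply (c _)).clm_apply (c _))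
        ((dτ.clm_apply (c _)).clm_apply (c _)), sub_apply, smul_apply,
      fderiv_apply₂_const hR, fderiv_apply₂_const dτ, fderiv_apply₂_const dτ] at this
    exact this
  simp only [fderiv_comp_const hR]
  have k1 := key u v w; have k2 := key v w u; have k3 := key w u v
  rw [fderiv_fderiv_symm hτ u v] at k1
  rw [fderiv_fderiv_symm hτ v w] at k2
  rw [fderiv_fderiv_symm hτ w u] at k3
  linarith

/-- The operator `S = h⁻¹ D_v h` is the sum of `Γ(v, ·)` and its adjoint by metric compatibility,
and the adjoint has the same trace. -/
theorem IsMetricOn.two_mul_christoffelTrace (H : IsMetricOn h U) (hy : y ∈ U) (v : V)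
    {S : V →L[ℝ] V} (hS : ∀ w u, h y (S w) u = fderiv ℝ h y v w u) :
    LinearMap.trace ℝ V S.toLinearMap = 2 * christoffelTrace h y v := by
  have : LinearMap.trace ℝ V (S - christoffel h y v).toLinearMap =
      LinearMap.trace ℝ V (christoffel h y v).toLinearMap := by
    refine H.trace_adjoint hy fun u z => ?_
    rw [sub_apply, map_sub, sub_apply, hS, H.fderiv_metric hy]
    ring
  rw [ContinuousLinearMap.toLinearMap_sub, map_sub] at this
  rw [christoffelTrace_apply]
  linarith

/-- The determinant of `h'` is that of `h` times a power of `t` whose exponent is the rank of `p`,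
so the logarithmic derivatives agree. The argument is run on traces of `h⁻¹ Dh` instead of on
determinants. -/
theorem IsMetricOn.christoffelTrace_rescale {h' : V → V →L[ℝ] V →L[ℝ] ℝ} (H : IsMetricOn h U)
    (H' : IsMetricOn h' U) {p : V → V →L[ℝ] V} (hp : DifferentiableAt ℝ p y)
    (hpp : ∀ z ∈ U, ∀ v, p z (p z v) = p z v) {t : ℝ} (ht : t ≠ 0)
    (hh' : ∀ z ∈ U, ∀ v w, h' z v w = h z v (w + (t - 1) • p z w)) (hy : y ∈ U) :
    christoffelTrace h y = christoffelTrace h' y := by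
  have hd := H.differentiableAt hy
  have c := fun w : V => differentiableAt_const (𝕜 := ℝ) (E := V) (x := y) w
  ext v
  let S := ((h y).inverse).comp (fderiv ℝ h y v)
  let S' := ((h' y).inverse).comp (fderiv ℝ h' y v)
  have hS : ∀ w u, h y (S w) u = fderiv ℝ h y v w u := by
    intro w u; simp [S, H.apply_inverse hy]
  have hS' : ∀ w u, h' y (S' w) u = fderiv ℝ h' y v w u := by
    intro w u; simp [S', H'.apply_inverse hy]
  -- Differentiating `p² = p` gives `qp + pq = q`, hence `pqp = 0`. By cyclicity of the trace both
  -- `qp` and `q` are then traceless.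
  let q := fderiv ℝ p y v
  have hq : ∀ w, q (p y w) + p y (q w) = q w := by
    intro w
    have e : (fun z => p z (p z w)) =ᶠ[𝓝 y] fun z => p z w := by
      filter_upwards [H.isOpen.mem_nhds hy] with z hz using hpp z hz w
    have := congrArg (fun L : V →L[ℝ] V => L v) e.fderiv_eq
    rwa [fderiv_apply_apply hp (hp.clm_apply (c w)), fderiv_apply_const hp] at this
  have hpqp : ∀ w, p y (q (p y w)) = 0 := by
    intro w
    have := congrArg (p y) (hq w)
    rw [map_add, hpp y hy] at this
    simpa using this
  have hD : ∀ w u, fderiv ℝ h' y v w u =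
      fderiv ℝ h y v w (u + (t - 1) • p y u) + (t - 1) * h y w (q u) := by
    intro w u
    have e : (fun z => h' z w u) =ᶠ[𝓝 y] fun z => h z w (u + (t - 1) • p z u) := by
      filter_upwards [H.isOpen.mem_nhds hy] with z hz using hh' z hz w u
    have dpu : DifferentiableAt ℝ (fun z => p z u) y := hp.clm_apply (c u)
    rw [← fderiv_apply₂_const (H'.differentiableAt hy), e.fderiv_eq,
      fderiv_apply₂ hd (c w) ((c u).fun_add (dpu.fun_const_smul _)), fderiv_const_add,
      fderiv_fun_const_smul dpu, smul_apply, fderiv_apply_const hp]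
    simp [q]
  have htr : LinearMap.trace ℝ V (S' - S).toLinearMap =
      LinearMap.trace ℝ V ((t - 1) • (q.comp (ContinuousLinearMap.id ℝ V +
        (t⁻¹ - 1) • p y))).toLinearMap := by
    refine H.trace_adjoint hy fun w u => ?_
    -- The inverse of `1 + (t - 1) p` is `1 + (t⁻¹ - 1) p`; pairing with `u'` in `h'` is pairing
    -- with `u` in `h`.
    let u' := u + (t⁻¹ - 1) • p y u
    have hu' : u' + (t - 1) • p y u' = u := by
      simp only [u', map_add, map_smul, hpp y hy, smul_add, smul_smul]
      have : (t⁻¹ - 1) + ((t - 1) + (t - 1) * (t⁻¹ - 1)) = 0 := by field_simp; ring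
      rw [add_assoc, ← add_smul, ← add_smul, this, zero_smul, add_zero]
    have h1 := hS' w u'
    rw [hh' y hy, hD, hu'] at h1
    rw [sub_apply, map_sub, sub_apply, h1, hS]
    simp [u']
    ring
  have hq0 : LinearMap.trace ℝ V (q.comp (p y)).toLinearMap = 0 := by
    have h1 := LinearMap.trace_mul_comm ℝ (q.comp (p y)).toLinearMap (p y).toLinearMap
    have h2 : (q.comp (p y)).toLinearMap * (p y).toLinearMap = (q.comp (p y)).toLinearMap := by
      ext w; simp [hpp y hy]
    have h3 : (p y).toLinearMap * (q.comp (p y)).toLinearMap = 0 := by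
      ext w; simp [hpqp]
    rw [← h2, h1, h3, map_zero]
  have hq1 : LinearMap.trace ℝ V q.toLinearMap = 0 := by
    have h1 : q.toLinearMap = q.toLinearMap * (p y).toLinearMap
        + (p y).toLinearMap * q.toLinearMap := by
      ext w; simp [hq]
    have h2 : LinearMap.trace ℝ V (q.toLinearMap * (p y).toLinearMap) = 0 := hq0
    rw [h1, map_add, ← LinearMap.trace_mul_comm ℝ q.toLinearMap, h2, add_zero]
  have hz : LinearMap.trace ℝ V ((t - 1) • (q.comp (ContinuousLinearMap.id ℝ V +
        (t⁻¹ - 1) • p y))).toLinearMap = 0 := by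
    have : ((t - 1) • (q.comp (ContinuousLinearMap.id ℝ V + (t⁻¹ - 1) • p y))).toLinearMap =
        (t - 1) • (q.toLinearMap + (t⁻¹ - 1) • (q.comp (p y)).toLinearMap) := by
      ext w; simp
    rw [this, map_smul, map_add, map_smul, hq0, hq1]; simp
  rw [hz, ContinuousLinearMap.toLinearMap_sub, map_sub, H.two_mul_christoffelTrace hy v hS,
    H'.two_mul_christoffelTrace hy v hS'] at htr
  linarith

/-- The Ricci tensor of a Kähler metric does not change when the metric is rescaled by constant
factors on the two summands of a decomposition of the tangent bundle, provided that the new metric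
is Kähler. -/
theorem IsKahlerOn.ricci_rescale {h' : V → V →L[ℝ] V →L[ℝ] ℝ} (H : IsKahlerOn J h U)
    (H' : IsKahlerOn J h' U) {p : V → V →L[ℝ] V} (hp : ∀ z ∈ U, DifferentiableAt ℝ p z)
    (hpp : ∀ z ∈ U, ∀ v, p z (p z v) = p z v) {t : ℝ} (ht : t ≠ 0)
    (hh' : ∀ z ∈ U, ∀ v w, h' z v w = h z v (w + (t - 1) • p z w)) (hy : y ∈ U) :
    ricci h y = ricci h' y :=
  H.ricci_congr_trace H' hy fun z hz =>
    H.christoffelTrace_rescale H'.toIsMetricOn (hp z hz) hpp ht hh' hz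

end

end CoordMetric

section

open scoped unitInterval

/-! ### Local inverses of smooth maps -/

/-- The inverse function theorem with its source shrunk to the open set where the derivative is
invertible, so that the inverse is smooth on the whole target. The spaces may be
infinite-dimensional, as is needed for curves. -/
theorem exists_openPartialHomeomorph_of_contDiffOn {X Y : Type*} [NormedAddCommGroup X]
    [NormedSpace ℝ X] [CompleteSpace X] [NormedAddCommGroup Y] [NormedSpace ℝ Y]
    {f : X → Y} {S : Set X} {x : X} (hS : IsOpen S) (hx : x ∈ S) (hf : ContDiffOn ℝ ∞ f S)
    (e : X ≃L[ℝ] Y) (he : fderiv ℝ f x = e) :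
    ∃ Φ : OpenPartialHomeomorph X Y, x ∈ Φ.source ∧ Φ.source ⊆ S ∧ ⇑Φ = f ∧
      ContDiffOn ℝ ∞ Φ.symm Φ.target ∧
      ∀ x' ∈ Φ.source, ∃ e' : X ≃L[ℝ] Y, fderiv ℝ f x' = e' := by
  have hfx : ∀ x' ∈ S, ContDiffAt ℝ ∞ f x' := fun x' h => (hf x' h).contDiffAt (hS.mem_nhds h)
  have hfx' : HasFDerivAt f (e : X →L[ℝ] Y) x := by
    rw [← he]; exact (hfx x hx).differentiableAt_infty.hasFDerivAt
  let Φ₀ := (hfx x hx).toOpenPartialHomeomorph f hfx' (by simp)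
  let T := S ∩ (fderiv ℝ f) ⁻¹' (range ((↑) : (X ≃L[ℝ] Y) → X →L[ℝ] Y))
  have hT : IsOpen T :=
    ContinuousOn.isOpen_inter_preimage
      (fun x' h => (hfx x' h).fderiv_infty.continuousAt.continuousWithinAt)
      hS (ContinuousLinearEquiv.isOpen)
  have hxT : x ∈ T := ⟨hx, e, he.symm⟩
  have hco : ⇑Φ₀ = f := (hfx x hx).toOpenPartialHomeomorph_coe hfx' (by simp)
  refine ⟨Φ₀.restrOpen T hT, ⟨(hfx x hx).mem_toOpenPartialHomeomorph_source hfx' (by simp), hxT⟩,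
    fun x' h => h.2.1, hco, ?_, fun x' h => ?_⟩
  · intro y hy
    have hy' := (Φ₀.restrOpen T hT).map_target hy
    obtain ⟨e', he'⟩ := hy'.2.2
    refine ContDiffAt.contDiffWithinAt ?_
    refine (Φ₀.restrOpen T hT).contDiffAt_symm (f₀' := e') hy ?_ ?_
    · have : ⇑(Φ₀.restrOpen T hT) = f := hco
      rw [this, he']; exact (hfx _ hy'.2.1).differentiableAt_infty.hasFDerivAt
    · have : ⇑(Φ₀.restrOpen T hT) = f := hco
      rw [this]; exact hfx _ hy'.2.1
  · obtain ⟨e', he'⟩ := h.2.2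
    exact ⟨e', he'.symm⟩

/-! ### Superposition operators on spaces of curves -/

namespace CurveSpace

variable {E F : Type} [NormedAddCommGroup E] [NormedSpace ℝ E]
  [NormedAddCommGroup F] [NormedSpace ℝ F]

/-- Pointwise application of a curve of linear maps to a curve of vectors. -/
def pointwiseApply (E F : Type) [NormedAddCommGroup E] [NormedSpace ℝ E]
    [NormedAddCommGroup F] [NormedSpace ℝ F] : C(I, E →L[ℝ] F) →L[ℝ] C(I, E) →L[ℝ] C(I, F) :=
  LinearMap.mkContinuous₂
    (LinearMap.mk₂ ℝ (fun (A : C(I, E →L[ℝ] F)) (c : C(I, E)) =>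
        (⟨fun t => A t (c t), A.continuous.clm_apply c.continuous⟩ : C(I, F)))
      (fun A A' c => by ext t; simp) (fun r A c => by ext t; simp)
      (fun A c c' => by ext t; simp) (fun r A c => by ext t; simp)) 1 (fun A c => by
        rw [one_mul]
        refine (ContinuousMap.norm_le _ (by positivity)).2 fun t => ?_
        exact (A t).le_of_opNorm_le_of_le (A.norm_coe_le_norm t) (c.norm_coe_le_norm t))

@[simp] theorem pointwiseApply_apply (A : C(I, E →L[ℝ] F)) (c : C(I, E)) (t : I) :
    pointwiseApply E F A c t = A t (c t) := rfl

/-- The mean value inequality on each segment from `c t` to `c t + η t` gives the error bound. It is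
uniform in `t` because `c ↦ f' ∘ c` is continuous for the supremum norm. -/
theorem hasFDerivAt_comp (f : C(E, F)) (f' : C(E, E →L[ℝ] F)) (hf : ∀ x, HasFDerivAt f (f' x) x)
    (c : C(I, E)) :
    HasFDerivAt (fun c : C(I, E) => f.comp c) (pointwiseApply E F (f'.comp c)) c := by
  rw [hasFDerivAt_iff_isLittleO_nhds_zero, Asymptotics.isLittleO_iff]
  intro ε hε
  have hcont : ContinuousAt (fun c : C(I, E) => f'.comp c) c :=
    (ContinuousMap.continuous_postcomp f').continuousAt
  obtain ⟨δ, hδ, hd⟩ := Metric.continuousAt_iff.1 hcont ε hε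
  filter_upwards [Metric.ball_mem_nhds (0 : C(I, E)) hδ] with η hη
  rw [mem_ball_zero_iff] at hη
  refine (ContinuousMap.norm_le _ (by positivity)).2 fun t => ?_
  have key : ‖f (c t + η t) - f (c t) - f' (c t) (c t + η t - c t)‖ ≤
      ε * ‖c t + η t - c t‖ := by
    refine (convex_segment (c t) (c t + η t)).norm_image_sub_le_of_norm_hasFDerivWithin_le'
      (fun x _ => (hf x).hasFDerivWithinAt) ?_ (left_mem_segment ℝ _ _) (right_mem_segment ℝ _ _)
    intro x hx
    rw [segment_eq_image'] at hx
    obtain ⟨s, hs, rfl⟩ := hx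
    have h1 : dist (c + s • η) c < δ := by
      rw [dist_eq_norm, add_sub_cancel_left, norm_smul, Real.norm_of_nonneg hs.1]
      exact (mul_le_of_le_one_left (norm_nonneg _) hs.2).trans_lt hη
    have h2 := (ContinuousMap.dist_apply_le_dist t).trans (hd h1).le
    rw [dist_eq_norm] at h2
    simpa using h2
  rw [add_sub_cancel_left] at key
  refine key.trans ?_
  gcongr
  exact η.norm_coe_le_norm t

/-- The derivative of a superposition operator is the superposition operator of `fderiv ℝ f`
followed by a bounded linear map. The induction lets `F` vary, since `fderiv ℝ f` takes values in `E
→L[ℝ] F`. -/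
theorem contDiff_comp_nat (n : ℕ) : ∀ {F : Type} [NormedAddCommGroup F] [NormedSpace ℝ F]
    (f : C(E, F)), ContDiff ℝ ∞ f → ContDiff ℝ n (fun c : C(I, E) => f.comp c) := by
  induction n with
  | zero =>
    intro F _ _ f _
    exact contDiff_zero.2 (ContinuousMap.continuous_postcomp f)
  | succ n ih =>
    intro F _ _ f hf
    have hf' : ContDiff ℝ ∞ (fderiv ℝ f) := hf.fderiv_right (by simp)
    let f' : C(E, E →L[ℝ] F) := ⟨fderiv ℝ f, hf'.continuous⟩
    have hd := hasFDerivAt_comp f f' fun x =>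
      (hf.differentiable (by simp) x).hasFDerivAt
    push_cast
    refine (contDiff_succ_iff_hasFDerivAt (n := n)).2 ⟨_, ?_, hd⟩
    exact (pointwiseApply E F).contDiff.comp (ih f' hf')

theorem contDiff_comp (f : C(E, F)) (hf : ContDiff ℝ ∞ f) :
    ContDiff ℝ ∞ (fun c : C(I, E) => f.comp c) :=
  contDiff_infty.2 fun n => contDiff_comp_nat n f hf

/-- The primitive of a curve, vanishing at `0`. -/
def primitive (E : Type) [NormedAddCommGroup E] [NormedSpace ℝ E] [CompleteSpace E] :
    C(I, E) →L[ℝ] C(I, E) :=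
  LinearMap.mkContinuous
    { toFun := fun c => ⟨fun t => ∫ s in (0 : ℝ)..t, c (projIcc 0 1 zero_le_one s),
        (intervalIntegral.continuous_primitive (fun a b =>
          (c.continuous.comp continuous_projIcc).intervalIntegrable a b) 0).comp
          continuous_subtype_val⟩
      map_add' := fun c c' => by
        ext t
        exact intervalIntegral.integral_add
          ((c.continuous.comp continuous_projIcc).intervalIntegrable _ _)
          ((c'.continuous.comp continuous_projIcc).intervalIntegrable _ _)
      map_smul' := fun r c => by
        ext t
        exact intervalIntegral.integral_smul r _ } 1 (fun c => by
      rw [one_mul]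
      refine (ContinuousMap.norm_le _ (norm_nonneg _)).2 fun t => ?_
      refine (intervalIntegral.norm_integral_le_of_norm_le_const
        (fun s _ => c.norm_coe_le_norm _)).trans ?_
      rw [sub_zero, abs_of_nonneg t.2.1]
      exact mul_le_of_le_one_right (norm_nonneg _) t.2.2)

theorem primitive_apply [CompleteSpace E] (c : C(I, E)) (t : I) :
    primitive E c t = ∫ s in (0 : ℝ)..t, c (projIcc 0 1 zero_le_one s) := rfl

theorem primitive_map [CompleteSpace E] [CompleteSpace F] (L : E →L[ℝ] F) (c : C(I, E)) :
    primitive F ((L : C(E, F)).comp c) = (L : C(E, F)).comp (primitive E c) := by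
  ext t
  simp only [primitive_apply, ContinuousMap.comp_apply]
  exact L.intervalIntegral_comp_comm ((c.continuous.comp continuous_projIcc).intervalIntegrable _ _)

/-- The linear map from vectors to constant curves. -/
def constCurve (E : Type) [NormedAddCommGroup E] [NormedSpace ℝ E] : E →L[ℝ] C(I, E) :=
  ContinuousLinearMap.const ℝ I

end CurveSpace

/-! ### Curves along the leaves: a differential equation with parameters -/

namespace CurveSpace

section Leaf

variable {E : Type} [NormedAddCommGroup E] [NormedSpace ℝ E] [CompleteSpace E]

/-- The defect of the curve `c` from being the solution of `c' = P(c) z`, `c(0) = a`. -/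
def leafDefect (P : C(E, E →L[ℝ] E)) (x : E × E × C(I, E)) : C(I, E) :=
  x.2.2 - constCurve E x.1
    - primitive E (pointwiseApply E E (P.comp x.2.2) (constCurve E x.2.1))

/-- The derivative of `leafDefect`. -/
def leafDefectDeriv (P : C(E, E →L[ℝ] E)) (P' : C(E, E →L[ℝ] E →L[ℝ] E)) (x : E × E × C(I, E)) :
    E × E × C(I, E) →L[ℝ] C(I, E) :=
  let pr₁ := ContinuousLinearMap.fst ℝ E (E × C(I, E))
  let pr₂ := (ContinuousLinearMap.fst ℝ E C(I, E)).comp (ContinuousLinearMap.snd ℝ E (E × C(I, E)))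
  let pr₃ := (ContinuousLinearMap.snd ℝ E C(I, E)).comp (ContinuousLinearMap.snd ℝ E (E × C(I, E)))
  pr₃ - (constCurve E).comp pr₁ - (primitive E).comp
    ((pointwiseApply E E (P.comp x.2.2)).comp ((constCurve E).comp pr₂) +
      ((pointwiseApply E E).flip (constCurve E x.2.1)).comp
        ((pointwiseApply E (E →L[ℝ] E) (P'.comp x.2.2)).comp pr₃))

theorem leafDefectDeriv_apply (P : C(E, E →L[ℝ] E)) (P' : C(E, E →L[ℝ] E →L[ℝ] E))
    (x u : E × E × C(I, E)) : leafDefectDeriv P P' x u =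
      u.2.2 - constCurve E u.1 - primitive E (pointwiseApply E E (P.comp x.2.2) (constCurve E u.2.1)
        + pointwiseApply E E (pointwiseApply E (E →L[ℝ] E) (P'.comp x.2.2) u.2.2)
            (constCurve E x.2.1)) := by
  simp [leafDefectDeriv]

theorem hasFDerivAt_leafDefect (P : C(E, E →L[ℝ] E)) (P' : C(E, E →L[ℝ] E →L[ℝ] E))
    (hP : ∀ x, HasFDerivAt P (P' x) x) (x : E × E × C(I, E)) :
    HasFDerivAt (leafDefect P) (leafDefectDeriv P P' x) x := by
  have h1 : HasFDerivAt (𝕜 := ℝ) (fun x : E × E × C(I, E) => x.1) _ x := hasFDerivAt_fst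
  have h2 : HasFDerivAt (𝕜 := ℝ) (fun x : E × E × C(I, E) => x.2.1) _ x :=
    (hasFDerivAt_fst (𝕜 := ℝ) (p := x.2)).comp x hasFDerivAt_snd
  have h3 : HasFDerivAt (𝕜 := ℝ) (fun x : E × E × C(I, E) => x.2.2) _ x :=
    (hasFDerivAt_snd (𝕜 := ℝ) (p := x.2)).comp x hasFDerivAt_snd
  have hN := (hasFDerivAt_comp P P' hP x.2.2).comp x h3
  have hA := ((pointwiseApply E E).hasFDerivAt.comp x hN).clm_apply
    ((constCurve E).hasFDerivAt.comp x h2)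
  exact (h3.sub ((constCurve E).hasFDerivAt.comp x h1)).sub ((primitive E).hasFDerivAt.comp x hA)

theorem contDiff_leafDefect (P : C(E, E →L[ℝ] E)) (hP : ContDiff ℝ ∞ P) :
    ContDiff ℝ ∞ (leafDefect P) := by
  have h1 : ContDiff ℝ ∞ (fun x : E × E × C(I, E) => x.1) := contDiff_fst
  have h2 : ContDiff ℝ ∞ (fun x : E × E × C(I, E) => x.2.1) := contDiff_fst.comp contDiff_snd
  have h3 : ContDiff ℝ ∞ (fun x : E × E × C(I, E) => x.2.2) := contDiff_snd.comp contDiff_snd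
  have hN := (contDiff_comp P hP).comp h3
  exact (h3.sub ((constCurve E).contDiff.comp h1)).sub ((primitive E).contDiff.comp
    (((pointwiseApply E E).contDiff.comp hN).clm_apply ((constCurve E).contDiff.comp h2)))

theorem leafDefect_eq_zero_iff (P : C(E, E →L[ℝ] E)) (a z : E) (c : C(I, E)) :
    leafDefect P (a, z, c) = 0 ↔
      ∀ t : I, c t = a + ∫ s in (0 : ℝ)..t, P (c (projIcc 0 1 zero_le_one s)) z := by
  rw [ContinuousMap.ext_iff]
  refine forall_congr' fun t => ?_
  have : leafDefect P (a, z, c) t =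
      c t - a - ∫ s in (0 : ℝ)..t, P (c (projIcc 0 1 zero_le_one s)) z := rfl
  rw [this, ContinuousMap.zero_apply, sub_sub, sub_eq_zero]

/-- If `c` solves the equation for `z`, then `s ↦ c (t s)` solves it for `t • z`, by substitution in
the integral. Together with uniqueness this makes the solution at time `1` for `t • z` the solution
at time `t` for `z`. -/
theorem leafDefect_scale (P : C(E, E →L[ℝ] E)) (a z : E) (c : C(I, E))
    (hc : leafDefect P (a, z, c) = 0) (t : I) :
    leafDefect P (a, (t : ℝ) • z, c.comp ⟨fun s => t * s, by fun_prop⟩) = 0 := by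
  rw [leafDefect_eq_zero_iff] at hc ⊢
  intro s
  have h1 := hc (t * s)
  simp only [ContinuousMap.comp_apply, ContinuousMap.coe_mk, map_smul]
  rw [h1, intervalIntegral.integral_smul]
  congr 1
  have h2 := intervalIntegral.smul_integral_comp_mul_left (a := 0) (b := s)
    (fun τ => P (c (projIcc 0 1 zero_le_one τ)) z) (t : ℝ)
  rw [mul_zero] at h2
  rw [Icc.coe_mul, ← h2]
  congr 1
  refine intervalIntegral.integral_congr fun τ hτ => ?_
  rw [uIcc_of_le s.2.1] at hτ
  have hτ' : τ ∈ Icc (0 : ℝ) 1 := ⟨hτ.1, hτ.2.trans s.2.2⟩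
  have hτt : (t : ℝ) * τ ∈ Icc (0 : ℝ) 1 :=
    ⟨mul_nonneg t.2.1 hτ'.1, mul_le_one₀ t.2.2 hτ'.1 hτ'.2⟩
  rw [projIcc_of_mem _ hτ', projIcc_of_mem _ hτt]
  rfl

/-- Along a curve where `P` is `J`-linear and depends holomorphically on the point, the linearised
equation is `J`-linear, since integration commutes with `J`. This makes the flow holomorphic. -/
theorem leafDefectDeriv_J (P : C(E, E →L[ℝ] E)) (P' : C(E, E →L[ℝ] E →L[ℝ] E)) {J : E →L[ℝ] E}
    (x u : E × E × C(I, E)) (h1 : ∀ t v, P (x.2.2 t) (J v) = J (P (x.2.2 t) v))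
    (h2 : ∀ t v w, P' (x.2.2 t) (J v) w = J (P' (x.2.2 t) v w)) :
    leafDefectDeriv P P' x (J u.1, J u.2.1, (J : C(E, E)).comp u.2.2) =
      (J : C(E, E)).comp (leafDefectDeriv P P' x u) := by
  rw [leafDefectDeriv_apply, leafDefectDeriv_apply]
  have : pointwiseApply E E (P.comp x.2.2) (constCurve E (J u.2.1))
        + pointwiseApply E E (pointwiseApply E (E →L[ℝ] E) (P'.comp x.2.2)
          ((J : C(E, E)).comp u.2.2)) (constCurve E x.2.1) =
      (J : C(E, E)).comp (pointwiseApply E E (P.comp x.2.2) (constCurve E u.2.1)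
        + pointwiseApply E E (pointwiseApply E (E →L[ℝ] E) (P'.comp x.2.2) u.2.2)
            (constCurve E x.2.1)) := by
    ext t
    simp [constCurve, h1, h2]
  simp only [this, primitive_map]
  ext t
  simp [constCurve]

/-- Smooth dependence on the initial value `a` and on `z` of the solutions of `c' = P(c) z`,
`c(0) = a` at time `1`. -/
theorem exists_leaf_flow (P : C(E, E →L[ℝ] E)) (hP : ContDiff ℝ ∞ P) (J : E →L[ℝ] E)
    {N : Set E} (hN : IsOpen N) {y₀ : E} (hy₀ : y₀ ∈ N)
    (h1 : ∀ y ∈ N, ∀ v, P y (J v) = J (P y v))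
    (h2 : ∀ y ∈ N, ∀ v w, fderiv ℝ P y (J v) w = J (fderiv ℝ P y v w)) :
    ∃ Ψ : E × E → E, ∃ r > 0, ContDiffOn ℝ ∞ Ψ (Metric.ball (y₀, 0) r) ∧
      (∀ x ∈ Metric.ball (y₀, 0) r, Ψ x ∈ N ∧ fderiv ℝ Ψ x (0, x.2) = P (Ψ x) x.2 ∧
        (∀ u, fderiv ℝ Ψ x (J u.1, J u.2) = J (fderiv ℝ Ψ x u)) ∧ Ψ (x.1, 0) = x.1) ∧
      ∀ u, fderiv ℝ Ψ (y₀, 0) u = u.1 + P y₀ u.2 := by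
  let P' : C(E, E →L[ℝ] E →L[ℝ] E) := ⟨fderiv ℝ P, (hP.fderiv_right (m := ∞) (by simp)).continuous⟩
  have hP' : ∀ x, HasFDerivAt P (P' x) x := fun x => (hP.differentiable (by simp) x).hasFDerivAt
  -- Adjoining the parameters to the defect turns the implicit function theorem for `c` into the
  -- inverse function theorem for `Θ`.
  let Θ : E × E × C(I, E) → E × E × C(I, E) := fun x => (x.1, x.2.1, leafDefect P x)
  have hΘ : ContDiff ℝ ∞ Θ :=
    contDiff_fst.prodMk ((contDiff_fst.comp contDiff_snd).prodMk (contDiff_leafDefect P hP))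
  have hΘ' : ∀ x u, fderiv ℝ Θ x u = (u.1, u.2.1, leafDefectDeriv P P' x u) := by
    intro x u
    have h1 : HasFDerivAt (𝕜 := ℝ) (fun x : E × E × C(I, E) => x.1) _ x := hasFDerivAt_fst
    have h2 : HasFDerivAt (𝕜 := ℝ) (fun x : E × E × C(I, E) => x.2.1) _ x :=
      (hasFDerivAt_fst (𝕜 := ℝ) (p := x.2)).comp x hasFDerivAt_snd
    rw [(h1.prodMk (h2.prodMk (hasFDerivAt_leafDefect P P' hP' x))).fderiv]
    rfl
  let x₀ : E × E × C(I, E) := (y₀, 0, constCurve E y₀)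
  have hdefect₀ : ∀ a : E, leafDefect P (a, 0, constCurve E a) = 0 := by
    intro a
    rw [leafDefect_eq_zero_iff]
    intro t
    simp [constCurve]
  -- At the base point `z = 0`, which kills the term with the derivative of `P`. So `A` does not
  -- involve the curve component, the derivative of `Θ` is unipotent, and its inverse is obtained by
  -- changing the sign of `A`.
  let A : E × E × C(I, E) →L[ℝ] C(I, E) :=
    (constCurve E).comp (ContinuousLinearMap.fst ℝ E (E × C(I, E))) +
      (primitive E).comp ((pointwiseApply E E (P.comp x₀.2.2)).comp ((constCurve E).comp
        ((ContinuousLinearMap.fst ℝ E C(I, E)).comp (ContinuousLinearMap.snd ℝ E (E × C(I, E))))))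
  have hA : ∀ u : E × E × C(I, E), leafDefectDeriv P P' x₀ u = u.2.2 - A u := by
    intro u
    rw [leafDefectDeriv_apply]
    simp [x₀, A, sub_sub]
  let pr₁ := ContinuousLinearMap.fst ℝ E (E × C(I, E))
  let pr₂ := (ContinuousLinearMap.fst ℝ E C(I, E)).comp (ContinuousLinearMap.snd ℝ E (E × C(I, E)))
  let pr₃ := (ContinuousLinearMap.snd ℝ E C(I, E)).comp (ContinuousLinearMap.snd ℝ E (E × C(I, E)))
  have hA' : ∀ (a z : E) (c c' : C(I, E)), A (a, z, c) = A (a, z, c') := fun a z c c' => rfl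
  let e : (E × E × C(I, E)) ≃L[ℝ] (E × E × C(I, E)) :=
    ContinuousLinearEquiv.equivOfInverse (pr₁.prod (pr₂.prod (pr₃ - A)))
      (pr₁.prod (pr₂.prod (pr₃ + A)))
      (fun u => by
        refine Prod.ext rfl (Prod.ext rfl ?_)
        change u.2.2 - A u + A (u.1, u.2.1, u.2.2 - A u) = u.2.2
        rw [hA' u.1 u.2.1 (u.2.2 - A u) u.2.2]
        exact sub_add_cancel _ _)
      (fun u => by
        refine Prod.ext rfl (Prod.ext rfl ?_)
        change u.2.2 + A u - A (u.1, u.2.1, u.2.2 + A u) = u.2.2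
        rw [hA' u.1 u.2.1 (u.2.2 + A u) u.2.2]
        exact add_sub_cancel_right _ _)
  have he : fderiv ℝ Θ x₀ = e := by
    refine ContinuousLinearMap.ext fun u => ?_
    rw [hΘ', hA]
    rfl
  obtain ⟨Φ, hxΦ, -, hΦ, hΦs, hΦe⟩ :=
    exists_openPartialHomeomorph_of_contDiffOn isOpen_univ (mem_univ x₀) hΘ.contDiffOn e he
  have hΘx₀ : Θ x₀ = (y₀, 0, 0) := by
    simp only [Θ, x₀, hdefect₀]
  obtain ⟨ρ, hρ, hρs⟩ := Metric.mem_nhds_iff.1 (Φ.open_source.mem_nhds hxΦ)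
  obtain ⟨ρ', hρ', hρN⟩ := Metric.mem_nhds_iff.1 (hN.mem_nhds hy₀)
  let W := Φ.symm.source ∩ Φ.symm ⁻¹' (Metric.ball x₀ (min ρ ρ'))
  have hW : IsOpen W := Φ.symm.isOpen_inter_preimage Metric.isOpen_ball
  have hx₀W : (y₀, 0, 0) ∈ W := by
    have h1 : Φ x₀ = (y₀, 0, 0) := by rw [hΦ, hΘx₀]
    refine ⟨h1 ▸ Φ.map_source hxΦ, ?_⟩
    rw [mem_preimage, ← h1, Φ.left_inv hxΦ]
    exact Metric.mem_ball_self (lt_min hρ hρ')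
  let ι : E × E → E × E × C(I, E) := fun x => (x.1, x.2, 0)
  have hι : ContDiff ℝ ∞ ι := contDiff_fst.prodMk (contDiff_snd.prodMk contDiff_const)
  have hιW : ι ⁻¹' W ∈ 𝓝 (y₀, (0 : E)) := hι.continuous.continuousAt (hW.mem_nhds hx₀W)
  obtain ⟨r, hr, hrW⟩ := Metric.mem_nhds_iff.1 hιW
  let r' := min r (min ρ ρ')
  have hr' : 0 < r' := lt_min hr (lt_min hρ hρ')
  let B := Metric.ball (y₀, (0 : E)) r'
  have hBW : ∀ x ∈ B, ι x ∈ W := fun x hx => hrW (Metric.ball_subset_ball (min_le_left _ _) hx)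
  let C : E × E → C(I, E) := fun x => (Φ.symm (ι x)).2.2
  have hsymm : ∀ x ∈ B, Φ.symm (ι x) = (x.1, x.2, C x) ∧ leafDefect P (x.1, x.2, C x) = 0 := by
    intro x hx
    have h3 := Φ.right_inv (hBW x hx).1
    rw [hΦ] at h3
    have e1 : (Φ.symm (ι x)).1 = x.1 := congrArg (fun q : E × E × C(I, E) => q.1) h3
    have e2 : (Φ.symm (ι x)).2.1 = x.2 := congrArg (fun q : E × E × C(I, E) => q.2.1) h3
    have e3 : leafDefect P (Φ.symm (ι x)) = 0 := congrArg (fun q : E × E × C(I, E) => q.2.2) h3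
    have e4 : Φ.symm (ι x) = (x.1, x.2, C x) := Prod.ext e1 (Prod.ext e2 rfl)
    exact ⟨e4, e4 ▸ e3⟩
  have hmem : ∀ x ∈ B, ∀ t, dist (C x t) y₀ < min ρ ρ' := by
    intro x hx t
    have := (hBW x hx).2
    rw [mem_preimage, (hsymm x hx).1, Metric.mem_ball, Prod.dist_eq, Prod.dist_eq] at this
    exact (ContinuousMap.dist_apply_le_dist (f := C x) (g := constCurve E y₀) t).trans_lt
      ((le_max_right _ _).trans_lt ((le_max_right _ _).trans_lt this))
  -- Uniqueness among curves close to `y₀` comes from the injectivity of `Φ` on its source.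
  have huniq : ∀ x ∈ B, ∀ c : C(I, E), (∀ t, dist (c t) y₀ < min ρ ρ') →
      leafDefect P (x.1, x.2, c) = 0 → C x = c := by
    intro x hx c hc hdc
    have hx' := Metric.mem_ball.1 hx
    rw [Prod.dist_eq, max_lt_iff] at hx'
    have hcs : (x.1, x.2, c) ∈ Φ.source := by
      apply hρs
      rw [Metric.mem_ball, Prod.dist_eq, Prod.dist_eq]
      refine max_lt (hx'.1.trans_le ((min_le_right _ _).trans (min_le_left _ _)))
        (max_lt (hx'.2.trans_le ((min_le_right _ _).trans (min_le_left _ _))) ?_)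
      refine (ContinuousMap.dist_lt_iff hρ).2 fun t => (hc t).trans_le (min_le_left _ _)
    have h3 : Φ (x.1, x.2, c) = ι x := by
      rw [hΦ]; simp only [Θ, hdc, ι]
    have h4 := Φ.left_inv hcs
    rw [h3, (hsymm x hx).1] at h4
    exact congrArg (fun q : E × E × C(I, E) => q.2.2) h4
  have hscale : ∀ x ∈ B, ∀ t : I, (x.1, (t : ℝ) • x.2) ∈ B := by
    intro x hx t
    have hx' := Metric.mem_ball.1 hx
    rw [Prod.dist_eq, max_lt_iff, dist_zero_right] at hx'
    refine Metric.mem_ball.2 ?_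
    rw [Prod.dist_eq, max_lt_iff, dist_zero_right, norm_smul, Real.norm_of_nonneg t.2.1]
    exact ⟨hx'.1, (mul_le_of_le_one_left (norm_nonneg _) t.2.2).trans_lt hx'.2⟩
  have hCs : ∀ x ∈ B, ContDiffAt ℝ ∞ C x := by
    intro x hx
    have h3 : ContDiffAt ℝ ∞ Φ.symm (ι x) :=
      (hΦs _ (hBW x hx).1).contDiffAt (Φ.open_target.mem_nhds (hBW x hx).1)
    have h4 := h3.comp x hι.contDiffAt
    exact (contDiff_snd.comp contDiff_snd).contDiffAt.comp x h4
  let ev : C(I, E) →L[ℝ] E := ContinuousMap.evalCLM ℝ (1 : I)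
  have hCderiv : ∀ x ∈ B, ∀ u : E × E,
      leafDefectDeriv P P' (x.1, x.2, C x) (u.1, u.2, fderiv ℝ C x u) = 0 := by
    intro x hx u
    have h3 : (fun x : E × E => leafDefect P (x.1, x.2, C x)) =ᶠ[𝓝 x] fun _ => 0 := by
      filter_upwards [Metric.isOpen_ball.mem_nhds hx] with x hx using (hsymm x hx).2
    have h4 : HasFDerivAt (fun x : E × E => (x.1, x.2, C x)) _ x :=
      hasFDerivAt_fst.prodMk (hasFDerivAt_snd.prodMk (hCs x hx).differentiableAt_infty.hasFDerivAt)
    have h5 := (hasFDerivAt_leafDefect P P' hP' (x.1, x.2, C x)).comp x h4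
    have h6 := h5.fderiv
    rw [show leafDefect P ∘ (fun x : E × E => (x.1, x.2, C x)) =
      fun x : E × E => leafDefect P (x.1, x.2, C x) from rfl, h3.fderiv_eq,
      fderiv_const_apply] at h6
    exact (congrArg (fun L : E × E →L[ℝ] C(I, E) => L u) h6).symm
  have hΨ : ∀ x ∈ B, HasFDerivAt (fun x => C x 1) (ev.comp (fderiv ℝ C x)) x := fun x hx =>
    ev.hasFDerivAt.comp x (hCs x hx).differentiableAt_infty.hasFDerivAt
  refine ⟨fun x => C x 1, r', hr', fun x hx =>
    (ev.contDiff.contDiffAt.comp x (hCs x hx)).contDiffWithinAt, fun x hx => ⟨?_, ?_, ?_, ?_⟩, ?_⟩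
  · exact hρN ((hmem x hx 1).trans_le (min_le_right _ _))
  -- Scaling and uniqueness show that `t ↦ Ψ (a, t • z)` is the solution curve itself. Its velocity
  -- at `t = 1` is therefore the value of `P` on `z`.
  · have hray : ∀ t : I, C (x.1, (t : ℝ) • x.2) 1 = C x t := by
      intro t
      have := huniq _ (hscale x hx t) ((C x).comp ⟨fun s => t * s, by fun_prop⟩)
        (fun s => hmem x hx _) (leafDefect_scale P _ _ _ (hsymm x hx).2 t)
      rw [this]
      simp
    have h3 : HasDerivAt (fun t : ℝ => C (x.1, t • x.2) 1)
        (fderiv ℝ (fun x => C x 1) x (0, x.2)) 1 := by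
      have h4 : HasDerivAt (fun t : ℝ => (x.1, t • x.2)) (0, x.2) 1 := by
        have := (hasDerivAt_const (1 : ℝ) x.1).prodMk ((hasDerivAt_id (1 : ℝ)).smul_const x.2)
        simpa using this
      have h5 : HasFDerivAt (fun x => C x 1) (fderiv ℝ (fun x => C x 1) x)
          (x.1, (1 : ℝ) • x.2) := by
        rw [one_smul]; exact (hΨ x hx).differentiableAt.hasFDerivAt
      exact h5.comp_hasDerivAt 1 h4
    have h6 : HasDerivAt
        (fun t : ℝ => x.1 + ∫ s in (0 : ℝ)..t, P (C x (projIcc 0 1 zero_le_one s)) x.2)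
        (P (C x (projIcc 0 1 zero_le_one (1 : ℝ))) x.2) 1 := by
      have hc : Continuous fun s : ℝ => P (C x (projIcc 0 1 zero_le_one s)) x.2 :=
        (P.continuous.comp ((C x).continuous.comp continuous_projIcc)).clm_apply continuous_const
      exact (hc.integral_hasStrictDerivAt 0 1).hasDerivAt.const_add _
    -- The curve is defined on `[0, 1]` only, so the two derivatives are compared within the
    -- interval, at its endpoint `1`.
    have h7 := (uniqueDiffOn_Icc_zero_one (1 : ℝ) (right_mem_Icc.2 zero_le_one)).eq_deriv _
      h3.hasDerivWithinAt
      (h6.hasDerivWithinAt.congr (f₁ := fun t : ℝ => C (x.1, t • x.2) 1) (s := Icc 0 1)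
        (fun t ht => by
          have := (leafDefect_eq_zero_iff P _ _ _).1 (hsymm x hx).2 ⟨t, ht⟩
          rw [← this]; exact hray ⟨t, ht⟩)
        (by
          have := (leafDefect_eq_zero_iff P _ _ _).1 (hsymm x hx).2 1
          have h8 := hray 1
          rw [this] at h8
          exact h8))
    rw [h7, projIcc_right]
    rfl
  · intro u
    rw [(hΨ x hx).fderiv]
    have h3 := leafDefectDeriv_J P P' (J := J) (x.1, x.2, C x) (u.1, u.2, fderiv ℝ C x u)
      (fun t v => h1 _ (hρN ((hmem x hx t).trans_le (min_le_right _ _))) v)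
      (fun t v w => h2 _ (hρN ((hmem x hx t).trans_le (min_le_right _ _))) v w)
    rw [hCderiv x hx] at h3
    have h4 := hCderiv x hx (J u.1, J u.2)
    have hsrc : (x.1, x.2, C x) ∈ Φ.source := by
      rw [← (hsymm x hx).1]; exact Φ.map_target (hBW x hx).1
    obtain ⟨e', he'⟩ := hΦe _ hsrc
    -- Both curves solve the same linearised equation with parameters `J u.1`, `J u.2`, and the
    -- invertible derivative of `Θ` admits only one solution.
    have h5 : fderiv ℝ Θ (x.1, x.2, C x) (J u.1, J u.2, fderiv ℝ C x (J u.1, J u.2)) =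
        fderiv ℝ Θ (x.1, x.2, C x) (J u.1, J u.2, (J : C(E, E)).comp (fderiv ℝ C x u)) := by
      rw [hΘ', hΘ', h4]
      refine Prod.ext rfl (Prod.ext rfl ?_)
      simp only
      rw [h3]
      ext t; simp
    rw [he'] at h5
    have h6 := e'.injective h5
    have h7 : fderiv ℝ C x (J u.1, J u.2) = (J : C(E, E)).comp (fderiv ℝ C x u) :=
      congrArg (fun q : E × E × C(I, E) => q.2.2) h6
    change fderiv ℝ C x (J u.1, J u.2) 1 = J (fderiv ℝ C x u 1)
    rw [h7]; rfl
  · have hx0 : (x.1, (0 : E)) ∈ B := by simpa using hscale x hx 0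
    have := huniq _ hx0 (constCurve E x.1) (fun t => ?_) (hdefect₀ _)
    · change C (x.1, 0) 1 = x.1
      rw [this]; simp [constCurve]
    · have hx' := Metric.mem_ball.1 hx
      rw [Prod.dist_eq, max_lt_iff] at hx'
      exact hx'.1.trans_le (min_le_right _ _)
  · intro u
    have hx : (y₀, (0 : E)) ∈ B := Metric.mem_ball_self hr'
    rw [(hΨ _ hx).fderiv]
    have hC : C (y₀, 0) = constCurve E y₀ :=
      huniq _ hx _ (fun t => by simpa [constCurve] using ⟨hρ, hρ'⟩) (hdefect₀ y₀)
    have h3 := hCderiv _ hx u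
    rw [hC, hA, sub_eq_zero] at h3
    change fderiv ℝ C (y₀, 0) u 1 = _
    have h4 : fderiv ℝ C (y₀, 0) u = _ := h3
    rw [h4]
    change u.1 + primitive E _ 1 = _
    rw [primitive_apply]
    simp [x₀, constCurve]

end Leaf

end CurveSpace

end

/-! ### Pullbacks and complex coordinates -/

namespace CoordMetric

section Pullback

variable {V W : Type*} [NormedAddCommGroup V] [NormedSpace ℝ V]
  [NormedAddCommGroup W] [NormedSpace ℝ W]

/-- The pullback of a field of bilinear forms. -/
def pullback (f : V → W) (b : W → W →L[ℝ] W →L[ℝ] ℝ) (x : V) : V →L[ℝ] V →L[ℝ] ℝ :=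
  (b (f x)).bilinearComp (fderiv ℝ f x) (fderiv ℝ f x)

@[simp] theorem pullback_apply (f : V → W) (b : W → W →L[ℝ] W →L[ℝ] ℝ) (x u v : V) :
    pullback f b x u v = b (f x) (fderiv ℝ f x u) (fderiv ℝ f x v) := rfl

theorem contDiffAt_pullback {f : V → W} {b : W → W →L[ℝ] W →L[ℝ] ℝ} {x : V}
    [FiniteDimensional ℝ V] (hf : ContDiffAt ℝ ∞ f x) (hb : ContDiffAt ℝ ∞ b (f x)) :
    ContDiffAt ℝ ∞ (pullback f b) x := by
  rw [contDiffAt_bilin_iff]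
  intro v w
  exact ((hb.comp x hf).clm_apply (hf.fderiv_infty.clm_apply contDiffAt_const)).clm_apply
    (hf.fderiv_infty.clm_apply contDiffAt_const)

theorem fderiv_pullback {f : V → W} {b : W → W →L[ℝ] W →L[ℝ] ℝ} {x : V}
    [FiniteDimensional ℝ V] (hf : ContDiffAt ℝ ∞ f x) (hb : ContDiffAt ℝ ∞ b (f x)) (u v w : V) :
    fderiv ℝ (pullback f b) x u v w =
      fderiv ℝ b (f x) (fderiv ℝ f x u) (fderiv ℝ f x v) (fderiv ℝ f x w)
      + b (f x) (fderiv ℝ (fderiv ℝ f) x u v) (fderiv ℝ f x w)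
      + b (f x) (fderiv ℝ f x v) (fderiv ℝ (fderiv ℝ f) x u w) := by
  have df := hf.differentiableAt_infty
  have ddf := hf.fderiv_infty.differentiableAt_infty
  have db := hb.differentiableAt_infty
  have c := fun w : V => differentiableAt_const (𝕜 := ℝ) (E := V) (x := x) w
  have dbf : DifferentiableAt ℝ (fun z => b (f z)) x := db.comp x df
  rw [← fderiv_apply₂_const (contDiffAt_pullback hf hb).differentiableAt_infty]
  simp only [pullback_apply]
  rw [fderiv_apply₂ dbf (ddf.clm_apply (c v)) (ddf.clm_apply (c w)), fderiv_apply_const ddf,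
    fderiv_apply_const ddf]
  congr 3
  rw [show (fun z => b (f z)) = b ∘ f from rfl, fderiv_comp x db df]
  rfl

/-- Second derivatives of `f` are symmetric and `b` is antisymmetric, so the terms containing them
cancel in the cyclic sum. -/
theorem ClosedAt.pullback {f : V → W} {b : W → W →L[ℝ] W →L[ℝ] ℝ} {x : V}
    [FiniteDimensional ℝ V] (hf : ContDiffAt ℝ ∞ f x) (hb : ContDiffAt ℝ ∞ b (f x))
    (hanti : ∀ v w, b (f x) v w = -b (f x) w v) (hc : ClosedAt b (f x)) :
    ClosedAt (pullback f b) x := by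
  intro u v w
  rw [fderiv_pullback hf hb, fderiv_pullback hf hb, fderiv_pullback hf hb,
    fderiv_fderiv_symm hf v u, fderiv_fderiv_symm hf w u, fderiv_fderiv_symm hf w v,
    hanti (fderiv ℝ f x v) (fderiv ℝ (fderiv ℝ f) x u w),
    hanti (fderiv ℝ f x w) (fderiv ℝ (fderiv ℝ f) x u v),
    hanti (fderiv ℝ f x u) (fderiv ℝ (fderiv ℝ f) x v w)]
  have := hc (fderiv ℝ f x u) (fderiv ℝ f x v) (fderiv ℝ f x w)
  linarith

theorem ClosedAt.congr {b b' : V → V →L[ℝ] V →L[ℝ] ℝ} {x : V} (hc : ClosedAt b x)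
    (h : b =ᶠ[𝓝 x] b') : ClosedAt b' x := by
  intro u v w
  rw [← h.fderiv_eq]
  exact hc u v w

end Pullback

/-- A cut-off by a bump function. Superposition operators act on curves in all of `E`, so the field
of projections has to be extended beyond `U`. -/
theorem exists_contDiff_eqOn {E F : Type*} [NormedAddCommGroup E] [NormedSpace ℝ E]
    [FiniteDimensional ℝ E] [NormedAddCommGroup F] [NormedSpace ℝ F] {f : E → F} {U : Set E}
    (hU : IsOpen U) {y₀ : E} (hy₀ : y₀ ∈ U) (hf : ContDiffOn ℝ ∞ f U) :
    ∃ g : E → F, ContDiff ℝ ∞ g ∧ ∃ N ⊆ U, IsOpen N ∧ y₀ ∈ N ∧ EqOn g f N := by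
  obtain ⟨r, hr, hrU⟩ := Metric.mem_nhds_iff.1 (hU.mem_nhds hy₀)
  let φ : ContDiffBump y₀ := ⟨r / 4, r / 2, by positivity, by linarith⟩
  refine ⟨fun x => φ x • f x, ?_, Metric.ball y₀ (r / 4),
    (Metric.ball_subset_ball (by linarith)).trans hrU, Metric.isOpen_ball,
    Metric.mem_ball_self (by positivity), fun x hx => ?_⟩
  · rw [contDiff_iff_contDiffAt]
    intro x
    by_cases hx : x ∈ U
    · exact φ.contDiff.contDiffAt.smul ((hf x hx).contDiffAt (hU.mem_nhds hx))
    · have hx' : x ∉ tsupport φ := by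
        rw [φ.tsupport_eq]
        intro h
        exact hx (hrU (Metric.closedBall_subset_ball (by simp [φ]; linarith) h))
      have : (fun x => φ x • f x) =ᶠ[𝓝 x] fun _ => 0 := by
        filter_upwards [(isClosed_tsupport φ).isOpen_compl.mem_nhds hx'] with z hz
        rw [image_eq_zero_of_notMem_tsupport hz, zero_smul]
      exact contDiffAt_const.congr_of_eventuallyEq this
  · have : φ x = 1 := φ.one_of_mem_closedBall (Metric.ball_subset_closedBall hx)
    simp [this]

/-- A closed 2-form whose contraction with the radial field of a decomposition `E = ker q ⊕ range q`
vanishes is the pullback of its restriction to `ker q`. -/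
theorem apply_eq_of_radial {E : Type*} [NormedAddCommGroup E] [NormedSpace ℝ E]
    {S : Set E} (hS : IsOpen S) {σ : E → E →L[ℝ] E →L[ℝ] ℝ} (hσ : ContDiffOn ℝ ∞ σ S)
    (hanti : ∀ x ∈ S, ∀ u v, σ x u v = -σ x v u) (hc : ∀ x ∈ S, ClosedAt σ x)
    {q : E →L[ℝ] E} (hq : ∀ v, q (q v) = q v)
    (hstar : ∀ x ∈ S, ∀ t ∈ Icc (0 : ℝ) 1, x - q x + t • q x ∈ S)
    (hrad : ∀ x ∈ S, ∀ v, σ x (q x) v = 0) {x : E} (hx : x ∈ S) (u v : E) :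
    σ x u v = σ (x - q x) (u - q u) (v - q v) := by
  let δ : ℝ → E → E := fun t w => w - q w + t • q w
  have hδq : ∀ t w, q (δ t w) = t • q w := by intro t w; simp [δ, hq]
  have hδ : ∀ t w, HasDerivAt (fun t => δ t w) (q w) t := by
    intro t w
    have := ((hasDerivAt_id t).smul_const (q w)).const_add (w - q w)
    rw [one_smul] at this
    exact this
  have hσd : ∀ z ∈ S, DifferentiableAt ℝ σ z := fun z hz =>
    ((hσ z hz).contDiffAt (hS.mem_nhds hz)).differentiableAt_infty
  have hrad' : ∀ z ∈ S, ∀ a b, fderiv ℝ σ z a (q z) b = -σ z (q a) b := by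
    intro z hz a b
    have e : (fun z => σ z (q z) b) =ᶠ[𝓝 z] fun _ => 0 := by
      filter_upwards [hS.mem_nhds hz] with z hz using hrad z hz b
    have := congrArg (fun L : E →L[ℝ] ℝ => L a) e.fderiv_eq
    rw [fderiv_apply₂ (hσd z hz) q.differentiableAt (differentiableAt_const b)] at this
    simp at this
    linarith
  -- The pullback of `σ` under the contraction `δ t`, where `δ 1` is the identity and `δ 0 = 1 - q`.
  -- It is constant in `t` by Cartan's formula, as `dσ` and the contraction with the radial field
  -- both vanish.
  let s : ℝ → ℝ := fun t => σ (δ t x) (δ t u) (δ t v)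
  have hs : ∀ t ∈ Icc (0 : ℝ) 1, HasDerivAt s (fderiv ℝ σ (δ t x) (q x) (δ t u) (δ t v)
      + σ (δ t x) (q u) (δ t v) + σ (δ t x) (δ t u) (q v)) t := by
    intro t ht
    have h1 := (hσd _ (hstar x hx t ht)).hasFDerivAt.comp_hasDerivAt t (hδ t x)
    have h2 := (h1.clm_apply (hδ t u)).clm_apply (hδ t v)
    simpa using h2
  have hs0 : ∀ t ∈ Ioo (0 : ℝ) 1, HasDerivAt s 0 t := by
    intro t ht
    have ht' : t ∈ Icc (0 : ℝ) 1 := ⟨ht.1.le, ht.2.le⟩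
    have hz := hstar x hx t ht'
    convert! hs t ht' using 1
    -- The radial vector at `δ t x` is `t` times the velocity `q x`. Closedness therefore gives `t
    -- s'(t) = 0`, which settles `t > 0`; the mean value theorem needs the derivative only on the
    -- open interval.
    have h1 := hc _ hz (q (δ t x)) (δ t u) (δ t v)
    have h2 : fderiv ℝ σ (δ t x) (δ t u) (δ t v) (q (δ t x)) =
        -fderiv ℝ σ (δ t x) (δ t u) (q (δ t x)) (δ t v) := by
      have hd := hσd _ hz
      have e : (fun z => σ z (δ t v) (q (δ t x))) =ᶠ[𝓝 (δ t x)]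
          fun z => -σ z (q (δ t x)) (δ t v) := by
        filter_upwards [hS.mem_nhds hz] with z hz using hanti z hz _ _
      rw [← fderiv_apply₂_const hd, ← fderiv_apply₂_const hd, e.fderiv_eq, fderiv_fun_neg,
        neg_apply]
    rw [h2, hrad' _ hz, hrad' _ hz, hδq, hδq, hδq] at h1
    simp only [map_smul, smul_apply, smul_eq_mul, neg_neg] at h1
    rw [hanti _ hz (q v) (δ t u)] at h1
    have h3 : t * (fderiv ℝ σ (δ t x) (q x) (δ t u) (δ t v)
      + σ (δ t x) (q u) (δ t v) + σ (δ t x) (δ t u) (q v)) = 0 := by linarith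
    exact ((mul_eq_zero.1 h3).resolve_left ht.1.ne').symm
  obtain ⟨c, hc, hc'⟩ := exists_hasDerivAt_eq_slope s (fun _ => 0) zero_lt_one
    (fun t ht => (hs t ht).continuousAt.continuousWithinAt) hs0
  have : s 1 = s 0 := by simp at hc'; linarith
  simpa [s, δ] using this

/-- The leaves of a holomorphic foliation, given as the kernel of a closed 2-form, are locally the
fibers of a holomorphic submersion. -/
theorem exists_holomorphic_first_integral {E : Type} [NormedAddCommGroup E] [NormedSpace ℝ E]
    [FiniteDimensional ℝ E] (J : E →L[ℝ] E) {U : Set E} (hU : IsOpen U) {y₀ : E} (hy₀ : y₀ ∈ U)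
    {p : E → E →L[ℝ] E} (hp : ContDiffOn ℝ ∞ p U) (hpp : ∀ y ∈ U, ∀ v, p y (p y v) = p y v)
    (hpJ : ∀ y ∈ U, ∀ v, p y (J v) = J (p y v))
    (hDp : ∀ y ∈ U, ∀ v w, fderiv ℝ p y (J v) w = J (fderiv ℝ p y v w))
    {β : E → E →L[ℝ] E →L[ℝ] ℝ} (hβ : ContDiffOn ℝ ∞ β U)
    (hanti : ∀ y ∈ U, ∀ v w, β y v w = -β y w v) (hclosed : ∀ y ∈ U, ClosedAt β y)
    (hker : ∀ y ∈ U, ∀ v, β y v = 0 ↔ p y v = v) :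
    ∃ N ⊆ U, IsOpen N ∧ y₀ ∈ N ∧ ∃ π : E → E, ContDiffOn ℝ ∞ π N ∧
      (∀ y ∈ N, (∀ v, fderiv ℝ π y v = 0 ↔ p y v = v) ∧
        (∀ v, fderiv ℝ π y (J v) = J (fderiv ℝ π y v)) ∧ ∀ v, p y₀ (fderiv ℝ π y v) = 0) ∧
      ∀ v, fderiv ℝ π y₀ v = v - p y₀ v := by
  obtain ⟨P, hP, N₁, hN₁U, hN₁, hyN₁, hPp⟩ := exists_contDiff_eqOn hU hy₀ hp
  let q := p y₀
  have hq : ∀ v, q (q v) = q v := hpp y₀ hy₀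
  have hqJ : ∀ v, q (J v) = J (q v) := hpJ y₀ hy₀
  -- A nonzero `w` with `q w = 0` and `P y w = w` would give `‖(P y - q) w‖ = ‖w‖`. Within distance
  -- `1` of `q` the image of `P y` thus meets `ker q` trivially.
  let N₂ := N₁ ∩ P ⁻¹' (Metric.ball q 1)
  have hN₂ : IsOpen N₂ := hN₁.inter (Metric.isOpen_ball.preimage hP.continuous)
  have hyN₂ : y₀ ∈ N₂ := ⟨hyN₁, by rw [mem_preimage, hPp hyN₁]; exact Metric.mem_ball_self one_pos⟩
  have hPe : ∀ y ∈ N₂, P y = p y := fun y hy => hPp hy.1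
  have hN₂U : N₂ ⊆ U := fun y hy => hN₁U hy.1
  obtain ⟨Ψ, r, hr, hΨs, hΨ, hΨ0⟩ := CurveSpace.exists_leaf_flow ⟨P, hP.continuous⟩ hP J hN₂ hyN₂
    (fun y hy v => by simp only [ContinuousMap.coe_mk, hPe y hy]; exact hpJ y (hN₂U hy) v)
    (fun y hy v w => by
      have e : P =ᶠ[𝓝 y] p := by
        filter_upwards [hN₂.mem_nhds hy] with z hz using hPe z hz
      simp only [ContinuousMap.coe_mk, e.fderiv_eq]; exact hDp y (hN₂U hy) v w)
  simp only [ContinuousMap.coe_mk] at hΨ hΨ0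
  -- The component of `x` in `ker q` gives the starting point on the transversal, the component in
  -- the image of `q` the direction in which a leaf is followed.
  let κ : E → E × E := fun x => (y₀ + (x - q x), q x)
  let κ' : E →L[ℝ] E × E := (ContinuousLinearMap.id ℝ E - q).prod q
  have hκ : ∀ x, HasFDerivAt κ κ' x := fun x =>
    ((ContinuousLinearMap.id ℝ E - q).hasFDerivAt.const_add y₀).prodMk q.hasFDerivAt
  have hκs : ContDiff ℝ ∞ κ :=
    (contDiff_const.add (contDiff_id.sub q.contDiff)).prodMk q.contDiff
  let S := fun ρ : ℝ => κ ⁻¹' Metric.ball (y₀, 0) ρ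
  have hSo : ∀ ρ, IsOpen (S ρ) := fun ρ => Metric.isOpen_ball.preimage hκs.continuous
  have hS : ∀ ρ x, x ∈ S ρ ↔ ‖x - q x‖ < ρ ∧ ‖q x‖ < ρ := by
    intro ρ x
    simp only [S, mem_preimage, Metric.mem_ball, Prod.dist_eq, max_lt_iff, κ, dist_zero_right,
      dist_self_add_left]
  have hstar : ∀ ρ, ∀ x ∈ S ρ, ∀ t ∈ Icc (0 : ℝ) 1, x - q x + t • q x ∈ S ρ := by
    intro ρ x hx t ht
    rw [hS] at hx ⊢
    have : q (x - q x + t • q x) = t • q x := by simp [hq]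
    rw [this, add_sub_cancel_right, norm_smul, Real.norm_of_nonneg ht.1]
    exact ⟨hx.1, (mul_le_of_le_one_left (norm_nonneg _) ht.2).trans_lt hx.2⟩
  let Ξ : E → E := fun x => Ψ (κ x)
  have hΞs : ContDiffOn ℝ ∞ Ξ (S r) := hΨs.comp hκs.contDiffOn (fun x hx => hx)
  have hΞd : ∀ x ∈ S r, ∀ u, fderiv ℝ Ξ x u = fderiv ℝ Ψ (κ x) (u - q u, q u) := by
    intro x hx u
    have h1 : DifferentiableAt ℝ Ψ (κ x) :=
      ((hΨs _ hx).contDiffAt (Metric.isOpen_ball.mem_nhds hx)).differentiableAt_infty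
    have h2 : HasFDerivAt Ξ _ x := h1.hasFDerivAt.comp x (hκ x)
    rw [h2.fderiv]
    rfl
  have h0r : ∀ ρ > 0, (0 : E) ∈ S ρ := by
    intro ρ hρ; rw [hS]; simpa using hρ
  have hκ0 : κ 0 = (y₀, 0) := by simp [κ]
  obtain ⟨Φ, h0Φ, hΦS, hΦ, hΦs, hΦe⟩ := exists_openPartialHomeomorph_of_contDiffOn (hSo r)
    (h0r r hr) hΞs (ContinuousLinearEquiv.refl ℝ E) (by
      ext u
      rw [hΞd 0 (h0r r hr), hκ0, hΨ0, hPe y₀ hyN₂]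
      change u - q u + q (q u) = u
      rw [hq, sub_add_cancel])
  obtain ⟨ρ', hρ', hρ'Φ⟩ := Metric.mem_nhds_iff.1 (Φ.open_source.mem_nhds h0Φ)
  let ρ := ρ' / 2
  have hρ : 0 < ρ := by positivity
  have hSρ : S ρ ⊆ Φ.source := by
    intro x hx
    rw [hS] at hx
    apply hρ'Φ
    rw [mem_ball_zero_iff]
    calc ‖x‖ = ‖(x - q x) + q x‖ := by rw [sub_add_cancel]
      _ ≤ ‖x - q x‖ + ‖q x‖ := norm_add_le _ _
      _ < ρ' := by simp only [ρ] at hx; linarith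
  have hSr : S ρ ⊆ S r := hSρ.trans hΦS
  have hΞN : ∀ x ∈ S r, Ξ x ∈ N₂ := fun x hx => (hΨ _ hx).1
  have hΞat : ∀ x ∈ S r, ContDiffAt ℝ ∞ Ξ x := fun x hx =>
    (hΞs x hx).contDiffAt ((hSo r).mem_nhds hx)
  have hβat : ∀ x ∈ S r, ContDiffAt ℝ ∞ β (Ξ x) := fun x hx =>
    (hβ _ (hN₂U (hΞN x hx))).contDiffAt (hU.mem_nhds (hN₂U (hΞN x hx)))
  have hsurj : ∀ x ∈ S ρ, ∀ w, ∃ v, fderiv ℝ Ξ x v = w := by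
    intro x hx w
    obtain ⟨e', he'⟩ := hΦe x (hSρ hx)
    exact ⟨e'.symm w, by rw [he']; simp⟩
  have hkerΞ : ∀ x ∈ S ρ, ∀ u, (∀ v, pullback Ξ β x u v = 0) ↔
      p (Ξ x) (fderiv ℝ Ξ x u) = fderiv ℝ Ξ x u := by
    intro x hx u
    rw [← hker _ (hN₂U (hΞN x (hSr hx)))]
    refine ⟨fun h => ?_, fun h v => by rw [pullback_apply, h]; rfl⟩
    ext w
    obtain ⟨v, rfl⟩ := hsurj x hx w
    exact h v
  -- The derivative of `Ξ` at `x` in the direction `q x` is the velocity of a curve in a leaf. It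
  -- lies in the image of `p`, which is the kernel of `β`.
  have hrad : ∀ x ∈ S ρ, ∀ v, pullback Ξ β x (q x) v = 0 := by
    intro x hx
    rw [hkerΞ x hx, hΞd x (hSr hx), hq, sub_self]
    have h1 : fderiv ℝ Ψ (κ x) (0, q x) = p (Ξ x) (q x) := by
      have := (hΨ _ (hSr hx)).2.1
      rwa [hPe _ (hΞN x (hSr hx))] at this
    rw [h1, hpp _ (hN₂U (hΞN x (hSr hx)))]
  have hpb : ∀ x ∈ S ρ, ∀ u v, pullback Ξ β x u v =
      pullback Ξ β (x - q x) (u - q u) (v - q v) := fun x hx u v =>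
    apply_eq_of_radial (hSo ρ)
      (fun x hx => (contDiffAt_pullback (hΞat x (hSr hx)) (hβat x (hSr hx))).contDiffWithinAt)
      (fun x hx u v => hanti _ (hN₂U (hΞN x (hSr hx))) _ _)
      (fun x hx => ClosedAt.pullback (hΞat x (hSr hx)) (hβat x (hSr hx))
        (hanti _ (hN₂U (hΞN x (hSr hx)))) (hclosed _ (hN₂U (hΞN x (hSr hx)))))
      hq (hstar ρ) hrad hx u v
  have hslice : ∀ x ∈ S ρ, x - q x ∈ S ρ := by
    intro x hx
    simpa using hstar ρ x hx 0 ⟨le_rfl, zero_le_one⟩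
  have hΞslice : ∀ x ∈ S ρ, ∀ u, fderiv ℝ Ξ (x - q x) (u - q u) = u - q u := by
    intro x hx u
    have h1 : HasFDerivAt (fun x => Ξ (x - q x))
        ((fderiv ℝ Ξ (x - q x)).comp (ContinuousLinearMap.id ℝ E - q)) x :=
      HasFDerivAt.comp (f := fun x => x - q x) x
        (hΞat _ (hSr (hslice x hx))).differentiableAt_infty.hasFDerivAt
        (ContinuousLinearMap.id ℝ E - q).hasFDerivAt
    have h2 : (fun x => Ξ (x - q x)) =ᶠ[𝓝 x] fun x => y₀ + (x - q x) := by
      filter_upwards [(hSo ρ).mem_nhds hx] with z hz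
      have := (hΨ _ (hSr hz)).2.2.2
      simpa [Ξ, κ, hq] using this
    have h3 : HasFDerivAt (fun x => y₀ + (x - q x)) (ContinuousLinearMap.id ℝ E - q) x :=
      (ContinuousLinearMap.id ℝ E - q).hasFDerivAt.const_add y₀
    have h4 := (h3.congr_of_eventuallyEq h2).unique h1
    exact (congrArg (fun L : E →L[ℝ] E => L u) h4).symm
  -- A kernel vector `u` at `x` gives the kernel vector `u - q u` at `x - q x`, where `DΞ` is the
  -- identity on `ker q`. So `u - q u` lies in `ker q` and is fixed by `p`, and it vanishes because
  -- `p` is within distance `1` of `q`.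
  have hkerq : ∀ x ∈ S ρ, ∀ u, (∀ v, pullback Ξ β x u v = 0) ↔ q u = u := by
    intro x hx u
    constructor
    · intro h
      have h1 : ∀ v, pullback Ξ β (x - q x) (u - q u) v = 0 := by
        intro v
        rw [hpb _ (hslice x hx)]
        have := hpb x hx u v
        rw [h] at this
        simp [hq] at this ⊢
        simp [← this]
      rw [hkerΞ _ (hslice x hx), hΞslice x hx] at h1
      have h2 := (hΞN _ (hSr (hslice x hx)))
      have h3 : ‖p (Ξ (x - q x)) - q‖ < 1 := by
        have := h2.2
        rwa [mem_preimage, hPe _ h2, mem_ball_iff_norm] at this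
      by_contra hne
      have h4 : u - q u ≠ 0 := fun h => hne (sub_eq_zero.1 h).symm
      have h5 := (p (Ξ (x - q x)) - q).le_opNorm (u - q u)
      rw [sub_apply, h1, map_sub, hq, sub_self, sub_zero] at h5
      have h6 : 0 < ‖u - q u‖ := norm_pos_iff.2 h4
      nlinarith
    · intro h v
      rw [hpb x hx, h, sub_self]
      simp
  let N := Φ.symm.source ∩ Φ.symm ⁻¹' (S ρ)
  have hN : IsOpen N := Φ.symm.isOpen_inter_preimage (hSo ρ)
  have hy₀Ξ : Φ 0 = y₀ := by
    rw [hΦ]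
    have := (hΨ _ (h0r r hr)).2.2.2
    simpa [Ξ, κ] using this
  have hsymm0 : Φ.symm y₀ = 0 := by rw [← hy₀Ξ, Φ.left_inv h0Φ]
  have hNx : ∀ y ∈ N, ∃ x ∈ S ρ, Ξ x = y ∧ Φ.symm y = x := fun y hy =>
    ⟨Φ.symm y, hy.2, by rw [← hΦ]; exact Φ.right_inv hy.1, rfl⟩
  -- The transversal coordinate in the flow chart. Its differential has the leaf directions as
  -- kernel, and it is `J`-linear because the flow is.
  let π : E → E := fun y => Φ.symm y - q (Φ.symm y)
  have hsymmat : ∀ y ∈ N, ContDiffAt ℝ ∞ Φ.symm y := fun y hy =>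
    (hΦs y hy.1).contDiffAt (Φ.open_target.mem_nhds hy.1)
  have hπd : ∀ x ∈ S ρ, ∀ u, fderiv ℝ π (Ξ x) (fderiv ℝ Ξ x u) = u - q u := by
    intro x hx u
    have hxN : Ξ x ∈ N := by
      rw [← hΦ]
      refine ⟨Φ.map_source (hSρ hx), ?_⟩
      rw [mem_preimage, Φ.left_inv (hSρ hx)]; exact hx
    have hπ : DifferentiableAt ℝ π (Ξ x) :=
      ((ContinuousLinearMap.id ℝ E - q).contDiff.contDiffAt.comp _
        (hsymmat _ hxN)).differentiableAt_infty
    have h1 := hπ.hasFDerivAt.comp x (hΞat x (hSr hx)).differentiableAt_infty.hasFDerivAt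
    have h2 : π ∘ Ξ =ᶠ[𝓝 x] fun x => x - q x := by
      filter_upwards [(hSo ρ).mem_nhds hx] with z hz
      simp only [Function.comp_apply, π, ← hΦ, Φ.left_inv (hSρ hz)]
    have h3 : HasFDerivAt (fun x => x - q x) (ContinuousLinearMap.id ℝ E - q) x :=
      (ContinuousLinearMap.id ℝ E - q).hasFDerivAt
    have h4 := (h3.congr_of_eventuallyEq h2).unique h1
    exact (congrArg (fun L : E →L[ℝ] E => L u) h4).symm
  refine ⟨N, ?_, hN, ⟨hy₀Ξ ▸ Φ.map_source h0Φ, by rw [mem_preimage, hsymm0]; exact h0r ρ hρ⟩, π,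
    fun y hy => ((ContinuousLinearMap.id ℝ E - q).contDiff.contDiffAt.comp _
        (hsymmat y hy)).contDiffWithinAt, ?_, ?_⟩
  · intro y hy
    obtain ⟨x, hx, rfl, -⟩ := hNx y hy
    exact hN₂U (hΞN x (hSr hx))
  · intro y hy
    obtain ⟨x, hx, rfl, -⟩ := hNx y hy
    refine ⟨fun w => ?_, fun w => ?_, fun w => ?_⟩ <;> obtain ⟨u, rfl⟩ := hsurj x hx w
    · rw [hπd x hx, ← hkerΞ x hx, hkerq x hx, sub_eq_zero, eq_comm]
    · have h1 : J (fderiv ℝ Ξ x u) = fderiv ℝ Ξ x (J u) := by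
        have := (hΨ _ (hSr hx)).2.2.1 (u - q u, q u)
        rw [hΞd x (hSr hx), hΞd x (hSr hx), ← this]
        simp [hqJ]
      rw [h1, hπd x hx, hπd x hx, map_sub, hqJ]
    · rw [hπd x hx]
      change q (u - q u) = 0
      rw [map_sub, hq, sub_self]
  · intro v
    have h1 := hπd 0 (h0r ρ hρ) v
    have h2 : fderiv ℝ Ξ 0 v = v := by
      rw [hΞd 0 (h0r r hr), hκ0, hΨ0, hPe y₀ hyN₂]
      change v - q v + q (q v) = v
      rw [hq, sub_add_cancel]
    rw [h2, show Ξ 0 = y₀ by rw [← hΦ, hy₀Ξ]] at h1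
    exact h1

end CoordMetric

/-! ### The Nijenhuis tensor and closed splittings -/

namespace CoordMetric

section Nijenhuis

variable {V : Type*} [NormedAddCommGroup V] [NormedSpace ℝ V]

/-- The Nijenhuis tensor of a field of endomorphisms, on constant vector fields. -/
def nijenhuis (A : V → V →L[ℝ] V) (y X Y : V) : V :=
  fderiv ℝ A y (A y X) Y - fderiv ℝ A y (A y Y) X - A y (fderiv ℝ A y X Y) + A y (fderiv ℝ A y Y X)

/-- The hypothesis `hAΓ` says that `A` is parallel for the torsion-free connection `Γ`. -/
theorem nijenhuis_eq_zero_of_parallel {A : V → V →L[ℝ] V} {y : V} (Γ : V → V → V)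
    (hΓ : ∀ v w, Γ v w = Γ w v) (hA : ∀ v, A y (A y v) = -v)
    (hAΓ : ∀ v w, fderiv ℝ A y v w = A y (Γ v w) - Γ v (A y w)) (X Y : V) :
    nijenhuis A y X Y = 0 := by
  simp only [nijenhuis, hAΓ, map_sub, hA]
  rw [hΓ (A y Y) X, hΓ (A y Y) (A y X), hΓ Y (A y X), hΓ Y X]
  abel

variable {J : V →L[ℝ] V} {h : V → V →L[ℝ] V →L[ℝ] ℝ} {U : Set V} {y : V} {p : V → V →L[ℝ] V}

/-- `p` is a field of orthogonal projections commuting with `J`, such that the restriction of the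
fundamental form of the Kähler metric `h` to the range of `p` is closed. -/
structure IsClosedSplitting (J : V →L[ℝ] V) (h : V → V →L[ℝ] V →L[ℝ] ℝ) (U : Set V)
    (p : V → V →L[ℝ] V) : Prop where
  smooth : ContDiffOn ℝ ∞ p U
  idem : ∀ y ∈ U, ∀ v, p y (p y v) = p y v
  comm : ∀ y ∈ U, ∀ v, p y (J v) = J (p y v)
  selfAdj : ∀ y ∈ U, ∀ v w, h y (p y v) w = h y v (p y w)
  closed : ∀ y ∈ U, ClosedAt (fun z => (h z).comp (J.comp (p z))) y

theorem IsClosedSplitting.contDiffAt (S : IsClosedSplitting J h U p) (hU : IsOpen U) (hy : y ∈ U) :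
    ContDiffAt ℝ ∞ p y := (S.smooth y hy).contDiffAt (hU.mem_nhds hy)

theorem IsClosedSplitting.contDiffAt_form (S : IsClosedSplitting J h U p) (H : IsMetricOn h U)
    (hy : y ∈ U) : ContDiffAt ℝ ∞ (fun z => (h z).comp (J.comp (p z))) y :=
  (H.contDiffAt hy).clm_comp (contDiffAt_const.clm_comp (S.contDiffAt H.isOpen hy))

theorem IsClosedSplitting.compl (S : IsClosedSplitting J h U p) (H : IsKahlerOn J h U) :
    IsClosedSplitting J h U (fun z => ContinuousLinearMap.id ℝ V - p z) where
  smooth := contDiffOn_const.sub S.smooth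
  idem y hy v := by simp [S.idem y hy]
  comm y hy v := by simp [S.comm y hy]
  selfAdj y hy v w := by simp [S.selfAdj y hy]
  closed y hy u v w := by
    have h1 := H.closed y hy u v w
    have h2 := S.closed y hy u v w
    have d1 : DifferentiableAt ℝ (fun z => (h z).comp J) y :=
      (H.differentiableAt hy).clm_comp (differentiableAt_const _)
    have d2 := (S.contDiffAt_form H.toIsMetricOn hy).differentiableAt_infty
    have e : (fun z => (h z).comp (J.comp (ContinuousLinearMap.id ℝ V - p z))) =
        fun z => (h z).comp J - (h z).comp (J.comp (p z)) := by
      ext z v w; simp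
    rw [e, fderiv_fun_sub d1 d2]
    simp only [sub_apply]
    linarith

theorem IsClosedSplitting.form_antisymm (S : IsClosedSplitting J h U p) (H : IsKahlerOn J h U)
    (hy : y ∈ U) (v w : V) : h y (J (p y v)) w = -h y (J (p y w)) v := by
  rw [H.apply_J_left hy, S.selfAdj y hy, S.comm y hy, H.symm y hy]

theorem IsClosedSplitting.form_eq_zero_iff (_S : IsClosedSplitting J h U p) (H : IsKahlerOn J h U)
    (hy : y ∈ U) (v : V) : (h y).comp (J.comp (p y)) v = 0 ↔ p y v = 0 := by
  refine ⟨fun h0 => ?_, fun h0 => by simp [h0]⟩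
  have h1 : J (p y v) = 0 := H.ext_left hy fun u => by
    have := congrArg (fun l : V →L[ℝ] ℝ => l u) h0
    simpa using this
  have := H.sq (p y v)
  rw [h1, map_zero] at this
  exact (neg_eq_zero.1 this.symm)

/-- Consequently each `D_v p` maps the image of `p` to its kernel and the kernel to the image. -/
theorem IsClosedSplitting.fderiv_idem (S : IsClosedSplitting J h U p) (hU : IsOpen U)
    (hy : y ∈ U) (v w : V) :
    fderiv ℝ p y v (p y w) + p y (fderiv ℝ p y v w) = fderiv ℝ p y v w := by
  have hp := (S.contDiffAt hU hy).differentiableAt_infty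
  have e : (fun z => p z (p z w)) =ᶠ[𝓝 y] fun z => p z w := by
    filter_upwards [hU.mem_nhds hy] with z hz using S.idem z hz w
  have := congrArg (fun L : V →L[ℝ] V => L v) e.fderiv_eq
  rwa [fderiv_apply_apply hp (hp.clm_apply (differentiableAt_const w)), fderiv_apply_const hp]
    at this

theorem IsClosedSplitting.fderiv_J (S : IsClosedSplitting J h U p) (hU : IsOpen U)
    (hy : y ∈ U) (v w : V) : fderiv ℝ p y v (J w) = J (fderiv ℝ p y v w) := by
  have hp := (S.contDiffAt hU hy).differentiableAt_infty
  rw [← fderiv_apply_const hp, ← fderiv_apply_const hp]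
  have e : (fun z => p z (J w)) =ᶠ[𝓝 y] fun z => J (p z w) := by
    filter_upwards [hU.mem_nhds hy] with z hz using S.comm z hz w
  have hd : DifferentiableAt ℝ (fun z => p z w) y := hp.clm_apply (differentiableAt_const w)
  rw [e.fderiv_eq]
  exact congrArg (fun L : V →L[ℝ] V => L v) (J.hasFDerivAt.comp y hd.hasFDerivAt).fderiv

/-- The image of `p` is the kernel of the closed form of `1 - p`, hence involutive. The difference
of the two sides is the bracket of the sections `p X` and `p Y`, so it is fixed by `p`. By
`fderiv_idem` it also lies in the kernel of `p`. -/
theorem IsClosedSplitting.fderiv_symm (S : IsClosedSplitting J h U p) (H : IsKahlerOn J h U)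
    (hy : y ∈ U) {X Y : V} (hX : p y X = X) (hY : p y Y = Y) :
    fderiv ℝ p y X Y = fderiv ℝ p y Y X := by
  have hp := (S.contDiffAt H.isOpen hy).differentiableAt_infty
  let S' := S.compl H
  let β : V → V →L[ℝ] V →L[ℝ] ℝ := fun z => (h z).comp (J.comp (ContinuousLinearMap.id ℝ V - p z))
  have dβ : DifferentiableAt ℝ β y := (S'.contDiffAt_form H.toIsMetricOn hy).differentiableAt_infty
  have hanti : ∀ z ∈ U, ∀ v w, β z v w = -β z w v := fun z hz v w => S'.form_antisymm H hz v w
  have hker : ∀ z ∈ U, ∀ v, β z (p z v) = 0 := fun z hz v =>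
    (S'.form_eq_zero_iff H hz _).2 (by simp [S.idem z hz])
  have hD : ∀ u v w, fderiv ℝ β y u (p y v) w = -β y (fderiv ℝ p y u v) w := by
    intro u v w
    have e : (fun z => β z (p z v) w) =ᶠ[𝓝 y] fun _ => 0 := by
      filter_upwards [H.isOpen.mem_nhds hy] with z hz
      rw [hker z hz]; rfl
    have := congrArg (fun L : V →L[ℝ] ℝ => L u) e.fderiv_eq
    rw [fderiv_apply₂ dβ (hp.clm_apply (differentiableAt_const v)) (differentiableAt_const w),
      fderiv_apply_const hp] at this
    simp at this
    linarith
  have hDanti : ∀ u v w, fderiv ℝ β y u v w = -fderiv ℝ β y u w v := by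
    intro u v w
    have e : (fun z => β z v w) =ᶠ[𝓝 y] fun z => -β z w v := by
      filter_upwards [H.isOpen.mem_nhds hy] with z hz using hanti z hz v w
    rw [← fderiv_apply₂_const dβ, ← fderiv_apply₂_const dβ, e.fderiv_eq, fderiv_fun_neg, neg_apply]
  let d := fderiv ℝ p y X Y - fderiv ℝ p y Y X
  have h1 : β y d = 0 := by
    ext W
    have hc := S'.closed y hy X Y W
    change fderiv ℝ β y X Y W + fderiv ℝ β y Y W X + fderiv ℝ β y W X Y = 0 at hc
    have e1 := hD X Y W
    have e2 := hD Y X W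
    have e3 := hD W X Y
    rw [hY] at e1
    rw [hX] at e2 e3
    have e4 : β y (fderiv ℝ p y W X) Y = 0 := by
      rw [hanti y hy, ← hY, hker y hy]; simp
    rw [hDanti Y W X, e1, e2, e3, e4] at hc
    simp only [d, map_sub, sub_apply, zero_apply]
    linarith
  have h2 : p y d = d := by
    have := (S'.form_eq_zero_iff H hy d).1 h1
    rw [sub_apply, sub_eq_zero] at this
    exact this.symm
  have h3 : p y d = 0 := by
    have e1 := S.fderiv_idem H.isOpen hy X Y
    have e2 := S.fderiv_idem H.isOpen hy Y X
    rw [hY, add_eq_left] at e1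
    rw [hX, add_eq_left] at e2
    simp [d, e1, e2]
  exact sub_eq_zero.1 (h2.symm.trans h3)

/-- `Dp` is complex linear in its second argument. On two vectors of the same type, `fderiv_symm`
for `p` or for `1 - p` carries this over to the first argument. On vectors of different types the
vanishing of the Nijenhuis tensor is used; `p` separates it into one equation for each order of the
arguments. -/
theorem IsClosedSplitting.fderiv_holomorphic (S : IsClosedSplitting J h U p)
    (H : IsKahlerOn J h U) (hy : y ∈ U) {A : V → V →L[ℝ] V}
    (hA : ∀ z ∈ U, ∀ v, A z v = J (v - (2 : ℝ) • p z v)) (hN : ∀ X Y, nijenhuis A y X Y = 0)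
    (v w : V) : fderiv ℝ p y (J v) w = J (fderiv ℝ p y v w) := by
  have hp := (S.contDiffAt H.isOpen hy).differentiableAt_infty
  have hid := S.fderiv_idem H.isOpen hy
  have hJ := S.fderiv_J H.isOpen hy
  have hcm := S.comm y hy
  have hDA : ∀ v w, fderiv ℝ A y v w = -(2 : ℝ) • J (fderiv ℝ p y v w) := by
    have e : A =ᶠ[𝓝 y] fun z => J.comp (ContinuousLinearMap.id ℝ V - (2 : ℝ) • p z) := by
      filter_upwards [H.isOpen.mem_nhds hy] with z hz
      ext v; simp [hA z hz]
    intro v w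
    rw [e.fderiv_eq, fderiv_clm_comp (differentiableAt_const _)
      ((differentiableAt_const _).fun_sub (hp.fun_const_smul _)),
      fderiv_fun_sub (differentiableAt_const _) (hp.fun_const_smul _), fderiv_fun_const_smul hp]
    simp
  have hc : fderiv ℝ (fun z => ContinuousLinearMap.id ℝ V - p z) y = -fderiv ℝ p y := by
    rw [fderiv_fun_sub (differentiableAt_const _) hp]; simp
  -- both arguments in the range of `p`, or both in the kernel
  have hmm : ∀ X Y, p y X = X → p y Y = Y → fderiv ℝ p y (J X) Y = J (fderiv ℝ p y X Y) := by
    intro X Y hX hY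
    rw [S.fderiv_symm H hy (by rw [hcm, hX]) hY, hJ, S.fderiv_symm H hy hX hY]
  have hpl : ∀ X Y, p y X = 0 → p y Y = 0 → fderiv ℝ p y (J X) Y = J (fderiv ℝ p y X Y) := by
    intro X Y hX hY
    have e1 := (S.compl H).fderiv_symm H hy (X := J X) (Y := Y) (by simp [hcm, hX]) (by simp [hY])
    have e2 := (S.compl H).fderiv_symm H hy (X := X) (Y := Y) (by simp [hX]) (by simp [hY])
    rw [hc] at e1 e2
    simp only [neg_apply, neg_inj] at e1 e2
    rw [e1, hJ, e2]
  have hpm : ∀ X Y, p y X = 0 → p y Y = Y → fderiv ℝ p y (J X) Y = J (fderiv ℝ p y X Y) ∧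
      fderiv ℝ p y (J Y) X = J (fderiv ℝ p y Y X) := by
    intro X Y hX hY
    have hAX : A y X = J X := by simp [hA y hy, hX]
    have hAY : A y Y = -J Y := by rw [hA y hy, hY, two_smul]; simp
    have a1 : ∀ v, p y (fderiv ℝ p y v Y) = 0 := fun v => by
      have := hid v Y; rwa [hY, add_eq_left] at this
    have a2 : ∀ v, p y (fderiv ℝ p y v X) = fderiv ℝ p y v X := fun v => by
      have := hid v X; rwa [hX, map_zero, zero_add] at this
    have hN' := hN X Y
    have b1 : A y (fderiv ℝ A y X Y) = (2 : ℝ) • fderiv ℝ p y X Y := by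
      rw [hDA, hA y hy, map_smul, hcm, a1]; simp [H.sq]
    have b2 : A y (fderiv ℝ A y Y X) = -(2 : ℝ) • fderiv ℝ p y Y X := by
      rw [hDA, hA y hy, map_smul, hcm, a2, two_smul]; simp [H.sq]
    rw [nijenhuis, b1, b2, hAX, hAY, map_neg, neg_apply, hDA, hDA] at hN'
    have c0 : J (fderiv ℝ p y (J X) Y) + J (fderiv ℝ p y (J Y) X) + fderiv ℝ p y X Y
        + fderiv ℝ p y Y X = 0 := by
      have : (-2 : ℝ) • (J (fderiv ℝ p y (J X) Y) + J (fderiv ℝ p y (J Y) X) + fderiv ℝ p y X Y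
        + fderiv ℝ p y Y X) = 0 := by
        rw [← hN']; module
      exact (smul_eq_zero.1 this).resolve_left (by norm_num)
    -- `p` fixes every `D_v p X` and kills every `D_v p Y`; the part that is killed is recovered as
    -- `c2`.
    have c1 := congrArg (p y) c0
    simp only [map_add, hcm, a1, a2, map_zero, zero_add, add_zero] at c1
    have c2 : J (fderiv ℝ p y (J X) Y) + fderiv ℝ p y X Y = 0 := by
      have : J (fderiv ℝ p y (J X) Y) + fderiv ℝ p y X Y +
        (J (fderiv ℝ p y (J Y) X) + fderiv ℝ p y Y X) = 0 := by rw [← c0]; abel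
      rwa [c1, add_zero] at this
    have d1 := congrArg J c1
    have d2 := congrArg J c2
    simp only [map_add, H.sq, map_zero] at d1 d2
    exact ⟨(neg_add_eq_zero.1 d2), (neg_add_eq_zero.1 d1)⟩
  have hv : v = (v - p y v) + p y v := by abel
  have hw : w = (w - p y w) + p y w := by abel
  have p1 : ∀ v, p y (v - p y v) = 0 := fun v => by rw [map_sub, S.idem y hy, sub_self]
  have p2 := S.idem y hy
  rw [hv, hw]
  simp only [map_add, add_apply]
  rw [hpl _ _ (p1 v) (p1 w), (hpm _ _ (p1 v) (p2 w)).1, (hpm _ _ (p1 w) (p2 v)).2,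
    hmm _ _ (p2 v) (p2 w)]

end Nijenhuis

/-! ### Holomorphic coordinates adapted to a splitting -/

section Splitting

theorem mulI_mulI (n : ℕ) (v : EuclideanSpace ℂ (Fin n)) : mulI n (mulI n v) = -v := by
  simp [mulI, smul_smul]

/-- Coordinates adapted to a complex linear projection. -/
theorem exists_linear_splitting {n : ℕ}
    (q : EuclideanSpace ℂ (Fin n) →L[ℝ] EuclideanSpace ℂ (Fin n))
    (hq : ∀ v, q (q v) = q v) (hqJ : ∀ v, q (mulI n v) = mulI n (q v)) :
    ∃ (a b : ℕ) (L : EuclideanSpace ℂ (Fin n) ≃L[ℝ]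
        EuclideanSpace ℂ (Fin a) × EuclideanSpace ℂ (Fin b)),
      (∀ v, L (mulI n v) = (mulI a (L v).1, mulI b (L v).2)) ∧
      (∀ v, (L v).1 = 0 ↔ q v = v) ∧ ∀ v, (L v).2 = 0 ↔ q v = 0 := by
  let E := EuclideanSpace ℂ (Fin n)
  let qc : E →ₗ[ℂ] E :=
    { toFun := q
      map_add' := map_add q
      map_smul' := fun c v => by
        have h1 : c • v = c.re • v + c.im • mulI n v := by
          have : c • v = ((c.re : ℂ) + c.im * Complex.I) • v := by rw [Complex.re_add_im]
          rw [this, add_smul, mul_smul]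
          rfl
        have h2 : c • q v = c.re • q v + c.im • mulI n (q v) := by
          have : c • q v = ((c.re : ℂ) + c.im * Complex.I) • q v := by rw [Complex.re_add_im]
          rw [this, add_smul, mul_smul]
          rfl
        rw [h1, map_add, map_smul, map_smul, hqJ]
        exact h2.symm }
  have hqc : ∀ v, qc v = q v := fun v => rfl
  let K := LinearMap.ker qc
  let R := LinearMap.range qc
  let eK : K ≃ₗ[ℂ] EuclideanSpace ℂ (Fin (Module.finrank ℂ K)) :=
    LinearEquiv.ofFinrankEq _ _ (by simp)
  let eR : R ≃ₗ[ℂ] EuclideanSpace ℂ (Fin (Module.finrank ℂ R)) :=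
    LinearEquiv.ofFinrankEq _ _ (by simp)
  let k : E →ₗ[ℂ] K := (LinearMap.id - qc).codRestrict K (fun v => by
    simp [K, hqc, hq])
  let L : E →ₗ[ℂ] EuclideanSpace ℂ (Fin (Module.finrank ℂ K)) ×
      EuclideanSpace ℂ (Fin (Module.finrank ℂ R)) :=
    (eK.toLinearMap.comp k).prod (eR.toLinearMap.comp qc.rangeRestrict)
  have hk0 : ∀ v, k v = 0 ↔ q v = v := by
    intro v
    rw [← Subtype.coe_inj]
    change v - q v = 0 ↔ _
    rw [sub_eq_zero, eq_comm]
  have hr0 : ∀ v, qc.rangeRestrict v = 0 ↔ q v = 0 := by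
    intro v
    rw [← Subtype.coe_inj]
    rfl
  have h1 : ∀ v, (L v).1 = 0 ↔ q v = v := fun v => by
    change eK (k v) = 0 ↔ _
    rw [LinearEquiv.map_eq_zero_iff, hk0]
  have h2 : ∀ v, (L v).2 = 0 ↔ q v = 0 := fun v => by
    change eR (qc.rangeRestrict v) = 0 ↔ _
    rw [LinearEquiv.map_eq_zero_iff, hr0]
  have hinj : Function.Injective L := by
    rw [injective_iff_map_eq_zero]
    intro v hv
    have a1 := (h1 v).1 (by rw [hv]; rfl)
    have a2 := (h2 v).1 (by rw [hv]; rfl)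
    rw [← a1, a2]
  have hsurj : Function.Surjective L := by
    rintro ⟨x, z⟩
    refine ⟨(eK.symm x : E) + (eR.symm z : E), ?_⟩
    have b1 : q (eK.symm x : E) = 0 := (eK.symm x).2
    have b2 : q (eR.symm z : E) = (eR.symm z : E) := by
      obtain ⟨w, hw⟩ := (eR.symm z).2
      rw [← hw, hqc, hq]
    have b3 : q ((eK.symm x : E) + (eR.symm z : E)) = (eR.symm z : E) := by
      have := q.map_add (eK.symm x : E) (eR.symm z : E)
      rw [b1, b2, zero_add] at this
      exact this
    refine Prod.ext ?_ ?_
    · change eK (k _) = x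
      rw [← LinearEquiv.eq_symm_apply]
      ext1
      change ((eK.symm x : E) + (eR.symm z : E)) - q ((eK.symm x : E) + (eR.symm z : E)) = _
      rw [b3]
      exact add_sub_cancel_right _ _
    · change eR (qc.rangeRestrict _) = z
      rw [← LinearEquiv.eq_symm_apply]
      ext1
      exact b3
  refine ⟨_, _,
    ((LinearEquiv.ofBijective L ⟨hinj, hsurj⟩).restrictScalars ℝ).toContinuousLinearEquiv,
    fun v => ?_, h1, h2⟩
  exact L.map_smul Complex.I v

/-- Holomorphic coordinates adapted to a decomposition of the tangent bundle of an open subset of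
`ℂⁿ` into two holomorphic subbundles which are the kernels of closed 2-forms. -/
theorem exists_splitting_chart {n : ℕ} {U : Set (EuclideanSpace ℂ (Fin n))}
    {y₀ : EuclideanSpace ℂ (Fin n)} (hy₀ : y₀ ∈ U)
    {h : EuclideanSpace ℂ (Fin n) →
      EuclideanSpace ℂ (Fin n) →L[ℝ] EuclideanSpace ℂ (Fin n) →L[ℝ] ℝ}
    (H : IsKahlerOn (mulI n) h U)
    {p : EuclideanSpace ℂ (Fin n) → EuclideanSpace ℂ (Fin n) →L[ℝ] EuclideanSpace ℂ (Fin n)}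
    (S : IsClosedSplitting (mulI n) h U p)
    (hDp : ∀ y ∈ U, ∀ v w, fderiv ℝ p y (mulI n v) w = mulI n (fderiv ℝ p y v w)) :
    ∃ (a b : ℕ) (Φ : OpenPartialHomeomorph (EuclideanSpace ℂ (Fin n))
        (EuclideanSpace ℂ (Fin a) × EuclideanSpace ℂ (Fin b))) (r : ℝ), 0 < r ∧
      y₀ ∈ Φ.source ∧ Φ.source ⊆ U ∧ Φ.target = Metric.ball 0 r ×ˢ Metric.ball 0 r ∧
      ContDiffOn ℝ ∞ Φ Φ.source ∧ ContDiffOn ℝ ∞ Φ.symm Φ.target ∧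
      ∀ y ∈ Φ.source, Function.Bijective (fderiv ℝ Φ y) ∧
        ∀ v, fderiv ℝ Φ y (mulI n v) = (mulI a (fderiv ℝ Φ y v).1, mulI b (fderiv ℝ Φ y v).2) ∧
        ((fderiv ℝ Φ y v).1 = 0 ↔ p y v = v) ∧ ((fderiv ℝ Φ y v).2 = 0 ↔ p y v = 0) := by
  have hid : ∀ y, ∀ v,
      (ContinuousLinearMap.id ℝ (EuclideanSpace ℂ (Fin n)) - p y) v = v ↔ p y v = 0 := by
    intro y v; simp
  obtain ⟨N, hNU, hN, hyN, π, hπ, hπN, hπ0⟩ := exists_holomorphic_first_integral (mulI n) H.isOpen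
    hy₀ S.smooth S.idem S.comm hDp
    (fun y hy => ((S.compl H).contDiffAt_form H.toIsMetricOn hy).contDiffWithinAt)
    (fun y hy v w => (S.compl H).form_antisymm H hy v w) (S.compl H).closed
    (fun y hy v => by rw [(S.compl H).form_eq_zero_iff H hy, sub_apply, sub_eq_zero, eq_comm]; rfl)
  obtain ⟨N', hNU', hN', hyN', π', hπ', hπN', hπ0'⟩ := exists_holomorphic_first_integral (mulI n)
    H.isOpen hy₀ (S.compl H).smooth (S.compl H).idem (S.compl H).comm
    (fun y hy v w => by
      rw [fderiv_fun_sub (differentiableAt_const _)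
        (S.contDiffAt H.isOpen hy).differentiableAt_infty]
      simp [hDp y hy])
    (fun y hy => (S.contDiffAt_form H.toIsMetricOn hy).contDiffWithinAt)
    (fun y hy v w => S.form_antisymm H hy v w) S.closed
    (fun y hy v => by rw [S.form_eq_zero_iff H hy, hid])
  obtain ⟨a, b, L, hLJ, hL1, hL2⟩ := exists_linear_splitting (p y₀) (S.idem y₀ hy₀) (S.comm y₀ hy₀)
  -- `Dπ` takes values in the kernel of `p y₀` and `Dπ'` in its image. At `y₀` they are `1 - p y₀`
  -- and `p y₀`, so the sum has the identity as derivative there, and `L` separates the two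
  -- components.
  let f : EuclideanSpace ℂ (Fin n) → EuclideanSpace ℂ (Fin a) × EuclideanSpace ℂ (Fin b) :=
    fun y => L (π y + π' y - (π y₀ + π' y₀))
  have hNN : IsOpen (N ∩ N') := hN.inter hN'
  have hf : ContDiffOn ℝ ∞ f (N ∩ N') := L.contDiff.comp_contDiffOn
    (((hπ.mono inter_subset_left).add (hπ'.mono inter_subset_right)).sub contDiffOn_const)
  have hfd : ∀ y ∈ N ∩ N', ∀ v, fderiv ℝ f y v = L (fderiv ℝ π y v + fderiv ℝ π' y v) := by
    intro y hy v
    have d1 := ((hπ y hy.1).contDiffAt (hN.mem_nhds hy.1)).differentiableAt_infty.hasFDerivAt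
    have d2 := ((hπ' y hy.2).contDiffAt (hN'.mem_nhds hy.2)).differentiableAt_infty.hasFDerivAt
    have d3 : HasFDerivAt f _ y :=
      L.hasFDerivAt.comp y ((d1.fun_add d2).sub_const (π y₀ + π' y₀))
    rw [d3.fderiv]
    rfl
  obtain ⟨Φ₀, h0, hs, hco, hsm, he⟩ :=
    exists_openPartialHomeomorph_of_contDiffOn hNN ⟨hyN, hyN'⟩ hf L
    (by
      refine ContinuousLinearMap.ext fun v => ?_
      rw [hfd y₀ ⟨hyN, hyN'⟩, hπ0, hπ0']
      simp)
  have hf0 : Φ₀ y₀ = 0 := by simp [hco, f]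
  have h0t : (0 : EuclideanSpace ℂ (Fin a) × EuclideanSpace ℂ (Fin b)) ∈ Φ₀.target :=
    hf0 ▸ Φ₀.map_source h0
  obtain ⟨r, hr, hrt⟩ := Metric.mem_nhds_iff.1 (Φ₀.open_target.mem_nhds h0t)
  -- Balls make the target a product that is star-shaped in each factor, as the homotopy argument
  -- for splitting the metric requires.
  let B : Set (EuclideanSpace ℂ (Fin a) × EuclideanSpace ℂ (Fin b)) :=
    Metric.ball 0 r ×ˢ Metric.ball 0 r
  have hB : IsOpen B := Metric.isOpen_ball.prod Metric.isOpen_ball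
  have hBt : B ⊆ Φ₀.target := by
    refine subset_trans ?_ hrt
    rintro ⟨x, z⟩ ⟨hx, hz⟩
    rw [mem_ball_zero_iff] at hx hz ⊢
    exact max_lt hx hz
  let Φ := (Φ₀.symm.restrOpen B hB).symm
  have hΦco : ⇑Φ = f := hco
  have hΦs : Φ.source ⊆ Φ₀.source := by
    intro y hy
    exact hy.1
  refine ⟨a, b, Φ, r, hr, ⟨h0, ?_⟩, fun y hy => hNU (hs (hΦs hy)).1, ?_, ?_, ?_, ?_⟩
  · change Φ₀ y₀ ∈ B
    rw [hf0]
    exact ⟨Metric.mem_ball_self hr, Metric.mem_ball_self hr⟩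
  · exact inter_eq_right.2 hBt
  · rw [hΦco]; exact hf.mono (hΦs.trans hs)
  · exact hsm.mono fun x hx => hx.1
  · intro y hy
    have hyN := hs (hΦs hy)
    have hyU := hNU hyN.1
    rw [hΦco]
    refine ⟨?_, fun v => ⟨?_, ?_, ?_⟩⟩
    · obtain ⟨e', he'⟩ := he y (hΦs hy)
      rw [he']; exact e'.bijective
    · rw [hfd y hyN, hfd y hyN, (hπN y hyN.1).2.1, (hπN' y hyN.2).2.1, ← map_add, hLJ]
    · have h1 := (hπN y hyN.1).2.2 v
      have h2 := (hπN' y hyN.2).2.2 v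
      rw [sub_apply, sub_eq_zero] at h2
      rw [hfd y hyN, hL1, map_add, h1, zero_add, ← h2]
      simp [(hπN y hyN.1).1 v]
    · have h1 := (hπN y hyN.1).2.2 v
      have h2 := (hπN' y hyN.2).2.2 v
      rw [sub_apply, sub_eq_zero] at h2
      rw [hfd y hyN, hL2, map_add, h1, zero_add, ← h2]
      simp [(hπN' y hyN.2).1 v]

end Splitting

end CoordMetric

/-! ### Product charts -/

namespace CoordMetric

section

variable {V W : Type*} [NormedAddCommGroup V] [NormedSpace ℝ V] [FiniteDimensional ℝ V]
  [NormedAddCommGroup W] [NormedSpace ℝ W]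
  {b : W → W →L[ℝ] W →L[ℝ] ℝ} {U : Set V} {U' : Set W} {f : V → W}

theorem IsMetricOn.pullback (B : IsMetricOn b U') (hU : IsOpen U) (hf : ContDiffOn ℝ ∞ f U)
    (hm : MapsTo f U U') (hinj : ∀ y ∈ U, ∀ v, fderiv ℝ f y v = 0 → v = 0) :
    IsMetricOn (pullback f b) U where
  isOpen := hU
  smooth y hy := (contDiffAt_pullback ((hf y hy).contDiffAt (hU.mem_nhds hy))
    (B.contDiffAt (hm hy))).contDiffWithinAt
  symm _ hy _ _ := B.symm _ (hm hy) _ _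
  pos y hy v hv := B.pos _ (hm hy) _ fun h => hv (hinj y hy v h)

theorem IsKahlerOn.pullback {J' : W →L[ℝ] W} {J : V →L[ℝ] V} (B : IsKahlerOn J' b U')
    (hJ : ∀ v, J (J v) = -v) (hU : IsOpen U) (hf : ContDiffOn ℝ ∞ f U)
    (hm : MapsTo f U U') (hinj : ∀ y ∈ U, ∀ v, fderiv ℝ f y v = 0 → v = 0)
    (hfJ : ∀ y ∈ U, ∀ v, fderiv ℝ f y (J v) = J' (fderiv ℝ f y v)) :
    IsKahlerOn J (CoordMetric.pullback f b) U where
  toIsMetricOn := B.toIsMetricOn.pullback hU hf hm hinj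
  sq := hJ
  hermitian y hy v w := by
    simp only [pullback_apply, hfJ y hy, B.hermitian _ (hm hy)]
  closed y hy := by
    have hb : ContDiffAt ℝ ∞ (fun z => (b z).comp J') (f y) :=
      (B.contDiffAt (hm hy)).clm_comp contDiffAt_const
    have h1 := ClosedAt.pullback ((hf y hy).contDiffAt (hU.mem_nhds hy)) hb (fun v w => by
      change b (f y) (J' v) w = -b (f y) (J' w) v
      rw [B.apply_J_left (hm hy), B.symm _ (hm hy)]) (B.closed _ (hm hy))
    refine h1.congr ?_
    filter_upwards [hU.mem_nhds hy] with z hz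
    ext v w
    change b (f z) (J' _) _ = b (f z) (fderiv ℝ f z (J v)) _
    rw [hfJ z hz]
    rfl

theorem IsKahlerEinsteinOn.isKahlerOn {n : ℕ} {h : EuclideanSpace ℂ (Fin n) →
      EuclideanSpace ℂ (Fin n) →L[ℝ] EuclideanSpace ℂ (Fin n) →L[ℝ] ℝ}
    {U : Set (EuclideanSpace ℂ (Fin n))} (H : IsKahlerEinsteinOn h U) (hU : IsOpen U) :
    IsKahlerOn (mulI n) h U :=
  { isOpen := hU, smooth := H.smooth, symm := H.symm, pos := H.pos, sq := mulI_mulI n,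
    hermitian := H.hermitian, closed := H.closed }

theorem IsKahlerOn.isKahlerEinsteinOn {n : ℕ} {h : EuclideanSpace ℂ (Fin n) →
      EuclideanSpace ℂ (Fin n) →L[ℝ] EuclideanSpace ℂ (Fin n) →L[ℝ] ℝ}
    {U : Set (EuclideanSpace ℂ (Fin n))} (H : IsKahlerOn (mulI n) h U) {c : ℝ}
    (hc : ∀ y ∈ U, ∀ v w, ricci h y v w = c * h y v w) : IsKahlerEinsteinOn h U :=
  { smooth := H.smooth, symm := H.symm, pos := H.pos, hermitian := H.hermitian, closed := H.closed,
    einstein := ⟨c, fun y hy => by ext v w; simpa using hc y hy v w⟩ }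

end

/-- A Kähler metric whose fundamental form splits along two complementary holomorphic subbundles,
which are eigenspaces of its Ricci tensor, is locally a product of Kähler–Einstein metrics. -/
theorem exists_product_chart {n : ℕ} {U : Set (EuclideanSpace ℂ (Fin n))}
    {y₀ : EuclideanSpace ℂ (Fin n)} (hy₀ : y₀ ∈ U)
    {h : EuclideanSpace ℂ (Fin n) →
      EuclideanSpace ℂ (Fin n) →L[ℝ] EuclideanSpace ℂ (Fin n) →L[ℝ] ℝ}
    (H : IsKahlerOn (mulI n) h U)
    {p : EuclideanSpace ℂ (Fin n) → EuclideanSpace ℂ (Fin n) →L[ℝ] EuclideanSpace ℂ (Fin n)}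
    (S : IsClosedSplitting (mulI n) h U p)
    (hDp : ∀ y ∈ U, ∀ v w, fderiv ℝ p y (mulI n v) w = mulI n (fderiv ℝ p y v w))
    {lam mu : ℝ} (hric : ∀ y ∈ U, ∀ v w, ricci h y v w =
      lam * h y (v - p y v) w + mu * h y (p y v) w) :
    ∃ (a b : ℕ) (Φ : OpenPartialHomeomorph (EuclideanSpace ℂ (Fin n))
        (EuclideanSpace ℂ (Fin a) × EuclideanSpace ℂ (Fin b)))
      (U₁ : Set (EuclideanSpace ℂ (Fin a))) (U₂ : Set (EuclideanSpace ℂ (Fin b)))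
      (h₁ : EuclideanSpace ℂ (Fin a) →
        EuclideanSpace ℂ (Fin a) →L[ℝ] EuclideanSpace ℂ (Fin a) →L[ℝ] ℝ)
      (h₂ : EuclideanSpace ℂ (Fin b) →
        EuclideanSpace ℂ (Fin b) →L[ℝ] EuclideanSpace ℂ (Fin b) →L[ℝ] ℝ),
      y₀ ∈ Φ.source ∧ Φ.source ⊆ U ∧ IsOpen U₁ ∧ IsOpen U₂ ∧ Φ.target = U₁ ×ˢ U₂ ∧
      ContDiffOn ℝ ∞ Φ Φ.source ∧ ContDiffOn ℝ ∞ Φ.symm Φ.target ∧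
      IsKahlerEinsteinOn h₁ U₁ ∧ IsKahlerEinsteinOn h₂ U₂ ∧
      ∀ y ∈ Φ.source, Function.Bijective (fderiv ℝ Φ y) ∧
        (∀ v w, h y v w = h₁ (Φ y).1 (fderiv ℝ Φ y v).1 (fderiv ℝ Φ y w).1
          + h₂ (Φ y).2 (fderiv ℝ Φ y v).2 (fderiv ℝ Φ y w).2) ∧
        ∀ v, fderiv ℝ Φ y (mulI n v) = (mulI a (fderiv ℝ Φ y v).1, mulI b (fderiv ℝ Φ y v).2) ∧
        ((fderiv ℝ Φ y v).1 = 0 ↔ p y v = v) ∧ ((fderiv ℝ Φ y v).2 = 0 ↔ p y v = 0) := by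
  obtain ⟨a, b, Φ, r, hr, hy₀Φ, hΦU, hΦt, hΦs, hΦss, hΦ⟩ := exists_splitting_chart hy₀ H S hDp
  let E₁ := EuclideanSpace ℂ (Fin a)
  let E₂ := EuclideanSpace ℂ (Fin b)
  let B : Set (E₁ × E₂) := Metric.ball 0 r ×ˢ Metric.ball 0 r
  let χ : E₁ × E₂ → EuclideanSpace ℂ (Fin n) := Φ.symm
  have hBo : IsOpen B := Metric.isOpen_ball.prod Metric.isOpen_ball
  have hχs : ContDiffOn ℝ ∞ χ B := by rw [hΦt] at hΦss; exact hΦss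
  have hχat : ∀ x ∈ B, ContDiffAt ℝ ∞ χ x := fun x hx => (hχs x hx).contDiffAt (hBo.mem_nhds hx)
  have hχsrc : ∀ x ∈ B, χ x ∈ Φ.source := fun x hx => Φ.map_target (by rw [hΦt]; exact hx)
  have hχU : MapsTo χ B U := fun x hx => hΦU (hχsrc x hx)
  have hΦχ : ∀ x ∈ B, Φ (χ x) = x := fun x hx => Φ.right_inv (by rw [hΦt]; exact hx)
  have hΦat : ∀ y ∈ Φ.source, ContDiffAt ℝ ∞ Φ y := fun y hy =>
    (hΦs y hy).contDiffAt (Φ.open_source.mem_nhds hy)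
  have hDD : ∀ x ∈ B, ∀ u, fderiv ℝ Φ (χ x) (fderiv ℝ χ x u) = u := by
    intro x hx u
    have h1 := (hΦat _ (hχsrc x hx)).differentiableAt_infty.hasFDerivAt.comp x
      (hχat x hx).differentiableAt_infty.hasFDerivAt
    have h2 : Φ ∘ χ =ᶠ[𝓝 x] id := by
      filter_upwards [hBo.mem_nhds hx] with z hz using hΦχ z hz
    have h3 := ((hasFDerivAt_id x).congr_of_eventuallyEq h2).unique h1
    exact (congrArg (fun L : E₁ × E₂ →L[ℝ] E₁ × E₂ => L u) h3).symm
  have hDD' : ∀ x ∈ B, ∀ v, fderiv ℝ χ x (fderiv ℝ Φ (χ x) v) = v := by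
    intro x hx v
    exact (hΦ _ (hχsrc x hx)).1.1 (hDD x hx _)
  let JJ : E₁ × E₂ →L[ℝ] E₁ × E₂ := (mulI a).prodMap (mulI b)
  have hJJ : ∀ u, JJ (JJ u) = -u := by
    intro u
    change (mulI a (mulI a u.1), mulI b (mulI b u.2)) = -u
    rw [mulI_mulI, mulI_mulI]; rfl
  have hχJ : ∀ x ∈ B, ∀ u, fderiv ℝ χ x (JJ u) = mulI n (fderiv ℝ χ x u) := by
    intro x hx u
    apply (hΦ _ (hχsrc x hx)).1.1
    rw [hDD x hx, ((hΦ _ (hχsrc x hx)).2 _).1, hDD x hx]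
    rfl
  have hχinj : ∀ x ∈ B, ∀ u, fderiv ℝ χ x u = 0 → u = 0 := by
    intro x hx u hu
    rw [← hDD x hx u, hu, map_zero]
  have hp1 : ∀ x ∈ B, ∀ u, u.1 = 0 → p (χ x) (fderiv ℝ χ x u) = fderiv ℝ χ x u := by
    intro x hx u hu
    rw [← ((hΦ _ (hχsrc x hx)).2 _).2.1, hDD x hx, hu]
  have hp2 : ∀ x ∈ B, ∀ u, u.2 = 0 → p (χ x) (fderiv ℝ χ x u) = 0 := by
    intro x hx u hu
    rw [← ((hΦ _ (hχsrc x hx)).2 _).2.2, hDD x hx, hu]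
  let k := pullback χ h
  have K : IsKahlerOn JJ k B := H.pullback hJJ hBo hχs hχU hχinj hχJ
  -- The Kähler form is the sum of these two closed forms, each of which annihilates one of the two
  -- subbundles.
  let βp := fun z => (h z).comp ((mulI n).comp (p z))
  let βm := fun z => (h z).comp ((mulI n).comp (ContinuousLinearMap.id ℝ _ - p z))
  have S' := S.compl H
  have hβp : ∀ x ∈ B, ContDiffAt ℝ ∞ βp (χ x) := fun x hx =>
    S.contDiffAt_form H.toIsMetricOn (hχU hx)
  have hβm : ∀ x ∈ B, ContDiffAt ℝ ∞ βm (χ x) := fun x hx =>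
    S'.contDiffAt_form H.toIsMetricOn (hχU hx)
  let σp := pullback χ βp
  let σm := pullback χ βm
  have hσp0 : ∀ x ∈ B, ∀ u, u.2 = 0 → ∀ v, σp x u v = 0 := by
    intro x hx u hu v
    change h (χ x) (mulI n (p (χ x) (fderiv ℝ χ x u))) _ = 0
    rw [hp2 x hx u hu]; simp
  have hσm0 : ∀ x ∈ B, ∀ u, u.1 = 0 → ∀ v, σm x u v = 0 := by
    intro x hx u hu v
    change h (χ x) (mulI n (fderiv ℝ χ x u - p (χ x) (fderiv ℝ χ x u))) _ = 0
    rw [hp1 x hx u hu]; simp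
  let q₁ : E₁ × E₂ →L[ℝ] E₁ × E₂ :=
    (ContinuousLinearMap.inl ℝ E₁ E₂).comp (ContinuousLinearMap.fst ℝ E₁ E₂)
  let q₂ : E₁ × E₂ →L[ℝ] E₁ × E₂ :=
    (ContinuousLinearMap.inr ℝ E₁ E₂).comp (ContinuousLinearMap.snd ℝ E₁ E₂)
  have hq₁ : ∀ u, q₁ u = (u.1, 0) := fun u => rfl
  have hq₂ : ∀ u, q₂ u = (0, u.2) := fun u => rfl
  have hs₁ : ∀ u : E₁ × E₂, u - q₁ u = (0, u.2) := fun u => by ext1 <;> simp [hq₁]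
  have hs₂ : ∀ u : E₁ × E₂, u - q₂ u = (u.1, 0) := fun u => by ext1 <;> simp [hq₂]
  have hball : ∀ {G : Type} [NormedAddCommGroup G] [NormedSpace ℝ G] (x : G),
      x ∈ Metric.ball (0 : G) r → ∀ t ∈ Icc (0 : ℝ) 1, t • x ∈ Metric.ball (0 : G) r := by
    intro G _ _ x hx t ht
    rw [mem_ball_zero_iff] at hx ⊢
    rw [norm_smul, Real.norm_of_nonneg ht.1]
    exact (mul_le_of_le_one_left (norm_nonneg _) ht.2).trans_lt hx
  -- `σp` is annihilated by the first factor, so contracting that factor shows it is pulled back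
  -- from the second one. The roles are exchanged for `σm`.
  have hσp : ∀ x ∈ B, ∀ u v, σp x u v = σp (0, x.2) (0, u.2) (0, v.2) := by
    intro x hx u v
    have := apply_eq_of_radial hBo (σ := σp)
      (fun x hx => (contDiffAt_pullback (hχat x hx) (hβp x hx)).contDiffWithinAt)
      (fun x hx u v => S.form_antisymm H (hχU hx) _ _)
      (fun x hx => ClosedAt.pullback (hχat x hx) (hβp x hx)
        (S.form_antisymm H (hχU hx)) (S.closed _ (hχU hx))) (q := q₁)
      (fun v => rfl) (fun x hx t ht => by
        rw [hs₁]
        have : ((0 : E₁), x.2) + t • q₁ x = (t • x.1, x.2) := by ext1 <;> simp [hq₁]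
        rw [this]
        exact ⟨hball _ hx.1 t ht, hx.2⟩)
      (fun x hx v => hσp0 x hx _ rfl v) hx u v
    rwa [hs₁, hs₁, hs₁] at this
  have hσm : ∀ x ∈ B, ∀ u v, σm x u v = σm (x.1, 0) (u.1, 0) (v.1, 0) := by
    intro x hx u v
    have := apply_eq_of_radial hBo (σ := σm)
      (fun x hx => (contDiffAt_pullback (hχat x hx) (hβm x hx)).contDiffWithinAt)
      (fun x hx u v => S'.form_antisymm H (hχU hx) _ _)
      (fun x hx => ClosedAt.pullback (hχat x hx) (hβm x hx)
        (S'.form_antisymm H (hχU hx)) (S'.closed _ (hχU hx))) (q := q₂)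
      (fun v => rfl) (fun x hx t ht => by
        rw [hs₂]
        have : (x.1, (0 : E₂)) + t • q₂ x = (x.1, t • x.2) := by ext1 <;> simp [hq₂]
        rw [this]
        exact ⟨hx.1, hball _ hx.2 t ht⟩)
      (fun x hx v => hσm0 x hx _ rfl v) hx u v
    rwa [hs₂, hs₂, hs₂] at this
  -- The metric is recovered from its fundamental form `ω` as `k(u, v) = -ω(Ju, v)`.
  have hk : ∀ x ∈ B, ∀ u v, k x u v = -(σp x (JJ u) v + σm x (JJ u) v) := by
    intro x hx u v
    change h (χ x) (fderiv ℝ χ x u) (fderiv ℝ χ x v) =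
      -(h (χ x) (mulI n (p (χ x) (fderiv ℝ χ x (JJ u)))) (fderiv ℝ χ x v) +
      h (χ x) (mulI n (fderiv ℝ χ x (JJ u) - p (χ x) (fderiv ℝ χ x (JJ u)))) (fderiv ℝ χ x v))
    rw [← add_apply, ← map_add, ← map_add, add_sub_cancel, hχJ x hx, mulI_mulI]
    simp
  have h0 : ∀ {G : Type} [NormedAddCommGroup G], (0 : G) ∈ Metric.ball (0 : G) r := fun {G} _ =>
    Metric.mem_ball_self hr
  let i₁ := ContinuousLinearMap.inl ℝ E₁ E₂
  let i₂ := ContinuousLinearMap.inr ℝ E₁ E₂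
  have hi₁ : MapsTo i₁ (Metric.ball 0 r) B := fun x hx => ⟨hx, h0⟩
  have hi₂ : MapsTo i₂ (Metric.ball 0 r) B := fun x hx => ⟨h0, hx⟩
  -- The factor metrics are the restrictions of `k` to the two slices through the origin.
  let h₁ := pullback i₁ k
  let h₂ := pullback i₂ k
  have hh₁ : ∀ x u v, h₁ x u v = k (x, 0) (u, 0) (v, 0) := by
    intro x u v
    rw [pullback_apply, ContinuousLinearMap.fderiv]; rfl
  have hh₂ : ∀ x u v, h₂ x u v = k (0, x) (0, u) (0, v) := by
    intro x u v
    rw [pullback_apply, ContinuousLinearMap.fderiv]; rfl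
  have K₁ : IsKahlerOn (mulI a) h₁ (Metric.ball 0 r) :=
    K.pullback (mulI_mulI a) Metric.isOpen_ball i₁.contDiff.contDiffOn hi₁
      (fun x hx u hu => by
        rw [ContinuousLinearMap.fderiv] at hu; exact congrArg Prod.fst hu)
      (fun x hx u => by
        rw [ContinuousLinearMap.fderiv]
        exact Prod.ext rfl (map_zero (mulI b)).symm)
  have K₂ : IsKahlerOn (mulI b) h₂ (Metric.ball 0 r) :=
    K.pullback (mulI_mulI b) Metric.isOpen_ball i₂.contDiff.contDiffOn hi₂
      (fun x hx u hu => by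
        rw [ContinuousLinearMap.fderiv] at hu; exact congrArg Prod.snd hu)
      (fun x hx u => by
        rw [ContinuousLinearMap.fderiv]
        exact Prod.ext (map_zero (mulI a)).symm rfl)
  have hJJ₁ : ∀ u : E₁, JJ (u, 0) = (mulI a u, 0) := fun u => Prod.ext rfl (map_zero (mulI b))
  have hJJ₂ : ∀ u : E₂, JJ (0, u) = (0, mulI b u) := fun u => Prod.ext (map_zero (mulI a)) rfl
  have hprod : ∀ x ∈ B, k x = prodMetric h₁ h₂ x := by
    intro x hx
    refine ContinuousLinearMap.ext fun u => ContinuousLinearMap.ext fun v => ?_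
    have hx1 : (x.1, (0 : E₂)) ∈ B := ⟨hx.1, h0⟩
    have hx2 : ((0 : E₁), x.2) ∈ B := ⟨h0, hx.2⟩
    rw [prodMetric_apply, hh₁, hh₂, hk x hx, hk _ hx1, hk _ hx2, hσp x hx, hσm x hx, hJJ₁, hJJ₂,
      hσp0 _ hx1 _ rfl, hσm0 _ hx2 _ rfl]
    change -(σp (0, x.2) (0, mulI b u.2) (0, v.2) + σm (x.1, 0) (mulI a u.1, 0) (v.1, 0)) = _
    ring
  have I : IsLocalIsometryOn χ k B h U :=
    ⟨hχs, hχU, fun x hx u v => rfl, fun x hx v => ⟨_, hDD' x hx v⟩⟩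
  have hRic : ∀ x ∈ B, ∀ u v, ricci h₁ x.1 u.1 v.1 + ricci h₂ x.2 u.2 v.2 =
      lam * h (χ x) (fderiv ℝ χ x u - p (χ x) (fderiv ℝ χ x u)) (fderiv ℝ χ x v)
        + mu * h (χ x) (p (χ x) (fderiv ℝ χ x u)) (fderiv ℝ χ x v) := by
    intro x hx u v
    rw [← ricci_prod K₁.toIsMetricOn K₂.toIsMetricOn hx, ← hric _ (hχU hx),
      ← I.ricci_eq K.toIsMetricOn H.toIsMetricOn hx]
    have : k =ᶠ[𝓝 x] prodMetric h₁ h₂ := by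
      filter_upwards [hBo.mem_nhds hx] with z hz using hprod z hz
    rw [ricci_congr this]
  refine ⟨a, b, Φ, Metric.ball 0 r, Metric.ball 0 r, h₁, h₂, hy₀Φ, hΦU, Metric.isOpen_ball,
    Metric.isOpen_ball, hΦt, hΦs, hΦss, K₁.isKahlerEinsteinOn (c := lam) ?_,
    K₂.isKahlerEinsteinOn (c := mu) ?_, fun y hy => ⟨(hΦ y hy).1, ?_, (hΦ y hy).2⟩⟩
  -- Vectors of the first factor lie in the kernel of `p`, which gives the Einstein constant `lam`;
  -- those of the second lie in the image and give `mu`.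
  · intro x hx u v
    have hx1 : (x, (0 : E₂)) ∈ B := ⟨hx, h0⟩
    have := hRic _ hx1 (u, 0) (v, 0)
    rw [hp2 _ hx1 _ rfl] at this
    rw [hh₁]
    simp only [sub_zero, map_zero, zero_apply, mul_zero, add_zero] at this
    exact this
  · intro x hx u v
    have hx2 : ((0 : E₁), x) ∈ B := ⟨h0, hx⟩
    have := hRic _ hx2 (0, u) (0, v)
    rw [hp1 _ hx2 _ rfl] at this
    rw [hh₂]
    simp only [sub_self, map_zero, zero_apply, mul_zero, zero_add] at this
    exact this
  · intro v w
    have hyB : Φ y ∈ B := by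
      have := Φ.map_source hy
      rwa [hΦt] at this
    have hχy : χ (Φ y) = y := Φ.left_inv hy
    have h1 := hprod _ hyB
    have h2 := prodMetric_apply h₁ h₂ (Φ y) (fderiv ℝ Φ y v) (fderiv ℝ Φ y w)
    rw [← h1] at h2
    rw [← h2]
    change _ = h (χ (Φ y)) (fderiv ℝ χ (Φ y) _) (fderiv ℝ χ (Φ y) _)
    have h3 := hDD' _ hyB v
    have h4 := hDD' _ hyB w
    rw [hχy] at h3 h4
    rw [h3, h4, hχy]

end CoordMetric

/-! ### Tensor fields in charts -/

namespace ComplexManifold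

open CoordMetric

variable {n : ℕ} {M : Type*} [TopologicalSpace M] [ChartedSpace (EuclideanSpace ℂ (Fin n)) M]

/-- The derivative of the inverse of the chart at `x₀`. -/
def chartD (x₀ : M) (y : EuclideanSpace ℂ (Fin n)) :
    EuclideanSpace ℂ (Fin n) →L[ℝ] EuclideanSpace ℂ (Fin n) :=
  mfderiv 𝓘(ℝ, EuclideanSpace ℂ (Fin n)) 𝓘(ℝ, EuclideanSpace ℂ (Fin n))
    (chartAt (EuclideanSpace ℂ (Fin n)) x₀).symm y

/-- The derivative of the chart at `x₀`. -/
def chartDinv (x₀ : M) (y : EuclideanSpace ℂ (Fin n)) :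
    EuclideanSpace ℂ (Fin n) →L[ℝ] EuclideanSpace ℂ (Fin n) :=
  mfderiv 𝓘(ℝ, EuclideanSpace ℂ (Fin n)) 𝓘(ℝ, EuclideanSpace ℂ (Fin n))
    (chartAt (EuclideanSpace ℂ (Fin n)) x₀) ((chartAt (EuclideanSpace ℂ (Fin n)) x₀).symm y)

/-- The value at `x` of a field of bilinear forms, as a bilinear form on the model space. -/
def modelBilin (B : BilinField n M) (x : M) :
    EuclideanSpace ℂ (Fin n) →L[ℝ] EuclideanSpace ℂ (Fin n) →L[ℝ] ℝ := B x

/-- The value at `x` of a field of endomorphisms, as an endomorphism of the model space. -/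
def modelEnd (A : EndField n M) (x : M) : EuclideanSpace ℂ (Fin n) →L[ℝ] EuclideanSpace ℂ (Fin n) :=
  A x

theorem coord_apply (B : BilinField n M) (x₀ : M) (y v w : EuclideanSpace ℂ (Fin n)) :
    coord B x₀ y v w = modelBilin B ((chartAt (EuclideanSpace ℂ (Fin n)) x₀).symm y)
      (chartD x₀ y v) (chartD x₀ y w) := rfl

/-- The expression of a field of endomorphisms in the chart at `x₀`. -/
def coordEnd (A : EndField n M) (x₀ : M) (y : EuclideanSpace ℂ (Fin n)) :
    EuclideanSpace ℂ (Fin n) →L[ℝ] EuclideanSpace ℂ (Fin n) :=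
  (chartDinv x₀ y).comp
    ((modelEnd A ((chartAt (EuclideanSpace ℂ (Fin n)) x₀).symm y)).comp (chartD x₀ y))

theorem coordEnd_apply (A : EndField n M) (x₀ : M) (y v : EuclideanSpace ℂ (Fin n)) :
    coordEnd A x₀ y v = chartDinv x₀ y
      (modelEnd A ((chartAt (EuclideanSpace ℂ (Fin n)) x₀).symm y) (chartD x₀ y v)) := rfl

/-- The change of coordinates from the chart at `x₀` to the chart at `x₁`. -/
def transition (x₀ x₁ : M) :
    OpenPartialHomeomorph (EuclideanSpace ℂ (Fin n)) (EuclideanSpace ℂ (Fin n)) :=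
  (chartAt (EuclideanSpace ℂ (Fin n)) x₀).symm.trans (chartAt (EuclideanSpace ℂ (Fin n)) x₁)

theorem transition_apply (x₀ x₁ : M) (y : EuclideanSpace ℂ (Fin n)) :
    transition x₀ x₁ y = chartAt (EuclideanSpace ℂ (Fin n)) x₁
      ((chartAt (EuclideanSpace ℂ (Fin n)) x₀).symm y) := rfl

theorem mem_transition_source {x₀ x₁ : M} {y : EuclideanSpace ℂ (Fin n)} :
    y ∈ (transition x₀ x₁).source ↔ y ∈ (chartAt (EuclideanSpace ℂ (Fin n)) x₀).target ∧
      (chartAt (EuclideanSpace ℂ (Fin n)) x₀).symm y ∈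
        (chartAt (EuclideanSpace ℂ (Fin n)) x₁).source := by
  simp [transition]

theorem mem_transition_source_self {x₀ : M} {y : EuclideanSpace ℂ (Fin n)}
    (hy : y ∈ (chartAt (EuclideanSpace ℂ (Fin n)) x₀).target) :
    y ∈ (transition x₀ ((chartAt (EuclideanSpace ℂ (Fin n)) x₀).symm y)).source :=
  mem_transition_source.2 ⟨hy, mem_chart_source _ _⟩

theorem transition_mem_target {x₀ x₁ : M} {y : EuclideanSpace ℂ (Fin n)}
    (hy : y ∈ (transition x₀ x₁).source) :
    transition x₀ x₁ y ∈ (chartAt (EuclideanSpace ℂ (Fin n)) x₁).target :=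
  (chartAt (EuclideanSpace ℂ (Fin n)) x₁).map_source (mem_transition_source.1 hy).2

theorem symm_transition {x₀ x₁ : M} {y : EuclideanSpace ℂ (Fin n)}
    (hy : y ∈ (transition x₀ x₁).source) :
    (chartAt (EuclideanSpace ℂ (Fin n)) x₁).symm (transition x₀ x₁ y) =
      (chartAt (EuclideanSpace ℂ (Fin n)) x₀).symm y :=
  (chartAt (EuclideanSpace ℂ (Fin n)) x₁).left_inv (mem_transition_source.1 hy).2

theorem transition_symm_apply {x₀ x₁ : M} {y : EuclideanSpace ℂ (Fin n)}
    (hy : y ∈ (transition x₀ x₁).source) :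
    transition x₁ x₀ (transition x₀ x₁ y) = y := by
  rw [transition_apply, symm_transition hy,
    (chartAt (EuclideanSpace ℂ (Fin n)) x₀).right_inv (mem_transition_source.1 hy).1]

theorem transition_mem_source {x₀ x₁ : M} {y : EuclideanSpace ℂ (Fin n)}
    (hy : y ∈ (transition x₀ x₁).source) :
    transition x₀ x₁ y ∈ (transition x₁ x₀).source := by
  refine mem_transition_source.2 ⟨transition_mem_target hy, ?_⟩
  rw [symm_transition hy]
  exact (chartAt (EuclideanSpace ℂ (Fin n)) x₀).map_target (mem_transition_source.1 hy).1

section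

variable [IsManifold 𝓘(ℂ, EuclideanSpace ℂ (Fin n)) ω M]

theorem mdifferentiable_chart_real (x₀ : M) :
    (chartAt (EuclideanSpace ℂ (Fin n)) x₀).MDifferentiable 𝓘(ℝ, EuclideanSpace ℂ (Fin n))
      𝓘(ℝ, EuclideanSpace ℂ (Fin n)) := by
  have : IsManifold 𝓘(ℝ, EuclideanSpace ℂ (Fin n)) 1 M := .of_le (n := ∞) (by simp)
  exact mdifferentiable_chart x₀

theorem chartD_chartDinv {x₀ : M} {y : EuclideanSpace ℂ (Fin n)}
    (hy : y ∈ (chartAt (EuclideanSpace ℂ (Fin n)) x₀).target) (v : EuclideanSpace ℂ (Fin n)) :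
    chartD x₀ y (chartDinv x₀ y v) = v := by
  have h := (mdifferentiable_chart_real x₀).symm_comp_deriv
    ((chartAt (EuclideanSpace ℂ (Fin n)) x₀).map_target hy)
  have h2 := DFunLike.congr_fun h v
  rw [(chartAt (EuclideanSpace ℂ (Fin n)) x₀).right_inv hy] at h2
  exact h2

theorem chartDinv_chartD {x₀ : M} {y : EuclideanSpace ℂ (Fin n)}
    (hy : y ∈ (chartAt (EuclideanSpace ℂ (Fin n)) x₀).target) (v : EuclideanSpace ℂ (Fin n)) :
    chartDinv x₀ y (chartD x₀ y v) = v :=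
  DFunLike.congr_fun ((mdifferentiable_chart_real x₀).comp_symm_deriv hy) v

theorem contDiffOn_transition_complex (x₀ x₁ : M) :
    ContDiffOn ℂ ω (transition (n := n) x₀ x₁) (transition (n := n) x₀ x₁).source := by
  have h := (contDiffGroupoid ω 𝓘(ℂ, EuclideanSpace ℂ (Fin n))).compatible
    (chart_mem_atlas _ x₀) (chart_mem_atlas _ x₁)
  rw [contDiffGroupoid, mem_groupoid_of_pregroupoid] at h
  have h1 := h.1
  simp only [contDiffPregroupoid, modelWithCornersSelf_coe, modelWithCornersSelf_coe_symm,
    Function.id_comp, Function.comp_id, preimage_id_eq, id_eq, range_id, inter_univ] at h1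
  exact h1

theorem contDiffAt_transition {x₀ x₁ : M} {y : EuclideanSpace ℂ (Fin n)}
    (hy : y ∈ (transition x₀ x₁).source) : ContDiffAt ℝ ∞ (transition x₀ x₁) y :=
  (((contDiffOn_transition_complex x₀ x₁).restrict_scalars ℝ).contDiffAt
    ((transition x₀ x₁).open_source.mem_nhds hy)).of_le le_top

theorem fderiv_transition_mulI {x₀ x₁ : M} {y : EuclideanSpace ℂ (Fin n)}
    (hy : y ∈ (transition x₀ x₁).source) (v : EuclideanSpace ℂ (Fin n)) :
    fderiv ℝ (transition x₀ x₁) y (mulI n v) = mulI n (fderiv ℝ (transition x₀ x₁) y v) := by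
  have h : DifferentiableAt ℂ (transition x₀ x₁) y :=
    ((contDiffOn_transition_complex x₀ x₁).contDiffAt
      ((transition x₀ x₁).open_source.mem_nhds hy)).differentiableAt (by simp)
  rw [h.fderiv_restrictScalars ℝ]
  exact (fderiv ℂ (transition x₀ x₁) y).map_smul Complex.I v

theorem chartD_fderiv_transition {x₀ x₁ : M} {y : EuclideanSpace ℂ (Fin n)}
    (hy : y ∈ (transition x₀ x₁).source) (v : EuclideanSpace ℂ (Fin n)) :
    chartD x₁ (transition x₀ x₁ y) (fderiv ℝ (transition x₀ x₁) y v) = chartD x₀ y v := by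
  have h1 := ((mdifferentiable_chart_real x₁).mdifferentiableAt_symm
    (transition_mem_target hy)).hasMFDerivAt
  have h2 := (contDiffAt_transition hy).differentiableAt_infty.hasFDerivAt.hasMFDerivAt
  have h3 := (h1.comp y h2).congr_of_eventuallyEq
    (f₁ := (chartAt (EuclideanSpace ℂ (Fin n)) x₀).symm) (by
      filter_upwards [(transition x₀ x₁).open_source.mem_nhds hy] with z hz
      exact (symm_transition hz).symm)
  exact (DFunLike.congr_fun h3.mfderiv v).symm

/-- `mfderiv` takes values in the tangent space at the image point, which is identified with the
model space by the preferred chart of that point and not by the chart at `x₀`. -/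
theorem chartD_symm_self {x₀ : M} {y : EuclideanSpace ℂ (Fin n)}
    (hy : y ∈ (chartAt (EuclideanSpace ℂ (Fin n)) x₀).target) :
    chartD x₀ y =
      fderiv ℝ (transition x₀ ((chartAt (EuclideanSpace ℂ (Fin n)) x₀).symm y)) y := by
  have h := ((mdifferentiable_chart_real x₀).mdifferentiableAt_symm hy)
  have h2 := h.mfderiv
  rw [chartD]
  refine h2.trans ?_
  simp only [writtenInExtChartAt, extChartAt_model_space_eq_id, modelWithCornersSelf_coe, range_id,
    fderivWithin_univ]
  rfl

theorem chartD_mulI {x₀ : M} {y : EuclideanSpace ℂ (Fin n)}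
    (hy : y ∈ (chartAt (EuclideanSpace ℂ (Fin n)) x₀).target) (v : EuclideanSpace ℂ (Fin n)) :
    chartD x₀ y (mulI n v) = mulI n (chartD x₀ y v) := by
  rw [chartD_symm_self hy, fderiv_transition_mulI (mem_transition_source_self hy)]

theorem chartDinv_mulI {x₀ : M} {y : EuclideanSpace ℂ (Fin n)}
    (hy : y ∈ (chartAt (EuclideanSpace ℂ (Fin n)) x₀).target) (v : EuclideanSpace ℂ (Fin n)) :
    chartDinv x₀ y (mulI n v) = mulI n (chartDinv x₀ y v) := by
  rw [← chartDinv_chartD hy (mulI n (chartDinv x₀ y v)), chartD_mulI hy, chartD_chartDinv hy]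

theorem chartD_self (x : M) : chartD x (chartAt (EuclideanSpace ℂ (Fin n)) x x) =
    ContinuousLinearMap.id ℝ (EuclideanSpace ℂ (Fin n)) := by
  have hy := mem_chart_target (EuclideanSpace ℂ (Fin n)) x
  rw [chartD_symm_self hy, (chartAt (EuclideanSpace ℂ (Fin n)) x).left_inv (mem_chart_source _ _)]
  have : transition x x =ᶠ[𝓝 (chartAt (EuclideanSpace ℂ (Fin n)) x x)] id := by
    filter_upwards [(chartAt (EuclideanSpace ℂ (Fin n)) x).open_target.mem_nhds hy] with z hz
    exact (chartAt (EuclideanSpace ℂ (Fin n)) x).right_inv hz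
  rw [this.fderiv_eq, fderiv_id]

theorem chartDinv_self (x : M) : chartDinv x (chartAt (EuclideanSpace ℂ (Fin n)) x x) =
    ContinuousLinearMap.id ℝ (EuclideanSpace ℂ (Fin n)) := by
  ext1 v
  have := chartDinv_chartD (mem_chart_target (EuclideanSpace ℂ (Fin n)) x) v
  rwa [chartD_self] at this

theorem coord_self (B : BilinField n M) (x : M) :
    coord B x (chartAt (EuclideanSpace ℂ (Fin n)) x x) = B x := by
  refine ContinuousLinearMap.ext fun v => ContinuousLinearMap.ext fun w => ?_
  rw [coord_apply, chartD_self,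
    (chartAt (EuclideanSpace ℂ (Fin n)) x).left_inv (mem_chart_source _ _)]
  rfl

theorem coordEnd_self (A : EndField n M) (x : M) :
    coordEnd A x (chartAt (EuclideanSpace ℂ (Fin n)) x x) = A x := by
  refine ContinuousLinearMap.ext fun v => ?_
  rw [coordEnd_apply, chartD_self, chartDinv_self,
    (chartAt (EuclideanSpace ℂ (Fin n)) x).left_inv (mem_chart_source _ _)]
  rfl

theorem coord_transition (B : BilinField n M) {x₀ x₁ : M} {y : EuclideanSpace ℂ (Fin n)}
    (hy : y ∈ (transition x₀ x₁).source) :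
    coord B x₀ y = pullback (transition x₀ x₁) (coord B x₁) y := by
  refine ContinuousLinearMap.ext fun v => ContinuousLinearMap.ext fun w => ?_
  rw [pullback_apply, coord_apply, coord_apply, chartD_fderiv_transition hy,
    chartD_fderiv_transition hy, symm_transition hy]

theorem fderiv_transition_coordEnd (A : EndField n M) {x₀ x₁ : M} {y : EuclideanSpace ℂ (Fin n)}
    (hy : y ∈ (transition x₀ x₁).source) (v : EuclideanSpace ℂ (Fin n)) :
    fderiv ℝ (transition x₀ x₁) y (coordEnd A x₀ y v) =
      coordEnd A x₁ (transition x₀ x₁ y) (fderiv ℝ (transition x₀ x₁) y v) := by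
  have ht := transition_mem_target hy
  have h0 := (mem_transition_source.1 hy).1
  rw [← chartDinv_chartD ht (fderiv ℝ (transition x₀ x₁) y (coordEnd A x₀ y v)),
    chartD_fderiv_transition hy, coordEnd_apply, coordEnd_apply, chartD_chartDinv h0,
    chartD_fderiv_transition hy, symm_transition hy]

theorem fderiv_transition_symm {x₀ x₁ : M} {y : EuclideanSpace ℂ (Fin n)}
    (hy : y ∈ (transition x₀ x₁).source) (v : EuclideanSpace ℂ (Fin n)) :
    fderiv ℝ (transition x₁ x₀) (transition x₀ x₁ y) (fderiv ℝ (transition x₀ x₁) y v) = v := by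
  have h0 := (mem_transition_source.1 hy).1
  have h := chartD_fderiv_transition (transition_mem_source hy) (fderiv ℝ (transition x₀ x₁) y v)
  rw [transition_symm_apply hy, chartD_fderiv_transition hy] at h
  rw [← chartDinv_chartD h0 (fderiv ℝ (transition x₁ x₀) _ _), h, chartDinv_chartD h0]

theorem coordEnd_transition (A : EndField n M) {x₀ x₁ : M} {y : EuclideanSpace ℂ (Fin n)}
    (hy : y ∈ (transition x₀ x₁).source) :
    coordEnd A x₀ y = (fderiv ℝ (transition x₁ x₀) (transition x₀ x₁ y)).comp
      ((coordEnd A x₁ (transition x₀ x₁ y)).comp (fderiv ℝ (transition x₀ x₁) y)) := by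
  refine ContinuousLinearMap.ext fun v => ?_
  change _ = fderiv ℝ (transition x₁ x₀) _ (coordEnd A x₁ _ (fderiv ℝ (transition x₀ x₁) y v))
  rw [← fderiv_transition_coordEnd A hy, fderiv_transition_symm hy]

/-- Any point of a chart is carried by a transition map to the centre of its own preferred chart, so
smoothness at the centres suffices. -/
theorem contDiffOn_coord {B : BilinField n M}
    (h : ∀ x, ContDiffAt ℝ ∞ (coord B x) (chartAt (EuclideanSpace ℂ (Fin n)) x x)) (x₀ : M) :
    ContDiffOn ℝ ∞ (coord B x₀) (chartAt (EuclideanSpace ℂ (Fin n)) x₀).target := by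
  intro y hy
  have hs := mem_transition_source_self hy
  refine ((contDiffAt_pullback (contDiffAt_transition hs) (h _)).congr_of_eventuallyEq
    ?_).contDiffWithinAt
  filter_upwards [(transition x₀ _).open_source.mem_nhds hs] with z hz
  exact coord_transition B hz

theorem contDiffOn_coordEnd {A : EndField n M}
    (h : ∀ x, ContDiffAt ℝ ∞ (coordEnd A x) (chartAt (EuclideanSpace ℂ (Fin n)) x x)) (x₀ : M) :
    ContDiffOn ℝ ∞ (coordEnd A x₀) (chartAt (EuclideanSpace ℂ (Fin n)) x₀).target := by
  intro y hy
  have hs := mem_transition_source_self hy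
  have ht := contDiffAt_transition hs
  have ht' := contDiffAt_transition (transition_mem_source hs)
  refine (((ht'.fderiv_infty.comp y ht).clm_comp (((h _).comp y ht).clm_comp
    ht.fderiv_infty)).congr_of_eventuallyEq ?_).contDiffWithinAt
  filter_upwards [(transition x₀ _).open_source.mem_nhds hs] with z hz
  exact coordEnd_transition A hz

theorem contMDiffAt_iff_comp_chart_symm {F : Type*} [NormedAddCommGroup F] [NormedSpace ℝ F]
    {f : M → F} {f' : EuclideanSpace ℂ (Fin n) → F} {x : M}
    (hf : ∀ᶠ z in 𝓝 x, f z = f' (chartAt (EuclideanSpace ℂ (Fin n)) x z)) :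
    ContMDiffAt 𝓘(ℝ, EuclideanSpace ℂ (Fin n)) 𝓘(ℝ, F) ∞ f x ↔
      ContDiffAt ℝ ∞ f' (chartAt (EuclideanSpace ℂ (Fin n)) x x) := by
  have hx := mem_chart_source (EuclideanSpace ℂ (Fin n)) x
  have ht := mem_chart_target (EuclideanSpace ℂ (Fin n)) x
  have hl := (chartAt (EuclideanSpace ℂ (Fin n)) x).left_inv hx
  rw [← contMDiffAt_iff_contDiffAt]
  constructor
  · intro h
    rw [← hl] at h
    have h1 : ContMDiffAt 𝓘(ℝ, EuclideanSpace ℂ (Fin n)) 𝓘(ℝ, EuclideanSpace ℂ (Fin n)) ∞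
        (chartAt (EuclideanSpace ℂ (Fin n)) x).symm (chartAt (EuclideanSpace ℂ (Fin n)) x x) :=
      contMDiffOn_chart_symm.contMDiffAt
        ((chartAt (EuclideanSpace ℂ (Fin n)) x).open_target.mem_nhds ht)
    refine (ContMDiffAt.comp _ h h1).congr_of_eventuallyEq ?_
    have h2 := (chartAt (EuclideanSpace ℂ (Fin n)) x).continuousAt_symm ht
    rw [ContinuousAt, hl] at h2
    filter_upwards [h2.eventually hf,
      (chartAt (EuclideanSpace ℂ (Fin n)) x).open_target.mem_nhds ht] with z hz hz'
    rw [Function.comp_apply, hz, (chartAt (EuclideanSpace ℂ (Fin n)) x).right_inv hz']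
  · intro h
    have h1 : ContMDiffAt 𝓘(ℝ, EuclideanSpace ℂ (Fin n)) 𝓘(ℝ, EuclideanSpace ℂ (Fin n)) ∞
        (chartAt (EuclideanSpace ℂ (Fin n)) x) x :=
      contMDiffOn_chart.contMDiffAt ((chartAt (EuclideanSpace ℂ (Fin n)) x).open_source.mem_nhds hx)
    exact (ContMDiffAt.comp _ h h1).congr_of_eventuallyEq hf

theorem symmL_trivializationAt_eq {x₀ x : M}
    (hx : x ∈ (chartAt (EuclideanSpace ℂ (Fin n)) x₀).source) :
    (trivializationAt (EuclideanSpace ℂ (Fin n))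
      (TangentSpace 𝓘(ℝ, EuclideanSpace ℂ (Fin n)) (M := M)) x₀).symmL ℝ x
      = chartD x₀ (chartAt (EuclideanSpace ℂ (Fin n)) x₀ x) := by
  have : IsManifold 𝓘(ℝ, EuclideanSpace ℂ (Fin n)) 1 M := .of_le (n := ∞) (by simp)
  rw [TangentBundle.symmL_trivializationAt hx, chartD]
  simp
  rfl

theorem continuousLinearMapAt_trivializationAt_eq {x₀ x : M}
    (hx : x ∈ (chartAt (EuclideanSpace ℂ (Fin n)) x₀).source) :
    (trivializationAt (EuclideanSpace ℂ (Fin n))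
      (TangentSpace 𝓘(ℝ, EuclideanSpace ℂ (Fin n)) (M := M)) x₀).continuousLinearMapAt ℝ x
      = chartDinv x₀ (chartAt (EuclideanSpace ℂ (Fin n)) x₀ x) := by
  have : IsManifold 𝓘(ℝ, EuclideanSpace ℂ (Fin n)) 1 M := .of_le (n := ∞) (by simp)
  rw [TangentBundle.continuousLinearMapAt_trivializationAt hx, chartDinv,
    (chartAt (EuclideanSpace ℂ (Fin n)) x₀).left_inv hx]
  simp
  rfl

theorem isSmoothEnd_iff {A : EndField n M} : IsSmoothEnd A ↔
    ∀ x, ContDiffAt ℝ ∞ (coordEnd A x) (chartAt (EuclideanSpace ℂ (Fin n)) x x) := by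
  refine forall_congr' fun x => ?_
  rw [contMDiffAt_hom_bundle]
  refine (and_iff_right contMDiffAt_id).trans (contMDiffAt_iff_comp_chart_symm ?_)
  filter_upwards [(chartAt (EuclideanSpace ℂ (Fin n)) x).open_source.mem_nhds
    (mem_chart_source (EuclideanSpace ℂ (Fin n)) x)] with z hz
  refine ContinuousLinearMap.ext fun v => ?_
  rw [coordEnd_apply, (chartAt (EuclideanSpace ℂ (Fin n)) x).left_inv hz,
    ContinuousLinearMap.inCoordinates, symmL_trivializationAt_eq hz,
    continuousLinearMapAt_trivializationAt_eq hz]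
  rfl

/-- Smoothness of a section of the bundle of bilinear forms. -/
theorem contMDiff_bilin_iff {B : BilinField n M} : ContMDiff 𝓘(ℝ, EuclideanSpace ℂ (Fin n))
    (𝓘(ℝ, EuclideanSpace ℂ (Fin n)).prod
      𝓘(ℝ, EuclideanSpace ℂ (Fin n) →L[ℝ] EuclideanSpace ℂ (Fin n) →L[ℝ] ℝ)) ∞
    (fun x => Bundle.TotalSpace.mk'
      (EuclideanSpace ℂ (Fin n) →L[ℝ] EuclideanSpace ℂ (Fin n) →L[ℝ] ℝ)
      (E := fun x : M => Tan n x →L[ℝ] Tan n x →L[ℝ] ℝ) x (B x)) ↔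
    ∀ x, ContDiffAt ℝ ∞ (coord B x) (chartAt (EuclideanSpace ℂ (Fin n)) x x) := by
  refine forall_congr' fun x => ?_
  rw [contMDiffAt_hom_bundle]
  refine (and_iff_right contMDiffAt_id).trans (contMDiffAt_iff_comp_chart_symm ?_)
  filter_upwards [(chartAt (EuclideanSpace ℂ (Fin n)) x).open_source.mem_nhds
    (mem_chart_source (EuclideanSpace ℂ (Fin n)) x)] with z hz
  refine ContinuousLinearMap.ext fun v => ContinuousLinearMap.ext fun w => ?_
  have hs : ∀ u, (trivializationAt (EuclideanSpace ℂ (Fin n))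
      (TangentSpace 𝓘(ℝ, EuclideanSpace ℂ (Fin n)) (M := M)) x).symm z u =
      chartD x (chartAt (EuclideanSpace ℂ (Fin n)) x z) u := by
    intro u
    rw [← symmL_trivializationAt_eq hz]
    exact (Bundle.Trivialization.symmL_apply _ hz u).symm
  rw [coord_apply, (chartAt (EuclideanSpace ℂ (Fin n)) x).left_inv hz, ← hs, ← hs]
  refine (inCoordinates_apply_eq₂ (E₃ := Bundle.Trivial M ℝ) (F₃ := ℝ) hz hz (mem_univ _)).trans ?_
  simp
  rfl

end

end ComplexManifold

/-! ### Riemannian and Kähler metrics in charts -/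

namespace CoordMetric

variable {V : Type*} [NormedAddCommGroup V] [NormedSpace ℝ V]
  {h : V → V →L[ℝ] V →L[ℝ] ℝ} {U : Set V}

/-- The unit ball of a positive definite form on a finite-dimensional space is bounded. -/
theorem isVonNBounded_of_pos [FiniteDimensional ℝ V] (b : V →L[ℝ] V →L[ℝ] ℝ)
    (hb : ∀ v, v ≠ 0 → 0 < b v v) : Bornology.IsVonNBounded ℝ {v : V | b v v < 1} := by
  -- In dimension zero the unit sphere, on which the form is minimised below, is empty.
  rcases subsingleton_or_nontrivial V with hV | hV
  · exact (Bornology.isVonNBounded_singleton (0 : V)).subset fun v _ => Subsingleton.elim v 0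
  have : ProperSpace V := FiniteDimensional.proper_real V
  have hc : Continuous fun v : V => b v v := by fun_prop
  obtain ⟨u, hu, hmin⟩ := (isCompact_sphere (0 : V) 1).exists_isMinOn
    (NormedSpace.sphere_nonempty.2 zero_le_one) hc.continuousOn
  have hu0 : u ≠ 0 := by
    rintro rfl
    simp at hu
  have hm := hb u hu0
  rw [NormedSpace.isVonNBounded_iff, isBounded_iff_forall_norm_le]
  refine ⟨Real.sqrt (1 / b u u), fun v hv => Real.le_sqrt_of_sq_le ?_⟩
  rw [le_div_iff₀ hm]
  rcases eq_or_ne v 0 with rfl | hv0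
  · simp
  have hn : 0 < ‖v‖ := norm_pos_iff.2 hv0
  have h1 : b u u ≤ b (‖v‖⁻¹ • v) (‖v‖⁻¹ • v) := hmin (by simp [norm_smul, hn.ne'])
  have h2 : b v v < 1 := hv
  simp only [map_smul, smul_apply, smul_eq_mul] at h1
  have h3 : ‖v‖ ^ 2 * b u u ≤ ‖v‖ ^ 2 * (‖v‖⁻¹ * (‖v‖⁻¹ * b v v)) :=
    mul_le_mul_of_nonneg_left h1 (sq_nonneg _)
  have h4 : ‖v‖ ^ 2 * (‖v‖⁻¹ * (‖v‖⁻¹ * b v v)) = b v v := by field_simp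
  linarith

end CoordMetric

namespace ComplexManifold

open CoordMetric

variable {n : ℕ} {M : Type*} [TopologicalSpace M] [ChartedSpace (EuclideanSpace ℂ (Fin n)) M]
  [IsManifold 𝓘(ℂ, EuclideanSpace ℂ (Fin n)) ω M]

theorem isMetricOn_coord (g : Metric n M) (x₀ : M) :
    IsMetricOn (coord g.inner x₀) (chartAt (EuclideanSpace ℂ (Fin n)) x₀).target where
  isOpen := (chartAt (EuclideanSpace ℂ (Fin n)) x₀).open_target
  smooth := contDiffOn_coord (contMDiff_bilin_iff.1 g.contMDiff) x₀
  symm y _ v w := g.symm ((chartAt (EuclideanSpace ℂ (Fin n)) x₀).symm y) (chartD x₀ y v)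
    (chartD x₀ y w)
  pos y hy v hv := by
    have hne : chartD x₀ y v ≠ 0 := fun h => hv (by
      rw [← chartDinv_chartD hy v, h, map_zero])
    exact g.pos ((chartAt (EuclideanSpace ℂ (Fin n)) x₀).symm y) (chartD x₀ y v) hne

theorem coord_fundamentalForm (B : BilinField n M) (A : EndField n M) {x₀ : M}
    {y : EuclideanSpace ℂ (Fin n)} (hy : y ∈ (chartAt (EuclideanSpace ℂ (Fin n)) x₀).target) :
    coord (fundamentalForm B A) x₀ y = (coord B x₀ y).comp (coordEnd A x₀ y) := by
  refine ContinuousLinearMap.ext fun v => ContinuousLinearMap.ext fun w => ?_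
  rw [ContinuousLinearMap.comp_apply, coord_apply, coord_apply, coordEnd_apply,
    chartD_chartDinv hy]
  rfl

theorem coordEnd_cplx {x₀ : M} {y : EuclideanSpace ℂ (Fin n)}
    (hy : y ∈ (chartAt (EuclideanSpace ℂ (Fin n)) x₀).target) :
    coordEnd cplx x₀ y = mulI n := by
  refine ContinuousLinearMap.ext fun v => ?_
  rw [coordEnd_apply]
  change chartDinv x₀ y (mulI n (chartD x₀ y v)) = _
  rw [chartDinv_mulI hy, chartDinv_chartD hy]

theorem closedAt_fundamentalForm_iff (B : BilinField n M) (A : EndField n M) {x₀ : M}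
    {y : EuclideanSpace ℂ (Fin n)} (hy : y ∈ (chartAt (EuclideanSpace ℂ (Fin n)) x₀).target) :
    ClosedAt (coord (fundamentalForm B A) x₀) y ↔
      ClosedAt (fun z => (coord B x₀ z).comp (coordEnd A x₀ z)) y := by
  have : coord (fundamentalForm B A) x₀ =ᶠ[𝓝 y]
      fun z => (coord B x₀ z).comp (coordEnd A x₀ z) := by
    filter_upwards [(chartAt (EuclideanSpace ℂ (Fin n)) x₀).open_target.mem_nhds hy] with z hz
    exact coord_fundamentalForm B A hz
  exact ⟨fun h => h.congr this, fun h => h.congr this.symm⟩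

theorem closedAt_fundamentalForm_cplx_iff (B : BilinField n M) {x₀ : M}
    {y : EuclideanSpace ℂ (Fin n)} (hy : y ∈ (chartAt (EuclideanSpace ℂ (Fin n)) x₀).target) :
    ClosedAt (coord (fundamentalForm B cplx) x₀) y ↔
      ClosedAt (fun z => (coord B x₀ z).comp (mulI n)) y := by
  have : coord (fundamentalForm B cplx) x₀ =ᶠ[𝓝 y] fun z => (coord B x₀ z).comp (mulI n) := by
    filter_upwards [(chartAt (EuclideanSpace ℂ (Fin n)) x₀).open_target.mem_nhds hy] with z hz
    rw [coord_fundamentalForm B cplx hz, coordEnd_cplx hz]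
  exact ⟨fun h => h.congr this, fun h => h.congr this.symm⟩

/-- Transition maps are holomorphic, so `J` is the constant `mulI n` in every chart and the
coordinate theory applies. -/
theorem isKahler_iff {g : Metric n M} : IsKahler g ↔ ∀ x₀ : M,
    IsKahlerOn (mulI n) (coord g.inner x₀) (chartAt (EuclideanSpace ℂ (Fin n)) x₀).target := by
  constructor
  · intro h x₀
    refine { isMetricOn_coord g x₀ with sq := mulI_mulI n, hermitian := ?_, closed := ?_ }
    · intro y hy v w
      rw [coord_apply, coord_apply, chartD_mulI hy, chartD_mulI hy]
      exact h.orthogonal _ _ _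
    · intro y hy
      exact (closedAt_fundamentalForm_cplx_iff _ hy).1 (h.closed x₀ y hy)
  · intro h
    constructor
    · intro x v w
      have := (h x).hermitian _ (mem_chart_target _ x) v w
      rwa [coord_self] at this
    · intro x₀ y hy
      exact (closedAt_fundamentalForm_cplx_iff _ hy).2 ((h x₀).closed y hy)

theorem isLocalIsometryOn_transition (g : Metric n M) (x₀ x₁ : M) :
    IsLocalIsometryOn (transition x₀ x₁) (coord g.inner x₀) (transition (n := n) x₀ x₁).source
      (coord g.inner x₁) (chartAt (EuclideanSpace ℂ (Fin n)) x₁).target where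
  smooth y hy := (contDiffAt_transition hy).contDiffWithinAt
  mapsTo y hy := transition_mem_target hy
  pullback y hy v w := by
    rw [coord_transition _ hy]
    rfl
  surjective y hy v := by
    have h := fderiv_transition_symm (transition_mem_source hy) v
    rw [transition_symm_apply hy] at h
    exact ⟨_, h⟩

/-- `ricci` is computed at each point in the preferred chart of that point. Transition maps are
isometries of the coordinate metrics, so every chart gives the same tensor. -/
theorem coord_ricci (g : Metric n M) {x₀ : M} {y : EuclideanSpace ℂ (Fin n)}
    (hy : y ∈ (chartAt (EuclideanSpace ℂ (Fin n)) x₀).target) :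
    coord (ricci g) x₀ y = CoordMetric.ricci (coord g.inner x₀) y := by
  have hs := mem_transition_source_self hy
  refine ContinuousLinearMap.ext fun v => ContinuousLinearMap.ext fun w => ?_
  rw [(isLocalIsometryOn_transition g x₀ _).ricci_eq
    ((isMetricOn_coord g x₀).mono (transition x₀ _).open_source fun z hz =>
      (mem_transition_source.1 hz).1) (isMetricOn_coord g _) hs, coord_apply, chartD_symm_self hy]
  rfl

theorem apply_ricciEnd (g : Metric n M) (x : M) (v w : EuclideanSpace ℂ (Fin n)) :
    modelBilin g.inner x (modelEnd (ricciEnd g) x v) w = modelBilin (ricci g) x v w := by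
  have h := (isMetricOn_coord g x).apply_inverse (mem_chart_target _ x) (modelBilin (ricci g) x v)
  rw [coord_self] at h
  exact congrArg (fun l : EuclideanSpace ℂ (Fin n) →L[ℝ] ℝ => l w) h

theorem modelBilin_ext {g : Metric n M} {x : M} {v w : EuclideanSpace ℂ (Fin n)}
    (h : ∀ u, modelBilin g.inner x v u = modelBilin g.inner x w u) : v = w := by
  refine (isMetricOn_coord g x).ext_left (mem_chart_target _ x) fun u => ?_
  rw [coord_self]
  exact h u

theorem coord_coordEnd_ricciEnd (g : Metric n M) {x₀ : M} {y : EuclideanSpace ℂ (Fin n)}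
    (hy : y ∈ (chartAt (EuclideanSpace ℂ (Fin n)) x₀).target) (v w : EuclideanSpace ℂ (Fin n)) :
    coord g.inner x₀ y (coordEnd (ricciEnd g) x₀ y v) w =
      CoordMetric.ricci (coord g.inner x₀) y v w := by
  rw [← coord_ricci g hy, coord_apply, coord_apply, coordEnd_apply, chartD_chartDinv hy,
    apply_ricciEnd]

theorem contDiffAt_coordEnd_ricciEnd (g : Metric n M) {x₀ : M} {y : EuclideanSpace ℂ (Fin n)}
    (hy : y ∈ (chartAt (EuclideanSpace ℂ (Fin n)) x₀).target) :
    ContDiffAt ℝ ∞ (coordEnd (ricciEnd g) x₀) y := by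
  have H := isMetricOn_coord g x₀
  refine ((H.contDiffAt_inverse hy).clm_comp (contDiffAt_ricci H hy)).congr_of_eventuallyEq ?_
  filter_upwards [(chartAt (EuclideanSpace ℂ (Fin n)) x₀).open_target.mem_nhds hy] with z hz
  refine ContinuousLinearMap.ext fun v => ?_
  rw [ContinuousLinearMap.comp_apply, ← H.inverse_apply hz (coordEnd (ricciEnd g) x₀ z v)]
  congr 1
  exact ContinuousLinearMap.ext fun w => coord_coordEnd_ricciEnd g hz v w

/-- The metric with given values. -/
def metricOfBilin (B : BilinField n M) (symm : ∀ x v w, B x v w = B x w v)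
    (pos : ∀ x v, v ≠ 0 → 0 < B x v v)
    (smooth : ∀ x, ContDiffAt ℝ ∞ (coord B x) (chartAt (EuclideanSpace ℂ (Fin n)) x x)) :
    Metric n M where
  inner := B
  symm := symm
  pos := pos
  isVonNBounded x := isVonNBounded_of_pos (modelBilin B x) (pos x)
  contMDiff := contMDiff_bilin_iff.2 smooth

theorem metric_ext {g g' : Metric n M}
    (h : ∀ x v w, modelBilin g.inner x v w = modelBilin g'.inner x v w) : g = g' := by
  have : g.inner = g'.inner := funext fun x =>
    ContinuousLinearMap.ext fun v => ContinuousLinearMap.ext fun w => h x v w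
  cases g
  cases g'
  congr

end ComplexManifold

/-! ### Orthogonal splittings of Kähler metrics -/

/-- An operator which is self-adjoint for a positive definite form and has at most the two
eigenvalues `lam`, `mu` is annihilated by `(X - lam) (X - mu)`. -/
theorem apply_apply_eq_of_eigenvalues {V : Type*} [AddCommGroup V] [Module ℝ V]
    [FiniteDimensional ℝ V] {b : V → V → ℝ} (hadd : ∀ u v w, b (u + v) w = b u w + b v w)
    (hsmul : ∀ (c : ℝ) v w, b (c • v) w = c * b v w) (hsymm : ∀ v w, b v w = b w v)
    (hpos : ∀ v, v ≠ 0 → 0 < b v v) {R : Module.End ℝ V} (hR : ∀ v w, b (R v) w = b v (R w))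
    {lam mu : ℝ} (heig : ∀ c, R.HasEigenvalue c → c = lam ∨ c = mu) (v : V) :
    R (R v) = (lam + mu) • R v - (lam * mu) • v := by
  have h0 : b 0 0 = 0 := by simpa using hsmul 0 0 0
  -- With `b` as inner product the spectral theorem shows that the eigenspaces span `V`, and the
  -- polynomial identity is checked on eigenvectors.
  let core : InnerProductSpace.Core ℝ V :=
    { inner := b
      conj_inner_symm := fun v w => hsymm w v
      re_inner_nonneg := fun v => by
        rcases eq_or_ne v 0 with rfl | hv
        · exact h0.ge
        · exact (hpos v hv).le
      add_left := hadd
      smul_left := fun v w c => hsmul c v w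
      definite := fun v hv => by
        by_contra hne
        exact (hpos v hne).ne' hv }
  let : NormedAddCommGroup V := core.toNormedAddCommGroup
  let : InnerProductSpace ℝ V := InnerProductSpace.ofCore core.toCore
  have hS : R.IsSymmetric := hR
  have htop : (⨆ c, R.eigenspace c) = ⊤ := by
    have := hS.orthogonalComplement_iSup_eigenspaces_eq_bot
    rwa [Submodule.orthogonal_eq_bot_iff] at this
  let L : Module.End ℝ V := R * R - ((lam + mu) • R - (lam * mu) • 1)
  have hle : (⨆ c, R.eigenspace c) ≤ LinearMap.ker L := by
    refine iSup_le fun c u hu => ?_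
    have hu' : R u = c • u := Module.End.mem_eigenspace_iff.1 hu
    rcases eq_or_ne u 0 with rfl | hne
    · exact zero_mem _
    have hLu : L u = ((c - lam) * (c - mu)) • u := by
      simp only [L, LinearMap.sub_apply, Module.End.mul_apply, LinearMap.smul_apply,
        Module.End.one_apply, hu', map_smul]
      module
    rw [LinearMap.mem_ker, hLu]
    rcases heig c (Module.End.hasEigenvalue_of_hasEigenvector ⟨hu, hne⟩) with rfl | rfl <;> simp
  have hv : v ∈ LinearMap.ker L := hle (htop ▸ Submodule.mem_top)
  have := LinearMap.mem_ker.1 hv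
  simp only [L, LinearMap.sub_apply, Module.End.mul_apply, LinearMap.smul_apply,
    Module.End.one_apply] at this
  exact sub_eq_zero.1 this

namespace CoordMetric

variable {V : Type*} [NormedAddCommGroup V] [NormedSpace ℝ V]
  {b b' : V → V →L[ℝ] V →L[ℝ] ℝ} {y : V}

theorem ClosedAt.add_const_smul (hb : DifferentiableAt ℝ b y) (hb' : DifferentiableAt ℝ b' y)
    (h : ClosedAt b y) (h' : ClosedAt b' y) (c c' : ℝ) :
    ClosedAt (fun z => c • b z + c' • b' z) y := by
  intro u v w
  rw [fderiv_fun_add (hb.fun_const_smul c) (hb'.fun_const_smul c'), fderiv_fun_const_smul hb,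
    fderiv_fun_const_smul hb']
  have h1 := h u v w
  have h2 := h' u v w
  simp only [add_apply, smul_apply, smul_eq_mul]
  linear_combination c * h1 + c' * h2

end CoordMetric

namespace ComplexManifold

open CoordMetric

variable {n : ℕ} {M : Type*} [TopologicalSpace M] [ChartedSpace (EuclideanSpace ℂ (Fin n)) M]

/-- The projection `projMinus A` as a field of continuous linear maps. -/
def projEnd (A : EndField n M) : EndField n M := fun x =>
  (1 / 2 : ℝ) • (ContinuousLinearMap.id ℝ (Tan n x) + (cplx x).comp (A x))

theorem modelEnd_projEnd (A : EndField n M) (x : M) (v : EuclideanSpace ℂ (Fin n)) :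
    modelEnd (projEnd A) x v = (1 / 2 : ℝ) • (v + mulI n (modelEnd A x v)) := rfl

/-- The almost complex structure equal to `J` on the kernel of the projection `P` and to `-J` on
its image. -/
def twist (P : EndField n M) : EndField n M := fun x =>
  (cplx x).comp (ContinuousLinearMap.id ℝ (Tan n x) - (2 : ℝ) • P x)

theorem modelEnd_twist (P : EndField n M) (x : M) (v : EuclideanSpace ℂ (Fin n)) :
    modelEnd (twist P) x v = mulI n (v - (2 : ℝ) • modelEnd P x v) := rfl

theorem endField_ext {A B : EndField n M} (h : ∀ x v, modelEnd A x v = modelEnd B x v) : A = B :=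
  funext fun x => ContinuousLinearMap.ext fun v => h x v

/-- As `J² = -1`, the relations `A = J (1 - 2P)` and `P = (1 + J A) / 2` are equivalent. -/
theorem projEnd_twist (P : EndField n M) : projEnd (twist P) = P := by
  refine endField_ext fun x v => ?_
  rw [modelEnd_projEnd, modelEnd_twist, mulI_mulI]
  module

theorem twist_projEnd (A : EndField n M) : twist (projEnd A) = A := by
  refine endField_ext fun x v => ?_
  rw [modelEnd_twist, modelEnd_projEnd]
  have : v - (2 : ℝ) • (1 / 2 : ℝ) • (v + mulI n (modelEnd A x v)) = -mulI n (modelEnd A x v) := by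
    module
  rw [this, map_neg, mulI_mulI, neg_neg]

variable [IsManifold 𝓘(ℂ, EuclideanSpace ℂ (Fin n)) ω M]

/-- `P` is a field of orthogonal projections commuting with the complex structure, such that the
restriction of the fundamental form to its image is closed. -/
def IsSplitting (g : Metric n M) (P : EndField n M) : Prop :=
  ∀ x₀ : M, IsClosedSplitting (mulI n) (coord g.inner x₀)
    (chartAt (EuclideanSpace ℂ (Fin n)) x₀).target (coordEnd P x₀)

variable {g : Metric n M} {P : EndField n M}

theorem IsSplitting.idem (S : IsSplitting g P) (x : M) (v : EuclideanSpace ℂ (Fin n)) :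
    modelEnd P x (modelEnd P x v) = modelEnd P x v := by
  have := (S x).idem _ (mem_chart_target _ x) v
  rwa [coordEnd_self] at this

theorem IsSplitting.comm (S : IsSplitting g P) (x : M) (v : EuclideanSpace ℂ (Fin n)) :
    modelEnd P x (mulI n v) = mulI n (modelEnd P x v) := by
  have := (S x).comm _ (mem_chart_target _ x) v
  rwa [coordEnd_self] at this

theorem IsSplitting.selfAdj (S : IsSplitting g P) (x : M) (v w : EuclideanSpace ℂ (Fin n)) :
    modelBilin g.inner x (modelEnd P x v) w = modelBilin g.inner x v (modelEnd P x w) := by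
  have := (S x).selfAdj _ (mem_chart_target _ x) v w
  rwa [coordEnd_self, coord_self] at this

theorem IsSplitting.contDiffAt_form (S : IsSplitting g P) (x₀ : M) {y : EuclideanSpace ℂ (Fin n)}
    (hy : y ∈ (chartAt (EuclideanSpace ℂ (Fin n)) x₀).target) :
    ContDiffAt ℝ ∞ (fun z => (coord g.inner x₀ z).comp ((mulI n).comp (coordEnd P x₀ z))) y :=
  (S x₀).contDiffAt_form (isMetricOn_coord g x₀) hy

theorem IsSplitting.smooth (S : IsSplitting g P) {x₀ : M} {y : EuclideanSpace ℂ (Fin n)}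
    (hy : y ∈ (chartAt (EuclideanSpace ℂ (Fin n)) x₀).target) :
    ContDiffAt ℝ ∞ (coordEnd P x₀) y :=
  (S x₀).contDiffAt (chartAt (EuclideanSpace ℂ (Fin n)) x₀).open_target hy

theorem contDiffAt_fundamentalForm (g : Metric n M) {x₀ : M} {y : EuclideanSpace ℂ (Fin n)}
    (hy : y ∈ (chartAt (EuclideanSpace ℂ (Fin n)) x₀).target) :
    ContDiffAt ℝ ∞ (fun z => (coord g.inner x₀ z).comp (mulI n)) y :=
  ((isMetricOn_coord g x₀).contDiffAt hy).clm_comp contDiffAt_const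

theorem modelBilin_symm (g : Metric n M) (x : M) (v w : EuclideanSpace ℂ (Fin n)) :
    modelBilin g.inner x v w = modelBilin g.inner x w v := g.symm x v w

theorem modelBilin_pos (g : Metric n M) (x : M) {v : EuclideanSpace ℂ (Fin n)} (hv : v ≠ 0) :
    0 < modelBilin g.inner x v v := g.pos x v hv

theorem isSplitting_of_pointwise (hs : IsSmoothEnd P)
    (hidem : ∀ x v, modelEnd P x (modelEnd P x v) = modelEnd P x v)
    (hcomm : ∀ x v, modelEnd P x (mulI n v) = mulI n (modelEnd P x v))
    (hadj : ∀ x v w, modelBilin g.inner x (modelEnd P x v) w =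
      modelBilin g.inner x v (modelEnd P x w))
    (hclosed : ∀ x₀ : M, ∀ y ∈ (chartAt (EuclideanSpace ℂ (Fin n)) x₀).target,
      ClosedAt (fun z => (coord g.inner x₀ z).comp ((mulI n).comp (coordEnd P x₀ z))) y) :
    IsSplitting g P := fun x₀ =>
  { smooth := contDiffOn_coordEnd (isSmoothEnd_iff.1 hs) x₀
    idem := fun y hy v => by
      rw [coordEnd_apply, coordEnd_apply, chartD_chartDinv hy, hidem]
    comm := fun y hy v => by
      rw [coordEnd_apply, coordEnd_apply, chartD_mulI hy, hcomm, chartDinv_mulI hy]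
    selfAdj := fun y hy v w => by
      rw [coordEnd_apply, coordEnd_apply, coord_apply, coord_apply, chartD_chartDinv hy,
        chartD_chartDinv hy, hadj]
    closed := hclosed x₀ }

/-- The projection onto the `mu`-eigenspace of the Ricci tensor along the `lam`-eigenspace. -/
def ricciProj (g : Metric n M) (lam mu : ℝ) : EndField n M := fun x =>
  (mu - lam)⁻¹ • (ricciEnd g x - lam • ContinuousLinearMap.id ℝ (Tan n x))

theorem modelEnd_ricciProj (g : Metric n M) (lam mu : ℝ) (x : M) (v : EuclideanSpace ℂ (Fin n)) :
    modelEnd (ricciProj g lam mu) x v = (mu - lam)⁻¹ • (modelEnd (ricciEnd g) x v - lam • v) := rfl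

theorem coordEnd_ricciProj (g : Metric n M) (lam mu : ℝ) {x₀ : M} {y : EuclideanSpace ℂ (Fin n)}
    (hy : y ∈ (chartAt (EuclideanSpace ℂ (Fin n)) x₀).target) :
    coordEnd (ricciProj g lam mu) x₀ y = (mu - lam)⁻¹ • (coordEnd (ricciEnd g) x₀ y -
      lam • ContinuousLinearMap.id ℝ (EuclideanSpace ℂ (Fin n))) := by
  refine ContinuousLinearMap.ext fun v => ?_
  rw [coordEnd_apply, modelEnd_ricciProj, map_smul, map_sub, map_smul, chartDinv_chartD hy]
  rfl

theorem modelEnd_ricciEnd_symm (g : Metric n M) (x : M) (v w : EuclideanSpace ℂ (Fin n)) :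
    modelBilin g.inner x (modelEnd (ricciEnd g) x v) w =
      modelBilin g.inner x v (modelEnd (ricciEnd g) x w) := by
  rw [modelBilin_symm g x v, apply_ricciEnd, apply_ricciEnd]
  exact (isMetricOn_coord g x).ricci_symm (mem_chart_target _ x) v w

theorem modelEnd_ricciEnd_mulI (hg : IsKahler g) (x : M) (v : EuclideanSpace ℂ (Fin n)) :
    modelEnd (ricciEnd g) x (mulI n v) = mulI n (modelEnd (ricciEnd g) x v) := by
  have H := isKahler_iff.1 hg x
  have hx := mem_chart_target (EuclideanSpace ℂ (Fin n)) x
  refine modelBilin_ext (g := g) (x := x) fun u => ?_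
  have h1 := H.apply_J_left hx (modelEnd (ricciEnd g) x v) u
  rw [coord_self] at h1
  refine Eq.trans ?_ h1.symm
  change _ = -modelBilin g.inner x (modelEnd (ricciEnd g) x v) (mulI n u)
  rw [apply_ricciEnd, apply_ricciEnd]
  have h2 := H.ricci_J_J hx v (mulI n u)
  rw [mulI_mulI, map_neg] at h2
  change CoordMetric.ricci _ _ _ _ = -CoordMetric.ricci _ _ _ _
  rw [← h2, neg_neg]

/-- Idempotency is `(Ric - lam) (Ric - mu) = 0`, and `J`-linearity is the `J`-invariance of the
Ricci tensor. The form of the projection is the Ricci form minus `lam` times the Kähler form,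
divided by `mu - lam`, hence closed. -/
theorem isSplitting_ricciProj (hg : IsKahler g) {lam mu : ℝ} (hne : lam ≠ mu)
    (hE : HasRicciEigenvalues g lam mu) : IsSplitting g (ricciProj g lam mu) := by
  have hne' : mu - lam ≠ 0 := sub_ne_zero.2 hne.symm
  refine isSplitting_of_pointwise (isSmoothEnd_iff.2 fun x => ?_) (fun x v => ?_) (fun x v => ?_)
    (fun x v w => ?_) fun x₀ y hy => ?_
  · have hx := mem_chart_target (EuclideanSpace ℂ (Fin n)) x
    have h1 : ContDiffAt ℝ ∞ (fun z => (mu - lam)⁻¹ • (coordEnd (ricciEnd g) x z -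
        lam • ContinuousLinearMap.id ℝ (EuclideanSpace ℂ (Fin n))))
        (chartAt (EuclideanSpace ℂ (Fin n)) x x) :=
      ((contDiffAt_coordEnd_ricciEnd g hx).sub contDiffAt_const).const_smul (mu - lam)⁻¹
    refine h1.congr_of_eventuallyEq ?_
    filter_upwards [(chartAt (EuclideanSpace ℂ (Fin n)) x).open_target.mem_nhds hx] with z hz
    exact coordEnd_ricciProj g lam mu hz
  · have h := apply_apply_eq_of_eigenvalues (b := fun v w => modelBilin g.inner x v w)
      (fun u v w => by simp) (fun c v w => by simp) (modelBilin_symm g x)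
      (fun v hv => modelBilin_pos g x hv) (R := (modelEnd (ricciEnd g) x).toLinearMap)
      (modelEnd_ricciEnd_symm g x) (fun c hc => (hE x c).1 hc) v
    simp only [ContinuousLinearMap.coe_coe] at h
    simp only [modelEnd_ricciProj, map_smul, map_sub, h]
    match_scalars <;> field_simp <;> ring
  · simp only [modelEnd_ricciProj, modelEnd_ricciEnd_mulI hg, map_smul, map_sub]
  · simp only [modelEnd_ricciProj, map_smul, map_sub, smul_apply, sub_apply,
      modelEnd_ricciEnd_symm]
  · have H := isKahler_iff.1 hg x₀
    have hR : ContDiffAt ℝ ∞ (fun z => (CoordMetric.ricci (coord g.inner x₀) z).comp (mulI n)) y :=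
      (contDiffAt_ricci H.toIsMetricOn hy).clm_comp contDiffAt_const
    refine ((H.closedAt_ricci hy).add_const_smul hR.differentiableAt_infty
      (contDiffAt_fundamentalForm g hy).differentiableAt_infty (H.closed y hy)
      (mu - lam)⁻¹ (-((mu - lam)⁻¹ * lam))).congr ?_
    filter_upwards [(chartAt (EuclideanSpace ℂ (Fin n)) x₀).open_target.mem_nhds hy] with z hz
    refine ContinuousLinearMap.ext fun v => ContinuousLinearMap.ext fun w => ?_
    have hc : mulI n (coordEnd (ricciEnd g) x₀ z v) = coordEnd (ricciEnd g) x₀ z (mulI n v) := by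
      rw [coordEnd_apply, coordEnd_apply, chartD_mulI hz, modelEnd_ricciEnd_mulI hg,
        chartDinv_mulI hz]
    simp only [coordEnd_ricciProj g lam mu hz, add_apply, smul_apply, sub_apply,
      ContinuousLinearMap.comp_apply, ContinuousLinearMap.id_apply, map_smul, map_sub, hc,
      coord_coordEnd_ricciEnd g hz, smul_eq_mul]
    ring

theorem coordEnd_projEnd (A : EndField n M) {x₀ : M} {y : EuclideanSpace ℂ (Fin n)}
    (hy : y ∈ (chartAt (EuclideanSpace ℂ (Fin n)) x₀).target) :
    coordEnd (projEnd A) x₀ y = (1 / 2 : ℝ) • (ContinuousLinearMap.id ℝ (EuclideanSpace ℂ (Fin n)) +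
      (mulI n).comp (coordEnd A x₀ y)) := by
  refine ContinuousLinearMap.ext fun v => ?_
  rw [coordEnd_apply, modelEnd_projEnd, map_smul, map_add, chartDinv_chartD hy, chartDinv_mulI hy]
  rfl

theorem coordEnd_twist (P : EndField n M) {x₀ : M} {y : EuclideanSpace ℂ (Fin n)}
    (hy : y ∈ (chartAt (EuclideanSpace ℂ (Fin n)) x₀).target) (v : EuclideanSpace ℂ (Fin n)) :
    coordEnd (twist P) x₀ y v = mulI n (v - (2 : ℝ) • coordEnd P x₀ y v) := by
  rw [coordEnd_apply, modelEnd_twist, chartDinv_mulI hy, map_sub, map_smul, chartDinv_chartD hy]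
  rfl

/-- Here `J P = (J - A) / 2`, so the form of the projection is half the difference of two closed
fundamental forms. Since `A` and `J` commute, `J A` is a self-adjoint involution. -/
theorem isSplitting_projEnd (hg : IsKahler g) {A : EndField n M} (hA : IsAlmostKahler g A)
    (hJ : ∀ x v, A x (cplx x v) = cplx x (A x v)) : IsSplitting g (projEnd A) := by
  have hJ' : ∀ x v, modelEnd A x (mulI n v) = mulI n (modelEnd A x v) := hJ
  have hsq : ∀ x v, modelEnd A x (modelEnd A x v) = -v := hA.almostComplex.sq
  have hort : ∀ x v w, modelBilin g.inner x (modelEnd A x v) (modelEnd A x w) =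
    modelBilin g.inner x v w := hA.orthogonal
  have hJort : ∀ x v w, modelBilin g.inner x (mulI n v) (mulI n w) =
    modelBilin g.inner x v w := hg.orthogonal
  have hsm := isSmoothEnd_iff.1 hA.almostComplex.smooth
  refine isSplitting_of_pointwise (isSmoothEnd_iff.2 fun x => ?_) (fun x v => ?_) (fun x v => ?_)
    (fun x v w => ?_) fun x₀ y hy => ?_
  · have hx := mem_chart_target (EuclideanSpace ℂ (Fin n)) x
    have h1 : ContDiffAt ℝ ∞ (fun z => (1 / 2 : ℝ) •
        (ContinuousLinearMap.id ℝ (EuclideanSpace ℂ (Fin n)) + (mulI n).comp (coordEnd A x z)))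
        (chartAt (EuclideanSpace ℂ (Fin n)) x x) :=
      (contDiffAt_const.add (contDiffAt_const.clm_comp (hsm x))).const_smul (1 / 2 : ℝ)
    refine h1.congr_of_eventuallyEq ?_
    filter_upwards [(chartAt (EuclideanSpace ℂ (Fin n)) x).open_target.mem_nhds hx] with z hz
    exact coordEnd_projEnd A hz
  · simp only [modelEnd_projEnd, map_smul, map_add, hJ', hsq, mulI_mulI, map_neg]
    module
  · simp only [modelEnd_projEnd, map_smul, map_add, hJ']
  · have h1 : modelBilin g.inner x (mulI n (modelEnd A x v)) w =
        modelBilin g.inner x v (mulI n (modelEnd A x w)) := by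
      rw [← hort x v, ← hJort x _ w, mulI_mulI, ← hJ', hsq]
      simp
    simp only [modelEnd_projEnd, map_smul, map_add, smul_apply, add_apply, h1]
  · have H := isKahler_iff.1 hg x₀
    have ha : ContDiffAt ℝ ∞ (fun z => (coord g.inner x₀ z).comp (coordEnd A x₀ z)) y :=
      (H.contDiffAt hy).clm_comp ((contDiffOn_coordEnd hsm x₀ y hy).contDiffAt
        ((chartAt (EuclideanSpace ℂ (Fin n)) x₀).open_target.mem_nhds hy))
    refine ((H.closed y hy).add_const_smul
      (contDiffAt_fundamentalForm g hy).differentiableAt_infty ha.differentiableAt_infty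
      ((closedAt_fundamentalForm_iff _ _ hy).1 (hA.closed x₀ y hy)) (1 / 2) (-(1 / 2))).congr ?_
    filter_upwards [(chartAt (EuclideanSpace ℂ (Fin n)) x₀).open_target.mem_nhds hy] with z hz
    refine ContinuousLinearMap.ext fun v => ContinuousLinearMap.ext fun w => ?_
    simp only [coordEnd_projEnd A hz, add_apply, smul_apply,
      ContinuousLinearMap.comp_apply, ContinuousLinearMap.id_apply, map_smul, map_add, mulI_mulI,
      smul_eq_mul, map_neg, neg_apply]
    ring

/-- The fundamental form of `J (1 - 2P)` is the Kähler form minus twice the closed form of `P`, and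
`1 - 2P` is an orthogonal reflection commuting with `J`. -/
theorem IsSplitting.isAlmostKahler_twist (S : IsSplitting g P) (hg : IsKahler g) :
    IsAlmostKahler g (twist P) := by
  have hJort : ∀ x v w, modelBilin g.inner x (mulI n v) (mulI n w) =
    modelBilin g.inner x v w := hg.orthogonal
  refine ⟨⟨isSmoothEnd_iff.2 fun x => ?_, fun x (v : EuclideanSpace ℂ (Fin n)) => ?_⟩,
    fun x (v w : EuclideanSpace ℂ (Fin n)) => ?_, fun x₀ y hy => ?_⟩
  · have hx := mem_chart_target (EuclideanSpace ℂ (Fin n)) x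
    have h1 : ContDiffAt ℝ ∞ (fun z => (mulI n).comp
        (ContinuousLinearMap.id ℝ (EuclideanSpace ℂ (Fin n)) - (2 : ℝ) • coordEnd P x z))
        (chartAt (EuclideanSpace ℂ (Fin n)) x x) :=
      contDiffAt_const.clm_comp (contDiffAt_const.sub ((S.smooth hx).const_smul (2 : ℝ)))
    refine h1.congr_of_eventuallyEq ?_
    filter_upwards [(chartAt (EuclideanSpace ℂ (Fin n)) x).open_target.mem_nhds hx] with z hz
    exact ContinuousLinearMap.ext fun v => coordEnd_twist P hz v
  · change modelEnd (twist P) x (modelEnd (twist P) x v) = -v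
    simp only [modelEnd_twist, S.comm, map_sub, map_smul, mulI_mulI, S.idem]
    module
  · change modelBilin g.inner x (modelEnd (twist P) x v) (modelEnd (twist P) x w) =
      modelBilin g.inner x v w
    rw [modelEnd_twist, modelEnd_twist, hJort]
    simp only [map_sub, map_smul, sub_apply, smul_apply, smul_eq_mul, S.selfAdj, S.idem]
    ring
  · rw [closedAt_fundamentalForm_iff _ _ hy]
    have H := isKahler_iff.1 hg x₀
    refine ((H.closed y hy).add_const_smul
      (contDiffAt_fundamentalForm g hy).differentiableAt_infty
      (S.contDiffAt_form x₀ hy).differentiableAt_infty ((S x₀).closed y hy) 1 (-2)).congr ?_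
    filter_upwards [(chartAt (EuclideanSpace ℂ (Fin n)) x₀).open_target.mem_nhds hy] with z hz
    refine ContinuousLinearMap.ext fun v => ContinuousLinearMap.ext fun w => ?_
    simp only [coordEnd_twist P hz, add_apply, smul_apply, sub_apply,
      ContinuousLinearMap.comp_apply, map_smul, map_sub, smul_eq_mul]
    ring

theorem IsSplitting.twist_comm (S : IsSplitting g P) (x : M) (v : EuclideanSpace ℂ (Fin n)) :
    modelEnd (twist P) x (mulI n v) = mulI n (modelEnd (twist P) x v) := by
  rw [modelEnd_twist, modelEnd_twist, S.comm, ← map_smul, ← map_sub]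

end ComplexManifold

/-! ### Rescaling along a splitting -/

namespace ComplexManifold

open CoordMetric

variable {n : ℕ} {M : Type*} [TopologicalSpace M] [ChartedSpace (EuclideanSpace ℂ (Fin n)) M]

/-- The bilinear forms `g|_{ker P} + t g|_{im P}`. -/
def rescaleBilin (B : BilinField n M) (P : EndField n M) (t : ℝ) : BilinField n M := fun x =>
  (modelBilin B x).comp
    (ContinuousLinearMap.id ℝ (EuclideanSpace ℂ (Fin n)) + (t - 1) • modelEnd P x)

theorem modelBilin_rescaleBilin (B : BilinField n M) (P : EndField n M) (t : ℝ) (x : M)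
    (v w : EuclideanSpace ℂ (Fin n)) : modelBilin (rescaleBilin B P t) x v w =
      modelBilin B x (v + (t - 1) • modelEnd P x v) w := rfl

variable [IsManifold 𝓘(ℂ, EuclideanSpace ℂ (Fin n)) ω M]

theorem coord_rescaleBilin (B : BilinField n M) (P : EndField n M) (t : ℝ) {x₀ : M}
    {y : EuclideanSpace ℂ (Fin n)} (hy : y ∈ (chartAt (EuclideanSpace ℂ (Fin n)) x₀).target) :
    coord (rescaleBilin B P t) x₀ y = (coord B x₀ y).comp
      (ContinuousLinearMap.id ℝ (EuclideanSpace ℂ (Fin n)) + (t - 1) • coordEnd P x₀ y) := by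
  refine ContinuousLinearMap.ext fun v => ContinuousLinearMap.ext fun w => ?_
  rw [coord_apply, modelBilin_rescaleBilin, ContinuousLinearMap.comp_apply, coord_apply]
  simp only [add_apply, smul_apply, ContinuousLinearMap.id_apply, map_add, map_smul,
    coordEnd_apply, chartD_chartDinv hy]

variable {g : Metric n M} {P : EndField n M}

/-- The metric `g|_{ker P} + t g|_{im P}`. -/
def rescale (S : IsSplitting g P) {t : ℝ} (ht : 0 < t) : Metric n M :=
  metricOfBilin (rescaleBilin g.inner P t)
    (fun x (v w : EuclideanSpace ℂ (Fin n)) => by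
      change modelBilin g.inner x (v + (t - 1) • modelEnd P x v) w =
        modelBilin g.inner x (w + (t - 1) • modelEnd P x w) v
      simp only [map_add, map_smul, add_apply, smul_apply]
      rw [modelBilin_symm g x v, S.selfAdj, modelBilin_symm g x v])
    (fun x (v : EuclideanSpace ℂ (Fin n)) hv => by
      change 0 < modelBilin g.inner x (v + (t - 1) • modelEnd P x v) v
      -- Kernel and image of `P` are orthogonal, so there are no cross terms.
      have key : modelBilin g.inner x (v + (t - 1) • modelEnd P x v) v =
          modelBilin g.inner x (v - modelEnd P x v) (v - modelEnd P x v) +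
            t * modelBilin g.inner x (modelEnd P x v) (modelEnd P x v) := by
        simp only [map_add, map_smul, map_sub, add_apply, smul_apply, sub_apply, smul_eq_mul,
          S.selfAdj, S.idem]
        ring
      rw [key]
      by_cases h0 : modelEnd P x v = 0
      · rw [h0, sub_zero]
        simpa using modelBilin_pos g x hv
      · have h1 := mul_pos ht (modelBilin_pos g x h0)
        by_cases h2 : v - modelEnd P x v = 0
        · rw [h2]
          simpa using h1
        · exact add_pos (modelBilin_pos g x h2) h1)
    (fun x => by
      have hx := mem_chart_target (EuclideanSpace ℂ (Fin n)) x
      have h1 : ContDiffAt ℝ ∞ (fun z => (coord g.inner x z).comp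
          (ContinuousLinearMap.id ℝ (EuclideanSpace ℂ (Fin n)) + (t - 1) • coordEnd P x z))
          (chartAt (EuclideanSpace ℂ (Fin n)) x x) :=
        ((isMetricOn_coord g x).contDiffAt hx).clm_comp
          (contDiffAt_const.add ((S.smooth hx).const_smul (t - 1)))
      refine h1.congr_of_eventuallyEq ?_
      filter_upwards [(chartAt (EuclideanSpace ℂ (Fin n)) x).open_target.mem_nhds hx] with z hz
      exact coord_rescaleBilin g.inner P t hz)

theorem rescale_apply (S : IsSplitting g P) {t : ℝ} (ht : 0 < t) (x : M)
    (v w : EuclideanSpace ℂ (Fin n)) : modelBilin (rescale S ht).inner x v w =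
      modelBilin g.inner x (v + (t - 1) • modelEnd P x v) w := rfl

theorem coord_rescale (S : IsSplitting g P) {t : ℝ} (ht : 0 < t) {x₀ : M}
    {y : EuclideanSpace ℂ (Fin n)} (hy : y ∈ (chartAt (EuclideanSpace ℂ (Fin n)) x₀).target)
    (v w : EuclideanSpace ℂ (Fin n)) : coord (rescale S ht).inner x₀ y v w =
      coord g.inner x₀ y (v + (t - 1) • coordEnd P x₀ y v) w := by
  have h := coord_rescaleBilin g.inner P t hy
  exact congrArg (fun b : EuclideanSpace ℂ (Fin n) →L[ℝ] EuclideanSpace ℂ (Fin n) →L[ℝ] ℝ =>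
    b v w) h

/-- The fundamental form changes by `t - 1` times the closed form of `P`. -/
theorem isKahler_rescale (S : IsSplitting g P) {t : ℝ} (ht : 0 < t) (hg : IsKahler g) :
    IsKahler (rescale S ht) := by
  refine isKahler_iff.2 fun x₀ =>
    { isMetricOn_coord (rescale S ht) x₀ with
      sq := mulI_mulI n, hermitian := fun y hy v w => ?_, closed := fun y hy => ?_ }
  · have H := isKahler_iff.1 hg x₀
    rw [coord_rescale S ht hy, coord_rescale S ht hy, (S x₀).comm y hy, ← map_smul, ← map_add,
      H.hermitian y hy]
  · have H := isKahler_iff.1 hg x₀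
    refine ((H.closed y hy).add_const_smul
      (contDiffAt_fundamentalForm g hy).differentiableAt_infty
      (S.contDiffAt_form x₀ hy).differentiableAt_infty ((S x₀).closed y hy) 1 (t - 1)).congr ?_
    filter_upwards [(chartAt (EuclideanSpace ℂ (Fin n)) x₀).open_target.mem_nhds hy] with z hz
    refine ContinuousLinearMap.ext fun v => ContinuousLinearMap.ext fun w => ?_
    simp only [ContinuousLinearMap.comp_apply, coord_rescale S ht hz, (S x₀).comm z hz, map_add,
      map_smul, add_apply, smul_apply, one_smul]

/-- The form of `P` is multiplied by `t = 1 + (t - 1)`, and the image and the kernel of `P` remain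
orthogonal. -/
theorem isSplitting_rescale (S : IsSplitting g P) {t : ℝ} (ht : 0 < t) :
    IsSplitting (rescale S ht) P := fun x₀ =>
  { smooth := (S x₀).smooth
    idem := (S x₀).idem
    comm := (S x₀).comm
    selfAdj := fun y hy v w => by
      rw [coord_rescale S ht hy, coord_rescale S ht hy]
      simp only [map_add, map_smul, add_apply, smul_apply, (S x₀).selfAdj y hy, (S x₀).idem y hy]
    closed := fun y hy => by
      refine (((S x₀).closed y hy).add_const_smul
        (S.contDiffAt_form x₀ hy).differentiableAt_infty
        (S.contDiffAt_form x₀ hy).differentiableAt_infty ((S x₀).closed y hy) 1 (t - 1)).congr ?_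
      filter_upwards [(chartAt (EuclideanSpace ℂ (Fin n)) x₀).open_target.mem_nhds hy] with z hz
      refine ContinuousLinearMap.ext fun v => ContinuousLinearMap.ext fun w => ?_
      simp only [ContinuousLinearMap.comp_apply, coord_rescale S ht hz, (S x₀).comm z hz,
        (S x₀).idem z hz, map_add, map_smul, add_apply, smul_apply, one_smul] }

theorem ricci_rescale (S : IsSplitting g P) {t : ℝ} (ht : 0 < t) (hg : IsKahler g) (x : M) :
    modelBilin (ricci (rescale S ht)) x = modelBilin (ricci g) x := by
  have hT := (chartAt (EuclideanSpace ℂ (Fin n)) x).open_target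
  refine (IsKahlerOn.ricci_rescale (isKahler_iff.1 hg x)
    (isKahler_iff.1 (isKahler_rescale S ht hg) x)
    (fun z hz => (S.smooth hz).differentiableAt_infty) (S x).idem ht.ne'
    (fun z hz v w => ?_) (mem_chart_target _ x)).symm
  rw [coord_rescale S ht hz]
  simp only [map_add, map_smul, add_apply, smul_apply, (S x).selfAdj z hz]

theorem rescale_rescale (S : IsSplitting g P) {t s : ℝ} (ht : 0 < t) (hs : 0 < s) (hts : t * s = 1)
    (S' : IsSplitting (rescale S ht) P) : rescale S' hs = g := by
  refine metric_ext fun x v w => ?_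
  rw [rescale_apply, rescale_apply]
  congr 1
  have : v + (s - 1) • modelEnd P x v + (t - 1) • modelEnd P x (v + (s - 1) • modelEnd P x v) =
      v + (t * s - 1) • modelEnd P x v := by
    simp only [map_add, map_smul, S.idem]
    module
  rw [this, hts]
  simp

/-- `P` splits the Kähler metric `g`, and the Ricci tensor of `g` equals `lam` on the kernel and
`mu` on the image of `P`, which are both nonzero. -/
structure IsRicciSplitting (g : Metric n M) (P : EndField n M) (lam mu : ℝ) : Prop where
  kahler : IsKahler g
  splitting : IsSplitting g P
  ricci_eq : ∀ x v, modelEnd (ricciEnd g) x v = lam • (v - modelEnd P x v) + mu • modelEnd P x v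
  exists_image : ∀ x, ∃ v : EuclideanSpace ℂ (Fin n), v ≠ 0 ∧ modelEnd P x v = v
  exists_kernel : ∀ x, ∃ v : EuclideanSpace ℂ (Fin n), v ≠ 0 ∧ modelEnd P x v = 0

theorem mem_ricciEigenspace {g : Metric n M} {c : ℝ} {x : M} {v : EuclideanSpace ℂ (Fin n)} :
    v ∈ ricciEigenspace g c x ↔ modelEnd (ricciEnd g) x v = c • v :=
  Module.End.mem_eigenspace_iff (M := Tan n x) (x := v)

theorem hasEigenvalue_ricciEnd_iff {g : Metric n M} {c : ℝ} {x : M} :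
    Module.End.HasEigenvalue (ricciEnd g x).toLinearMap c ↔
      ∃ v : EuclideanSpace ℂ (Fin n), v ≠ 0 ∧ modelEnd (ricciEnd g) x v = c • v := by
  constructor
  · intro hc
    obtain ⟨v, hv, hv0⟩ := hc.exists_hasEigenvector
    exact ⟨v, hv0, mem_ricciEigenspace.1 hv⟩
  · rintro ⟨v, hv0, hv⟩
    exact Module.End.hasEigenvalue_of_hasEigenvector ⟨mem_ricciEigenspace.2 hv, hv0⟩

theorem isRicciSplitting_ricciProj {lam mu : ℝ} (hne : lam ≠ mu) (hg : IsKahler g)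
    (hE : HasRicciEigenvalues g lam mu) : IsRicciSplitting g (ricciProj g lam mu) lam mu where
  kahler := hg
  splitting := isSplitting_ricciProj hg hne hE
  ricci_eq x v := by
    have hne' : mu - lam ≠ 0 := sub_ne_zero.2 hne.symm
    rw [modelEnd_ricciProj]
    match_scalars <;> field_simp <;> ring
  exists_image x := by
    have hne' : mu - lam ≠ 0 := sub_ne_zero.2 hne.symm
    obtain ⟨v, hv0, hv'⟩ := hasEigenvalue_ricciEnd_iff.1 ((hE x mu).2 (Or.inr rfl))
    refine ⟨v, hv0, ?_⟩
    rw [modelEnd_ricciProj, hv', ← sub_smul, smul_smul, inv_mul_cancel₀ hne', one_smul]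
  exists_kernel x := by
    obtain ⟨v, hv0, hv'⟩ := hasEigenvalue_ricciEnd_iff.1 ((hE x lam).2 (Or.inl rfl))
    refine ⟨v, hv0, ?_⟩
    rw [modelEnd_ricciProj, hv', sub_self, smul_zero]

variable {lam mu : ℝ}

theorem IsRicciSplitting.mem_ricciEigenspace_lam (H : IsRicciSplitting g P lam mu) (hne : lam ≠ mu)
    {x : M} {v : EuclideanSpace ℂ (Fin n)} : v ∈ ricciEigenspace g lam x ↔ modelEnd P x v = 0 := by
  rw [mem_ricciEigenspace, H.ricci_eq]
  refine ⟨fun h => ?_, fun h => by simp [h]⟩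
  have : (mu - lam) • modelEnd P x v = 0 := by
    rw [← sub_eq_zero] at h
    rw [← h]
    module
  exact (smul_eq_zero.1 this).resolve_left (sub_ne_zero.2 hne.symm)

theorem IsRicciSplitting.mem_ricciEigenspace_mu (H : IsRicciSplitting g P lam mu) (hne : lam ≠ mu)
    {x : M} {v : EuclideanSpace ℂ (Fin n)} : v ∈ ricciEigenspace g mu x ↔ modelEnd P x v = v := by
  rw [mem_ricciEigenspace, H.ricci_eq]
  refine ⟨fun h => ?_, fun h => by simp [h]⟩
  have : (lam - mu) • (modelEnd P x v - v) = 0 := by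
    rw [← sub_eq_zero] at h
    rw [← neg_eq_zero, ← h]
    module
  exact sub_eq_zero.1 ((smul_eq_zero.1 this).resolve_left (sub_ne_zero.2 hne))

theorem IsRicciSplitting.ricciProj_eq (H : IsRicciSplitting g P lam mu) (hne : lam ≠ mu) :
    ricciProj g lam mu = P := by
  have hne' : mu - lam ≠ 0 := sub_ne_zero.2 hne.symm
  refine endField_ext fun x v => ?_
  rw [modelEnd_ricciProj, H.ricci_eq]
  match_scalars <;> field_simp <;> ring

theorem IsRicciSplitting.hasRicciEigenvalues (H : IsRicciSplitting g P lam mu) (hne : lam ≠ mu) :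
    HasRicciEigenvalues g lam mu := by
  intro x c
  constructor
  · intro hc
    obtain ⟨v, hv0, hv'⟩ := hasEigenvalue_ricciEnd_iff.1 hc
    rw [H.ricci_eq] at hv'
    by_cases h0 : modelEnd P x v = 0
    · left
      rw [h0, sub_zero, smul_zero, add_zero] at hv'
      exact (smul_left_injective ℝ hv0 hv').symm
    · right
      have h1 := congrArg (modelEnd P x) hv'
      simp only [map_add, map_smul, map_sub, H.splitting.idem, sub_self, smul_zero, zero_add] at h1
      exact (smul_left_injective ℝ h0 h1).symm
  · rintro (rfl | rfl)
    · obtain ⟨v, hv0, hv⟩ := H.exists_kernel x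
      exact hasEigenvalue_ricciEnd_iff.2 ⟨v, hv0, by simp [H.ricci_eq, hv]⟩
    · obtain ⟨v, hv0, hv⟩ := H.exists_image x
      exact hasEigenvalue_ricciEnd_iff.2 ⟨v, hv0, by simp [H.ricci_eq, hv]⟩

end ComplexManifold

/-! ### The correspondence -/

namespace ComplexManifold

open CoordMetric

variable {n : ℕ} {M : Type*} [TopologicalSpace M] [ChartedSpace (EuclideanSpace ℂ (Fin n)) M]
  {P : EndField n M}

theorem twist_ne_cplx (hP : ∃ x v, modelEnd P x v ≠ 0) : twist P ≠ cplx := by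
  rintro h
  obtain ⟨x, v, hv⟩ := hP
  have h1 := congrArg projEnd h
  rw [projEnd_twist] at h1
  rw [h1, modelEnd_projEnd] at hv
  change (1 / 2 : ℝ) • (v + mulI n (mulI n v)) ≠ 0 at hv
  rw [mulI_mulI, add_neg_cancel, smul_zero] at hv
  exact hv rfl

theorem twist_ne_neg_cplx (hP : ∃ x v, modelEnd P x v ≠ v) : twist P ≠ -cplx := by
  rintro h
  obtain ⟨x, v, hv⟩ := hP
  have h1 := congrArg projEnd h
  rw [projEnd_twist] at h1
  rw [h1, modelEnd_projEnd] at hv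
  change (1 / 2 : ℝ) • (v + mulI n (-mulI n v)) ≠ v at hv
  rw [map_neg, mulI_mulI, neg_neg] at hv
  exact hv (by module)

variable [IsManifold 𝓘(ℂ, EuclideanSpace ℂ (Fin n)) ω M] {g : Metric n M} {lam mu : ℝ}

theorem trace_coordEnd (A : EndField n M) {x₀ : M} {y : EuclideanSpace ℂ (Fin n)}
    (hy : y ∈ (chartAt (EuclideanSpace ℂ (Fin n)) x₀).target) :
    LinearMap.trace ℝ _ (coordEnd A x₀ y).toLinearMap = LinearMap.trace ℝ _
      (modelEnd A ((chartAt (EuclideanSpace ℂ (Fin n)) x₀).symm y)).toLinearMap := by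
  have h1 : (coordEnd A x₀ y).toLinearMap = (chartDinv x₀ y).toLinearMap ∘ₗ
      ((modelEnd A ((chartAt (EuclideanSpace ℂ (Fin n)) x₀).symm y)).toLinearMap ∘ₗ
        (chartD x₀ y).toLinearMap) := rfl
  rw [h1, LinearMap.trace_comp_comm']
  congr 1
  ext1 v
  simp [chartD_chartDinv hy]

/-- On a connected manifold, a continuous field of projections vanishing at one point vanishes
everywhere. -/
theorem modelEnd_eq_zero_of_idem [PreconnectedSpace M] {Q : EndField n M}
    (hidem : ∀ x v, modelEnd Q x (modelEnd Q x v) = modelEnd Q x v)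
    (hcont : ∀ x, ContinuousAt (coordEnd Q x) (chartAt (EuclideanSpace ℂ (Fin n)) x x))
    {x₁ : M} (h₁ : modelEnd Q x₁ = 0) (x : M) : modelEnd Q x = 0 := by
  let T : (EuclideanSpace ℂ (Fin n) →L[ℝ] EuclideanSpace ℂ (Fin n)) →ₗ[ℝ] ℝ :=
    (LinearMap.trace ℝ (EuclideanSpace ℂ (Fin n))).comp (ContinuousLinearMap.coeLM ℝ)
  have hT : Continuous T := T.continuous_of_finiteDimensional
  have hc : Continuous fun x => T (modelEnd Q x) := by
    refine continuous_iff_continuousAt.2 fun x => ?_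
    have hx := mem_chart_source (EuclideanSpace ℂ (Fin n)) x
    have h2 : ContinuousAt (fun z => T (coordEnd Q x (chartAt (EuclideanSpace ℂ (Fin n)) x z))) x :=
      hT.continuousAt.comp (ContinuousAt.comp (f := chartAt (EuclideanSpace ℂ (Fin n)) x)
        (hcont x) ((chartAt (EuclideanSpace ℂ (Fin n)) x).continuousAt hx))
    refine h2.congr ?_
    filter_upwards [(chartAt (EuclideanSpace ℂ (Fin n)) x).open_source.mem_nhds hx] with z hz
    have h3 := trace_coordEnd Q ((chartAt (EuclideanSpace ℂ (Fin n)) x).map_source hz)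
    rw [(chartAt (EuclideanSpace ℂ (Fin n)) x).left_inv hz] at h3
    exact h3
  have hiff : ∀ x, modelEnd Q x = 0 ↔ T (modelEnd Q x) = 0 := by
    intro x
    have hid : IsIdempotentElem (modelEnd Q x).toLinearMap := LinearMap.ext (hidem x)
    refine Iff.trans ?_ (LinearMap.IsIdempotentElem.trace_eq_zero_iff hid).symm
    exact ⟨fun h => by rw [h]; rfl, fun h => ContinuousLinearMap.coe_injective h⟩
  -- The trace of a projection is its rank, a natural number, which vanishes if and only if it is
  -- less than `1`. The zero set is therefore open as well as closed.
  have hlt : ∀ x, modelEnd Q x = 0 ↔ T (modelEnd Q x) < 1 := by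
    intro x
    rw [hiff]
    have hid : IsIdempotentElem (modelEnd Q x).toLinearMap := LinearMap.ext (hidem x)
    have h4 : T (modelEnd Q x) =
        (Module.finrank ℝ (LinearMap.range (modelEnd Q x).toLinearMap) : ℝ) :=
      (LinearMap.IsIdempotentElem.isProj_range _ hid).trace
    rw [h4]
    norm_cast
    omega
  have hclopen : IsClopen {x | modelEnd Q x = 0} := by
    constructor
    · simp only [hiff]
      exact isClosed_eq hc continuous_const
    · simp only [hlt]
      exact isOpen_lt hc continuous_const
  rcases isClopen_iff.1 hclopen with h | h
  · exact absurd h₁ (h ▸ notMem_empty x₁ : x₁ ∉ {x | modelEnd Q x = 0})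
  · exact (h ▸ mem_univ x : x ∈ {x | modelEnd Q x = 0})

/-- If no vector were fixed at `x`, then `P` would vanish there, since `P v` is always fixed, and by
connectedness everywhere. The next lemma is the same argument for `1 - P`. -/
theorem IsSplitting.exists_image [PreconnectedSpace M] (S : IsSplitting g P)
    (hP : ∃ x, modelEnd P x ≠ 0) (x : M) :
    ∃ v : EuclideanSpace ℂ (Fin n), v ≠ 0 ∧ modelEnd P x v = v := by
  by_contra! hx
  obtain ⟨x₁, hx₁⟩ := hP
  refine hx₁ (modelEnd_eq_zero_of_idem S.idem
    (fun z => (S.smooth (mem_chart_target _ z)).continuousAt) (x₁ := x) ?_ x₁)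
  ext1 v
  by_contra hv
  exact hx _ hv (S.idem x v)

theorem IsSplitting.exists_kernel [PreconnectedSpace M] (S : IsSplitting g P)
    (hP : ∃ x v, modelEnd P x v ≠ v) (x : M) :
    ∃ v : EuclideanSpace ℂ (Fin n), v ≠ 0 ∧ modelEnd P x v = 0 := by
  by_contra! hx
  obtain ⟨x₁, v₁, hv₁⟩ := hP
  let Q : EndField n M := fun z =>
    ContinuousLinearMap.id ℝ (EuclideanSpace ℂ (Fin n)) - modelEnd P z
  have hQ : ∀ z v, modelEnd Q z v = v - modelEnd P z v := fun _ _ => rfl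
  have h0 : modelEnd Q x₁ = 0 := by
    refine modelEnd_eq_zero_of_idem (fun z v => ?_) (fun z => ?_) (x₁ := x) ?_ x₁
    · simp only [hQ, map_sub, S.idem, sub_self, sub_zero]
    · have hz := mem_chart_target (EuclideanSpace ℂ (Fin n)) z
      have h1 : ContinuousAt (fun y => ContinuousLinearMap.id ℝ (EuclideanSpace ℂ (Fin n)) -
          coordEnd P z y) (chartAt (EuclideanSpace ℂ (Fin n)) z z) :=
        continuousAt_const.sub (S.smooth hz).continuousAt
      refine h1.congr ?_
      filter_upwards [(chartAt (EuclideanSpace ℂ (Fin n)) z).open_target.mem_nhds hz] with y hy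
      ext1 v
      rw [coordEnd_apply, hQ, map_sub, chartDinv_chartD hy]
      rfl
    · ext1 v
      by_contra hv
      exact hx _ hv (by rw [hQ, map_sub, S.idem, sub_self])
  exact hv₁ (sub_eq_zero.1 (congrArg
    (fun L : EuclideanSpace ℂ (Fin n) →L[ℝ] EuclideanSpace ℂ (Fin n) => L v₁) h0)).symm

theorem finrank_real_euclideanSpace (n : ℕ) :
    Module.finrank ℝ (EuclideanSpace ℂ (Fin n)) = 2 * n := by
  rw [finrank_real_of_complex, finrank_euclideanSpace_fin]

theorem modelEnd_ricciEnd_of_einstein {c : ℝ} {x : M}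
    (h : ∀ v w, modelBilin (ricci g) x v w = c * modelBilin g.inner x v w)
    (v : EuclideanSpace ℂ (Fin n)) : modelEnd (ricciEnd g) x v = c • v := by
  refine modelBilin_ext (g := g) (x := x) fun u => ?_
  rw [apply_ricciEnd, h, map_smul, smul_apply, smul_eq_mul]

theorem scalarCurvature_of_einstein {c : ℝ} {x : M}
    (h : ∀ v w, modelBilin (ricci g) x v w = c * modelBilin g.inner x v w) :
    scalarCurvature g x = 2 * n * c := by
  have h1 : (modelEnd (ricciEnd g) x).toLinearMap = c • LinearMap.id := by
    ext1 v
    exact modelEnd_ricciEnd_of_einstein h v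
  have h2 : scalarCurvature g x = LinearMap.trace ℝ _ (modelEnd (ricciEnd g) x).toLinearMap := rfl
  rw [h2, h1, map_smul, LinearMap.trace_id, finrank_real_euclideanSpace, smul_eq_mul]
  push_cast
  ring

/-- The trace over the real dimension `2 * n` determines the Einstein constant once `n ≠ 0`. -/
theorem IsKahlerEinstein.ricci_eq (hg : IsKahlerEinstein g) (hn : n ≠ 0)
    (hs : ∀ x, scalarCurvature g x = 2 * n * lam) (x : M) (v w : EuclideanSpace ℂ (Fin n)) :
    modelBilin (ricci g) x v w = lam * modelBilin g.inner x v w := by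
  obtain ⟨c, hc⟩ := hg.einstein
  have h1 : ∀ x (v w : EuclideanSpace ℂ (Fin n)),
      modelBilin (ricci g) x v w = c * modelBilin g.inner x v w := fun x v w =>
    congrArg (fun b : EuclideanSpace ℂ (Fin n) →L[ℝ] EuclideanSpace ℂ (Fin n) →L[ℝ] ℝ => b v w)
      (hc x)
  have h2 := hs x
  rw [scalarCurvature_of_einstein (h1 x)] at h2
  have hn' : (2 * n : ℝ) ≠ 0 := by positivity
  rw [h1, mul_left_cancel₀ hn' h2]

/-- The Ricci tensor is unchanged and equals `mu g` on the image of `P`, which is `lam` times the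
rescaled metric there because the factor is `mu / lam`. -/
theorem IsRicciSplitting.einstein_rescale (H : IsRicciSplitting g P lam mu) (ht : 0 < mu / lam)
    (hlam : lam ≠ 0) (x : M) (v w : EuclideanSpace ℂ (Fin n)) :
    modelBilin (ricci (rescale H.splitting ht)) x v w =
      lam * modelBilin (rescale H.splitting ht).inner x v w := by
  rw [ricci_rescale H.splitting ht H.kahler, ← apply_ricciEnd, H.ricci_eq, rescale_apply]
  simp only [map_add, map_sub, map_smul, add_apply, sub_apply, smul_apply, smul_eq_mul]
  field_simp
  ring

/-- The converse computation: on the image of `P` the unchanged tensor `lam g` is `mu` times the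
metric rescaled by `lam / mu`. -/
theorem IsSplitting.isRicciSplitting_rescale (S : IsSplitting g P) (hg : IsKahler g)
    (hric : ∀ x v w, modelBilin (ricci g) x v w = lam * modelBilin g.inner x v w)
    (ht : 0 < lam / mu) (hmu : mu ≠ 0)
    (himage : ∀ x, ∃ v : EuclideanSpace ℂ (Fin n), v ≠ 0 ∧ modelEnd P x v = v)
    (hkernel : ∀ x, ∃ v : EuclideanSpace ℂ (Fin n), v ≠ 0 ∧ modelEnd P x v = 0) :
    IsRicciSplitting (rescale S ht) P lam mu where
  kahler := isKahler_rescale S ht hg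
  splitting := isSplitting_rescale S ht
  ricci_eq x v := by
    refine modelBilin_ext (g := rescale S ht) (x := x) fun u => ?_
    rw [apply_ricciEnd, ricci_rescale S ht hg, hric, rescale_apply]
    simp only [map_add, map_sub, map_smul, add_apply, sub_apply, smul_apply, smul_eq_mul, S.idem]
    field_simp
    ring
  exists_image := himage
  exists_kernel := hkernel

/-- The Kähler metrics whose Ricci tensor has the eigenvalues `lam` and `mu`. -/
abbrev RicciMetric (n : ℕ) (M : Type*) [TopologicalSpace M]
    [ChartedSpace (EuclideanSpace ℂ (Fin n)) M] [IsManifold 𝓘(ℂ, EuclideanSpace ℂ (Fin n)) ω M]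
    (lam mu : ℝ) :=
  {g : Metric n M // IsKahler g ∧ HasRicciEigenvalues g lam mu}

/-- The pairs of a Kähler–Einstein metric and a commuting almost Kähler structure. -/
abbrev EinsteinPair (n : ℕ) (M : Type*) [TopologicalSpace M]
    [ChartedSpace (EuclideanSpace ℂ (Fin n)) M] [IsManifold 𝓘(ℂ, EuclideanSpace ℂ (Fin n)) ω M]
    (lam : ℝ) :=
  {P : Metric n M × EndField n M //
    IsKahlerEinstein P.1 ∧
    (∀ x, scalarCurvature P.1 x = 2 * n * lam) ∧
    IsAlmostKahler P.1 P.2 ∧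
    (∀ x v, P.2 x (cplx x v) = cplx x (P.2 x v)) ∧
    P.2 ≠ cplx ∧ P.2 ≠ -cplx}

/-- `P = 0` means that the almost complex structure is `J`, and `P = 1` that it is `-J`. Both are
excluded globally, and connectedness excludes them at each point. Dimension zero is excluded as
well, since there all endomorphisms agree. -/
theorem EinsteinPair.ricciSplitting [ConnectedSpace M] (Q : EinsteinPair n M lam) (hmu : mu ≠ 0)
    (ht : 0 < lam / mu) :
    IsRicciSplitting (rescale (isSplitting_projEnd Q.2.1.kahler Q.2.2.2.1 Q.2.2.2.2.1) ht)
      (projEnd Q.1.2) lam mu := by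
  obtain ⟨⟨g, A⟩, hK, hs, hA, hJ, h1, h2⟩ := Q
  have hn : n ≠ 0 := by
    rintro rfl
    exact h1 (endField_ext fun x v => Subsingleton.elim _ _)
  have S := isSplitting_projEnd hK.kahler hA hJ
  refine IsSplitting.isRicciSplitting_rescale _ hK.kahler (hK.ricci_eq hn hs) ht hmu
    (S.exists_image ?_) (S.exists_kernel ?_)
  · by_contra! h
    refine h1 ?_
    rw [← twist_projEnd A]
    refine endField_ext fun x v => ?_
    rw [modelEnd_twist, h x]
    simp
    rfl
  · by_contra! h
    refine h2 ?_
    rw [← twist_projEnd A]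
    refine endField_ext fun x v => ?_
    rw [modelEnd_twist, h x]
    change _ = -mulI n v
    rw [← map_neg]
    congr 1
    module

theorem RicciMetric.ricciSplitting (g : RicciMetric n M lam mu) (hne : lam ≠ mu) :
    IsRicciSplitting g.1 (ricciProj g.1 lam mu) lam mu :=
  isRicciSplitting_ricciProj hne g.2.1 g.2.2

/-- `rescale` depends on a proof about the metric and the projection. This allows the projection to
be replaced by an equal one, such as `projEnd (twist P)` by `P`. -/
theorem rescale_congr {g' : Metric n M} {P' : EndField n M} (S : IsSplitting g P)
    (S' : IsSplitting g' P') (hg : g' = g) (h : P' = P) {t : ℝ} (ht : 0 < t) :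
    rescale S' ht = rescale S ht := by
  subst h hg
  rfl

theorem div_pos_of_mul_pos (h : 0 < lam * mu) : 0 < lam / mu := by
  rcases mul_pos_iff.1 h with h | h
  · exact div_pos h.1 h.2
  · exact div_pos_of_neg_of_neg h.1 h.2

/-- The correspondence between Kähler metrics with two Ricci eigenvalues and Kähler–Einstein
metrics with a commuting almost Kähler structure. -/
def ricciCorrespondence [ConnectedSpace M] (hlt : lam < mu) (hpos : 0 < lam * mu) :
    RicciMetric n M lam mu ≃ EinsteinPair n M lam where
  toFun g :=
    have H := g.ricciSplitting hlt.ne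
    have ht : 0 < mu / lam := div_pos_of_mul_pos (mul_comm lam mu ▸ hpos)
    have hE := H.einstein_rescale ht (left_ne_zero_of_mul hpos.ne')
    have hK := isKahler_rescale H.splitting ht H.kahler
    ⟨(rescale H.splitting ht, twist (ricciProj g.1 lam mu)),
      ⟨hK, lam, fun x => ContinuousLinearMap.ext fun v =>
          ContinuousLinearMap.ext fun w => hE x v w⟩,
      fun x => scalarCurvature_of_einstein (hE x),
      (isSplitting_rescale H.splitting ht).isAlmostKahler_twist hK,
      H.splitting.twist_comm,
      twist_ne_cplx (by
        obtain ⟨x⟩ := (inferInstance : Nonempty M)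
        obtain ⟨v, hv0, hv⟩ := H.exists_image x
        exact ⟨x, v, by rwa [hv]⟩),
      twist_ne_neg_cplx (by
        obtain ⟨x⟩ := (inferInstance : Nonempty M)
        obtain ⟨v, hv0, hv⟩ := H.exists_kernel x
        exact ⟨x, v, by rw [hv]; exact hv0.symm⟩)⟩
  invFun Q :=
    have H := Q.ricciSplitting (right_ne_zero_of_mul hpos.ne') (div_pos_of_mul_pos hpos)
    ⟨rescale (isSplitting_projEnd Q.2.1.kahler Q.2.2.2.1 Q.2.2.2.2.1) (div_pos_of_mul_pos hpos),
      H.kahler, H.hasRicciEigenvalues hlt.ne⟩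
  left_inv g := by
    have H := g.ricciSplitting hlt.ne
    have ht : 0 < mu / lam := div_pos_of_mul_pos (mul_comm lam mu ▸ hpos)
    have hlam : lam ≠ 0 := left_ne_zero_of_mul hpos.ne'
    have hmu : mu ≠ 0 := right_ne_zero_of_mul hpos.ne'
    have S' := isSplitting_rescale H.splitting ht
    refine Subtype.ext (Eq.trans ?_ (rescale_rescale H.splitting ht (div_pos_of_mul_pos hpos)
      (by field_simp) S'))
    have S'' : IsSplitting (rescale H.splitting ht) (projEnd (twist (ricciProj g.1 lam mu))) := by
      rwa [projEnd_twist]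
    exact rescale_congr S' S'' rfl (projEnd_twist _) _
  right_inv Q := by
    have H := Q.ricciSplitting (right_ne_zero_of_mul hpos.ne') (div_pos_of_mul_pos hpos)
    have ht : 0 < mu / lam := div_pos_of_mul_pos (mul_comm lam mu ▸ hpos)
    have hlam : lam ≠ 0 := left_ne_zero_of_mul hpos.ne'
    have hmu : mu ≠ 0 := right_ne_zero_of_mul hpos.ne'
    -- The Ricci tensor of the metric just constructed recovers the projection belonging to the
    -- given almost complex structure.
    have hP := H.ricciProj_eq hlt.ne
    have S := isSplitting_projEnd Q.2.1.kahler Q.2.2.2.1 Q.2.2.2.2.1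
    refine Subtype.ext (Prod.ext ?_ ?_)
    · refine Eq.trans ?_ (rescale_rescale S (div_pos_of_mul_pos hpos) ht
        (by field_simp) H.splitting)
      exact rescale_congr H.splitting (hP.symm ▸ H.splitting) rfl hP _
    · exact (congrArg twist hP).trans (twist_projEnd _)

end ComplexManifold

/-! ### Integrability in charts -/

namespace CoordMetric

/-- The Nijenhuis tensor is natural under smooth maps intertwining two fields of endomorphisms. -/
theorem fderiv_nijenhuis {V W : Type*} [NormedAddCommGroup V] [NormedSpace ℝ V]
    [NormedAddCommGroup W] [NormedSpace ℝ W] {A : V → V →L[ℝ] V} {B : W → W →L[ℝ] W}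
    {f : V → W} {y : V} (hf : ContDiffAt ℝ ∞ f y) (hA : DifferentiableAt ℝ A y)
    (hB : DifferentiableAt ℝ B (f y))
    (hAB : ∀ᶠ z in 𝓝 y, ∀ v, fderiv ℝ f z (A z v) = B (f z) (fderiv ℝ f z v)) (X Y : V) :
    fderiv ℝ f y (nijenhuis A y X Y) =
      nijenhuis B (f y) (fderiv ℝ f y X) (fderiv ℝ f y Y) := by
  have hf' := hf.fderiv_infty.differentiableAt_infty
  have hfd := hf.differentiableAt_infty
  have h0 := hAB.self_of_nhds
  -- The derivative of the intertwining relation. The second derivatives of `f` which it brings into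
  -- the Nijenhuis tensor cancel by symmetry.
  have key : ∀ v w, fderiv ℝ (fderiv ℝ f) y v (A y w) + fderiv ℝ f y (fderiv ℝ A y v w) =
      fderiv ℝ B (f y) (fderiv ℝ f y v) (fderiv ℝ f y w) +
        B (f y) (fderiv ℝ (fderiv ℝ f) y v w) := by
    intro v w
    have h1 : (fun z => fderiv ℝ f z (A z w)) =ᶠ[𝓝 y] fun z => B (f z) (fderiv ℝ f z w) := by
      filter_upwards [hAB] with z hz using hz w
    have hl := hf'.hasFDerivAt.clm_apply (hA.hasFDerivAt.clm_apply (hasFDerivAt_const w y))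
    have hr := (hB.hasFDerivAt.comp y hfd.hasFDerivAt).clm_apply
      (hf'.hasFDerivAt.clm_apply (hasFDerivAt_const w y))
    have h2 := congrArg (fun L : V →L[ℝ] W => L v) ((hl.congr_of_eventuallyEq h1.symm).unique hr)
    simp at h2
    rw [add_comm, h2, add_comm]
  have hsymm : ∀ v w, fderiv ℝ (fderiv ℝ f) y v w = fderiv ℝ (fderiv ℝ f) y w v :=
    fun v w => fderiv_fderiv_symm hf v w
  have key' : ∀ v w, fderiv ℝ f y (fderiv ℝ A y v w) =
      fderiv ℝ B (f y) (fderiv ℝ f y v) (fderiv ℝ f y w) +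
        B (f y) (fderiv ℝ (fderiv ℝ f) y v w) - fderiv ℝ (fderiv ℝ f) y v (A y w) :=
    fun v w => by rw [← key, add_sub_cancel_left]
  simp only [nijenhuis, map_add, map_sub, key', h0]
  rw [hsymm (A y Y) X, hsymm (A y X) Y, hsymm (A y X) (A y Y), hsymm X Y]
  abel

end CoordMetric

namespace ComplexManifold

open CoordMetric VectorField

variable {n : ℕ} {M : Type*} [TopologicalSpace M] [ChartedSpace (EuclideanSpace ℂ (Fin n)) M]

/-- The value of a vector field at `x`, as a vector of the model space. -/
def modelVec (V : (x : M) → Tan n x) (x : M) : EuclideanSpace ℂ (Fin n) := V x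

/-- The expression of a vector field in the chart at `x₀`. -/
def coordVec (V : (x : M) → Tan n x) (x₀ : M) (y : EuclideanSpace ℂ (Fin n)) :
    EuclideanSpace ℂ (Fin n) :=
  chartDinv x₀ y (modelVec V ((chartAt (EuclideanSpace ℂ (Fin n)) x₀).symm y))

variable [IsManifold 𝓘(ℂ, EuclideanSpace ℂ (Fin n)) ω M]

theorem coordVec_apply_end (A : EndField n M) (V : (x : M) → Tan n x) {x₀ : M}
    {y : EuclideanSpace ℂ (Fin n)} (hy : y ∈ (chartAt (EuclideanSpace ℂ (Fin n)) x₀).target) :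
    coordVec (fun x => A x (V x)) x₀ y = coordEnd A x₀ y (coordVec V x₀ y) := by
  rw [coordEnd_apply, coordVec, coordVec, chartD_chartDinv hy]
  rfl

theorem inverse_chartD {x₀ : M} {y : EuclideanSpace ℂ (Fin n)}
    (hy : y ∈ (chartAt (EuclideanSpace ℂ (Fin n)) x₀).target) :
    (chartD x₀ y).inverse = chartDinv x₀ y :=
  ContinuousLinearMap.inverse_eq (ContinuousLinearMap.ext (chartD_chartDinv hy))
    (ContinuousLinearMap.ext (chartDinv_chartD hy))

theorem mpullbackWithin_extChartAt_symm (V : (x : M) → Tan n x) {x₀ : M}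
    {y : EuclideanSpace ℂ (Fin n)} (hy : y ∈ (chartAt (EuclideanSpace ℂ (Fin n)) x₀).target) :
    mpullbackWithin 𝓘(ℝ, EuclideanSpace ℂ (Fin n)) 𝓘(ℝ, EuclideanSpace ℂ (Fin n))
      (extChartAt 𝓘(ℝ, EuclideanSpace ℂ (Fin n)) x₀).symm V univ y = coordVec V x₀ y := by
  have h1 : mfderivWithin 𝓘(ℝ, EuclideanSpace ℂ (Fin n)) 𝓘(ℝ, EuclideanSpace ℂ (Fin n))
      (extChartAt 𝓘(ℝ, EuclideanSpace ℂ (Fin n)) x₀).symm univ y = chartD x₀ y := by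
    rw [mfderivWithin_univ]
    rfl
  have h2 := inverse_chartD hy
  rw [← h1] at h2
  exact congrArg (fun L : EuclideanSpace ℂ (Fin n) →L[ℝ] EuclideanSpace ℂ (Fin n) =>
    L (modelVec V ((chartAt (EuclideanSpace ℂ (Fin n)) x₀).symm y))) h2

/-- The Lie bracket, computed in the preferred chart. -/
theorem mlieBracket_eq (V W : (x : M) → Tan n x) (x : M) :
    mlieBracket 𝓘(ℝ, EuclideanSpace ℂ (Fin n)) V W x =
      lieBracket ℝ (coordVec V x) (coordVec W x) (chartAt (EuclideanSpace ℂ (Fin n)) x x) := by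
  have : IsManifold 𝓘(ℝ, EuclideanSpace ℂ (Fin n)) 1 M := .of_le (n := ∞) (by simp)
  have hx := mem_chart_target (EuclideanSpace ℂ (Fin n)) x
  have he : ∀ U : (x : M) → Tan n x,
      mpullbackWithin 𝓘(ℝ, EuclideanSpace ℂ (Fin n)) 𝓘(ℝ, EuclideanSpace ℂ (Fin n))
      (extChartAt 𝓘(ℝ, EuclideanSpace ℂ (Fin n)) x).symm U univ
      =ᶠ[𝓝 (chartAt (EuclideanSpace ℂ (Fin n)) x x)] coordVec U x := fun U => by
    filter_upwards [(chartAt (EuclideanSpace ℂ (Fin n)) x).open_target.mem_nhds hx] with y hy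
    exact mpullbackWithin_extChartAt_symm U hy
  have h1 := (he V).lieBracket_vectorField_eq (𝕜 := ℝ) (he W)
  have h2 : mfderiv 𝓘(ℝ, EuclideanSpace ℂ (Fin n)) 𝓘(ℝ, EuclideanSpace ℂ (Fin n))
      (extChartAt 𝓘(ℝ, EuclideanSpace ℂ (Fin n)) x) x =
        ContinuousLinearMap.id ℝ (EuclideanSpace ℂ (Fin n)) := by
    have h3 := chartDinv_self (n := n) x
    rw [chartDinv, (chartAt (EuclideanSpace ℂ (Fin n)) x).left_inv (mem_chart_source _ _)] at h3
    exact h3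
  rw [← mlieBracketWithin_univ, mlieBracketWithin_apply]
  simp only [preimage_univ, modelWithCornersSelf_coe, range_id, inter_univ]
  have h4 := (congrArg
    (fun L : EuclideanSpace ℂ (Fin n) →L[ℝ] EuclideanSpace ℂ (Fin n) => L.inverse)
    h2).trans (ContinuousLinearMap.inverse_id (R := ℝ) (M := EuclideanSpace ℂ (Fin n)))
  exact (congrArg (fun L : EuclideanSpace ℂ (Fin n) →L[ℝ] EuclideanSpace ℂ (Fin n) => L _) h4).trans
    ((congrFun (lieBracketWithin_univ (𝕜 := ℝ)) _).trans h1)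

theorem contMDiffAt_vectorField_iff {V : (x : M) → Tan n x} {x : M} :
    ContMDiffAt 𝓘(ℝ, EuclideanSpace ℂ (Fin n)) 𝓘(ℝ, EuclideanSpace ℂ (Fin n)).tangent ∞
      (fun y => (⟨y, V y⟩ : TangentBundle 𝓘(ℝ, EuclideanSpace ℂ (Fin n)) M)) x ↔
    ContDiffAt ℝ ∞ (coordVec V x) (chartAt (EuclideanSpace ℂ (Fin n)) x x) := by
  refine (Bundle.contMDiffAt_section (s := V) x).trans (contMDiffAt_iff_comp_chart_symm ?_)
  filter_upwards [(chartAt (EuclideanSpace ℂ (Fin n)) x).open_source.mem_nhds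
    (mem_chart_source (EuclideanSpace ℂ (Fin n)) x)] with z hz
  have h := continuousLinearMapAt_trivializationAt_eq hz
  rw [coordVec, (chartAt (EuclideanSpace ℂ (Fin n)) x).left_inv hz, ← h]
  exact (congrFun (Bundle.Trivialization.coe_linearMapAt_of_mem (R := ℝ)
    (trivializationAt (EuclideanSpace ℂ (Fin n)) (TangentSpace 𝓘(ℝ, EuclideanSpace ℂ (Fin n))) x)
    hz) (V z)).symm

/-- The Nijenhuis expression is tensorial: the derivatives of `X` and `Y` cancel by `A² = -1`,
leaving their values at the point. -/
theorem isIntegrable_iff {A : EndField n M} (hA : IsAlmostComplex A) :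
    IsIntegrable A ↔ ∀ x v w,
      nijenhuis (coordEnd A x) (chartAt (EuclideanSpace ℂ (Fin n)) x x) v w = 0 := by
  have key : ∀ (x : M) (X Y : (x : M) → Tan n x),
      ContDiffAt ℝ ∞ (coordVec X x) (chartAt (EuclideanSpace ℂ (Fin n)) x x) →
      ContDiffAt ℝ ∞ (coordVec Y x) (chartAt (EuclideanSpace ℂ (Fin n)) x x) →
      mlieBracket 𝓘(ℝ, EuclideanSpace ℂ (Fin n)) (fun y => A y (X y)) (fun y => A y (Y y)) x
      - mlieBracket 𝓘(ℝ, EuclideanSpace ℂ (Fin n)) X Y x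
      - A x (mlieBracket 𝓘(ℝ, EuclideanSpace ℂ (Fin n)) (fun y => A y (X y)) Y x)
      - A x (mlieBracket 𝓘(ℝ, EuclideanSpace ℂ (Fin n)) X (fun y => A y (Y y)) x) =
      nijenhuis (coordEnd A x) (chartAt (EuclideanSpace ℂ (Fin n)) x x)
        (coordVec X x (chartAt (EuclideanSpace ℂ (Fin n)) x x))
        (coordVec Y x (chartAt (EuclideanSpace ℂ (Fin n)) x x)) := by
    intro x X Y hX hY
    have hx := mem_chart_target (EuclideanSpace ℂ (Fin n)) x
    have hXd := hX.differentiableAt_infty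
    have hYd := hY.differentiableAt_infty
    have hAd := (isSmoothEnd_iff.1 hA.smooth x).differentiableAt_infty
    have he : ∀ U : (x : M) → Tan n x, coordVec (fun z => A z (U z)) x
        =ᶠ[𝓝 (chartAt (EuclideanSpace ℂ (Fin n)) x x)]
          fun y => coordEnd A x y (coordVec U x y) := fun U => by
      filter_upwards [(chartAt (EuclideanSpace ℂ (Fin n)) x).open_target.mem_nhds hx] with y hy
      exact coordVec_apply_end A U hy
    have hsq : ∀ v, coordEnd A x (chartAt (EuclideanSpace ℂ (Fin n)) x x)
        (coordEnd A x (chartAt (EuclideanSpace ℂ (Fin n)) x x) v) = -v := by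
      intro v
      rw [coordEnd_self]
      exact hA.sq x v
    have hAx : ∀ v : EuclideanSpace ℂ (Fin n),
        A x v = coordEnd A x (chartAt (EuclideanSpace ℂ (Fin n)) x x) v := by
      intro v
      rw [coordEnd_self]
      rfl
    rw [mlieBracket_eq, mlieBracket_eq, mlieBracket_eq, mlieBracket_eq]
    refine Eq.trans (b := lieBracket ℝ (coordVec (fun y => A y (X y)) x)
        (coordVec (fun y => A y (Y y)) x) (chartAt (EuclideanSpace ℂ (Fin n)) x x)
      - lieBracket ℝ (coordVec X x) (coordVec Y x) (chartAt (EuclideanSpace ℂ (Fin n)) x x)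
      - coordEnd A x (chartAt (EuclideanSpace ℂ (Fin n)) x x)
        (lieBracket ℝ (coordVec (fun y => A y (X y)) x) (coordVec Y x)
          (chartAt (EuclideanSpace ℂ (Fin n)) x x))
      - coordEnd A x (chartAt (EuclideanSpace ℂ (Fin n)) x x)
        (lieBracket ℝ (coordVec X x) (coordVec (fun y => A y (Y y)) x)
          (chartAt (EuclideanSpace ℂ (Fin n)) x x))) ?_ ?_
    · rw [← hAx, ← hAx]
      rfl
    rw [(he X).lieBracket_vectorField_eq (he Y), (he X).lieBracket_vectorField_eq (.refl _ _),
      Filter.EventuallyEq.lieBracket_vectorField_eq (.refl _ _) (he Y)]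
    simp only [lieBracket, nijenhuis, fderiv_clm_apply hAd hXd, fderiv_clm_apply hAd hYd,
      add_apply, ContinuousLinearMap.comp_apply, ContinuousLinearMap.flip_apply, map_add, map_sub,
      hsq]
    abel
  constructor
  · intro h x v w
    have hx := mem_chart_target (EuclideanSpace ℂ (Fin n)) x
    -- The field with constant coordinates `v` in the chart at `x`; off that chart its values are
    -- irrelevant.
    let X : EuclideanSpace ℂ (Fin n) → (x : M) → Tan n x := fun v z =>
      chartD x (chartAt (EuclideanSpace ℂ (Fin n)) x z) v
    have hX : ∀ v, coordVec (X v) x =ᶠ[𝓝 (chartAt (EuclideanSpace ℂ (Fin n)) x x)] fun _ => v := by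
      intro v
      filter_upwards [(chartAt (EuclideanSpace ℂ (Fin n)) x).open_target.mem_nhds hx] with y hy
      change chartDinv x y (chartD x (chartAt (EuclideanSpace ℂ (Fin n)) x
        ((chartAt (EuclideanSpace ℂ (Fin n)) x).symm y)) v) = v
      rw [(chartAt (EuclideanSpace ℂ (Fin n)) x).right_inv hy, chartDinv_chartD hy]
    have hXc : ∀ v, ContDiffAt ℝ ∞ (coordVec (X v) x) (chartAt (EuclideanSpace ℂ (Fin n)) x x) :=
      fun v => contDiffAt_const.congr_of_eventuallyEq (hX v)
    have h1 := key x (X v) (X w) (hXc v) (hXc w)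
    rw [(hX v).self_of_nhds, (hX w).self_of_nhds] at h1
    rw [← h1]
    exact h x (X v) (X w) (contMDiffAt_vectorField_iff.2 (hXc v))
      (contMDiffAt_vectorField_iff.2 (hXc w))
  · intro h x X Y hX hY
    exact (key x X Y (contMDiffAt_vectorField_iff.1 hX) (contMDiffAt_vectorField_iff.1 hY)).trans
      (h x _ _)

/-- `isIntegrable_iff` speaks of the centres of the preferred charts only; naturality under
transition maps reaches all points of a chart. -/
theorem IsIntegrable.nijenhuis_coordEnd {A : EndField n M} (hA : IsAlmostComplex A)
    (hN : IsIntegrable A) {x₀ : M} {y : EuclideanSpace ℂ (Fin n)}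
    (hy : y ∈ (chartAt (EuclideanSpace ℂ (Fin n)) x₀).target) (v w : EuclideanSpace ℂ (Fin n)) :
    nijenhuis (coordEnd A x₀) y v w = 0 := by
  have hs := mem_transition_source_self hy
  have hc := contDiffOn_coordEnd (isSmoothEnd_iff.1 hA.smooth)
  have h1 := fderiv_nijenhuis (contDiffAt_transition hs)
    ((hc x₀ y hy).contDiffAt ((chartAt (EuclideanSpace ℂ (Fin n)) x₀).open_target.mem_nhds hy)
      |>.differentiableAt_infty)
    (isSmoothEnd_iff.1 hA.smooth _).differentiableAt_infty (by
      filter_upwards [(transition x₀ _).open_source.mem_nhds hs] with z hz v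
      exact fderiv_transition_coordEnd A hz v) v w
  rw [← fderiv_transition_symm hs (nijenhuis (coordEnd A x₀) y v w), h1]
  refine (congrArg _ ((isIntegrable_iff hA).1 hN _ _ _)).trans (map_zero _)

end ComplexManifold

/-! ### Products and smooth charts -/

namespace CoordMetric

theorem IsKahlerEinsteinOn.const_smul {n : ℕ} {h : EuclideanSpace ℂ (Fin n) →
      EuclideanSpace ℂ (Fin n) →L[ℝ] EuclideanSpace ℂ (Fin n) →L[ℝ] ℝ}
    {U : Set (EuclideanSpace ℂ (Fin n))} (H : IsKahlerEinsteinOn h U) (hU : IsOpen U) {t : ℝ}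
    (ht : 0 < t) : IsKahlerEinsteinOn (fun z => t • h z) U := by
  have HK := H.isKahlerOn hU
  have HM := HK.toIsMetricOn.const_smul ht
  obtain ⟨c, hc⟩ := H.einstein
  refine ⟨HM.smooth, HM.symm, HM.pos, fun y hy v w => ?_, fun y hy => ?_, t⁻¹ * c, fun y hy => ?_⟩
  · simp only [smul_apply, H.hermitian y hy]
  · have hd : DifferentiableAt ℝ (fun z => (h z).comp (mulI n)) y :=
      ((HK.contDiffAt hy).clm_comp contDiffAt_const).differentiableAt_infty
    intro u v w
    have h1 := H.closed y hy u v w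
    change fderiv ℝ (fun z => t • (h z).comp (mulI n)) y u v w +
      fderiv ℝ (fun z => t • (h z).comp (mulI n)) y v w u +
      fderiv ℝ (fun z => t • (h z).comp (mulI n)) y w u v = 0
    rw [fderiv_fun_const_smul hd]
    simp only [smul_apply, smul_eq_mul]
    linear_combination t * h1
  · rw [HK.toIsMetricOn.ricci_const_smul ht hy, hc y hy, smul_smul]
    field_simp

/-- If a Kähler metric is locally isometric to a product of two metrics and the endomorphisms `p`
correspond to constant multiples of the identity on the factors, then the almost complex structure
`J (1 - 2 p)` is integrable. -/
theorem nijenhuis_eq_zero_of_prod {V W W' : Type*} [NormedAddCommGroup V] [NormedSpace ℝ V]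
    [FiniteDimensional ℝ V] [NormedAddCommGroup W] [NormedSpace ℝ W] [FiniteDimensional ℝ W]
    [NormedAddCommGroup W'] [NormedSpace ℝ W'] [FiniteDimensional ℝ W']
    {J : V →L[ℝ] V} {h : V → V →L[ℝ] V →L[ℝ] ℝ} {U : Set V} (H : IsKahlerOn J h U)
    {h₁ : W → W →L[ℝ] W →L[ℝ] ℝ} {U₁ : Set W} (H₁ : IsMetricOn h₁ U₁)
    {h₂ : W' → W' →L[ℝ] W' →L[ℝ] ℝ} {U₂ : Set W'} (H₂ : IsMetricOn h₂ U₂)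
    {f : V → W × W'} (hf : IsLocalIsometryOn f h U (prodMetric h₁ h₂) (U₁ ×ˢ U₂))
    {p A : V → V →L[ℝ] V} {a b : ℝ}
    (hp : ∀ y ∈ U, ∀ v, fderiv ℝ f y (p y v) = (a • (fderiv ℝ f y v).1, b • (fderiv ℝ f y v).2))
    {y : V} (hy : y ∈ U) (hpd : DifferentiableAt ℝ p y)
    (hA : ∀ z ∈ U, ∀ v, A z v = J (v - (2 : ℝ) • p z v)) (hA2 : ∀ v, A y (A y v) = -v) (X Y : V) :
    nijenhuis A y X Y = 0 := by
  have hU := H.isOpen.mem_nhds hy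
  have hfy : ContDiffAt ℝ ∞ f y := (hf.smooth y hy).contDiffAt hU
  have hf' := hfy.fderiv_infty.differentiableAt_infty
  have hinj : ∀ v, fderiv ℝ f y v = 0 → v = 0 := by
    intro v hv
    by_contra hne
    have h1 := H.pos y hy v hne
    rw [hf.pullback y hy, hv] at h1
    simp at h1
  let D : W × W' →L[ℝ] W × W' :=
    (a • ContinuousLinearMap.id ℝ W).prodMap (b • ContinuousLinearMap.id ℝ W')
  have hD : ∀ u, D u = (a • u.1, b • u.2) := fun _ => rfl
  -- This is `∇p = 0`. In the product, `p` becomes the constant map `D`, which commutes with the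
  -- Christoffel symbols of a product metric; the transformation law carries this back to `h`.
  have hDp : ∀ v w, fderiv ℝ p y v w =
      p y (christoffel h y v w) - christoffel h y v (p y w) := by
    intro v w
    have e : (fun z => fderiv ℝ f z (p z w)) =ᶠ[𝓝 y] fun z => D (fderiv ℝ f z w) := by
      filter_upwards [hU] with z hz using hp z hz w
    have hl := hf'.hasFDerivAt.clm_apply (hpd.hasFDerivAt.clm_apply (hasFDerivAt_const w y))
    have hr := D.hasFDerivAt.comp y (hf'.hasFDerivAt.clm_apply (hasFDerivAt_const w y))
    have h2 := congrArg (fun L : V →L[ℝ] W × W' => L v)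
      ((hl.congr_of_eventuallyEq e.symm).unique hr)
    simp only [add_apply, ContinuousLinearMap.comp_apply, ContinuousLinearMap.flip_apply,
      zero_apply, map_zero, zero_add] at h2
    have c1 := hf.christoffel_eq H.toIsMetricOn (H₁.prod H₂) hy v w
    have c2 := hf.christoffel_eq H.toIsMetricOn (H₁.prod H₂) hy v (p y w)
    rw [christoffel_prod H₁ H₂ (hf.mapsTo hy)] at c1 c2
    rw [hp y hy] at c2
    refine sub_eq_zero.1 (hinj _ ?_)
    rw [map_sub, map_sub, hp y hy, c1, c2]
    have h3 : fderiv ℝ f y (fderiv ℝ p y v w) = D (fderiv ℝ (fderiv ℝ f) y v w) -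
        fderiv ℝ (fderiv ℝ f) y v (p y w) := by
      rw [← h2]
      abel
    rw [h3, hD]
    ext1 <;> simp
  have hpA : A =ᶠ[𝓝 y] fun z => J.comp (ContinuousLinearMap.id ℝ V - (2 : ℝ) • p z) := by
    filter_upwards [hU] with z hz
    ext1 v
    exact hA z hz v
  have hDA : ∀ v w, fderiv ℝ A y v w = -((2 : ℝ) • J (fderiv ℝ p y v w)) := by
    intro v w
    have h1 := (hasFDerivAt_const J y).clm_comp
      ((hasFDerivAt_const (ContinuousLinearMap.id ℝ V) y).sub (hpd.hasFDerivAt.const_smul (2 : ℝ)))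
    rw [(h1.congr_of_eventuallyEq hpA).fderiv]
    simp
  refine nijenhuis_eq_zero_of_parallel (fun v w => christoffel h y v w) (H.christoffel_symm hy) hA2
    (fun v w => ?_) X Y
  rw [hDA, hDp, hA y hy, hA y hy, H.christoffel_J_right hy]
  simp only [map_sub, map_smul]
  module

end CoordMetric

namespace ComplexManifold

open CoordMetric

variable {n : ℕ} {M : Type*} [TopologicalSpace M] [ChartedSpace (EuclideanSpace ℂ (Fin n)) M]
  {F : Type*} [NormedAddCommGroup F]

/-- The expression of a chart `Φ` with values in `F` in the coordinates of the chart at `x₀`. -/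
def chartRep (Φ : OpenPartialHomeomorph M F) (x₀ : M) :
    OpenPartialHomeomorph (EuclideanSpace ℂ (Fin n)) F :=
  (chartAt (EuclideanSpace ℂ (Fin n)) x₀).symm.trans Φ

theorem mem_chartRep_source {Φ : OpenPartialHomeomorph M F} {x₀ : M}
    {y : EuclideanSpace ℂ (Fin n)} : y ∈ (chartRep Φ x₀).source ↔
      y ∈ (chartAt (EuclideanSpace ℂ (Fin n)) x₀).target ∧
        (chartAt (EuclideanSpace ℂ (Fin n)) x₀).symm y ∈ Φ.source := by
  simp [chartRep]

theorem mem_chartRep_source_self {Φ : OpenPartialHomeomorph M F} {x : M} (hx : x ∈ Φ.source) :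
    chartAt (EuclideanSpace ℂ (Fin n)) x x ∈ (chartRep Φ x).source := by
  refine mem_chartRep_source.2 ⟨mem_chart_target _ x, ?_⟩
  rwa [(chartAt (EuclideanSpace ℂ (Fin n)) x).left_inv (mem_chart_source _ _)]

variable [NormedSpace ℝ F]

/-- The derivative of a map from `M` to a vector space. -/
def modelDiff (f : M → F) (x : M) : EuclideanSpace ℂ (Fin n) →L[ℝ] F :=
  mfderiv 𝓘(ℝ, EuclideanSpace ℂ (Fin n)) 𝓘(ℝ, F) f x

/-- `Φ` is a diffeomorphism from an open subset of `M` to an open subset of `F`. -/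
structure IsSmoothChart (Φ : OpenPartialHomeomorph M F) : Prop where
  smooth : ContMDiffOn 𝓘(ℝ, EuclideanSpace ℂ (Fin n)) 𝓘(ℝ, F) ∞ Φ Φ.source
  smooth_symm : ContMDiffOn 𝓘(ℝ, F) 𝓘(ℝ, EuclideanSpace ℂ (Fin n)) ∞ Φ.symm Φ.target

theorem IsSmoothChart.bijective {Φ : OpenPartialHomeomorph M F} (hΦ : IsSmoothChart (n := n) Φ)
    {x : M} (hx : x ∈ Φ.source) : Function.Bijective (modelDiff (n := n) Φ x) := by
  have h : Φ.MDifferentiable 𝓘(ℝ, EuclideanSpace ℂ (Fin n)) 𝓘(ℝ, F) :=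
    ⟨hΦ.smooth.mdifferentiableOn (by simp), hΦ.smooth_symm.mdifferentiableOn (by simp)⟩
  exact h.mfderiv_bijective hx

variable [IsManifold 𝓘(ℂ, EuclideanSpace ℂ (Fin n)) ω M]

theorem IsSmoothChart.contDiffAt_chartRep {Φ : OpenPartialHomeomorph M F}
    (hΦ : IsSmoothChart (n := n) Φ) {x₀ : M} {y : EuclideanSpace ℂ (Fin n)}
    (hy : y ∈ (chartRep Φ x₀).source) : ContDiffAt ℝ ∞ (chartRep Φ x₀) y := by
  obtain ⟨h1, h2⟩ := mem_chartRep_source.1 hy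
  rw [← contMDiffAt_iff_contDiffAt]
  have h3 : ContMDiffAt 𝓘(ℝ, EuclideanSpace ℂ (Fin n)) 𝓘(ℝ, EuclideanSpace ℂ (Fin n)) ∞
      (chartAt (EuclideanSpace ℂ (Fin n)) x₀).symm y :=
    contMDiffOn_chart_symm.contMDiffAt
      ((chartAt (EuclideanSpace ℂ (Fin n)) x₀).open_target.mem_nhds h1)
  exact (hΦ.smooth.contMDiffAt (Φ.open_source.mem_nhds h2)).comp y h3

theorem IsSmoothChart.fderiv_chartRep {Φ : OpenPartialHomeomorph M F}
    (hΦ : IsSmoothChart (n := n) Φ) {x₀ : M} {y : EuclideanSpace ℂ (Fin n)}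
    (hy : y ∈ (chartRep Φ x₀).source) (v : EuclideanSpace ℂ (Fin n)) :
    fderiv ℝ (chartRep Φ x₀) y v =
      modelDiff Φ ((chartAt (EuclideanSpace ℂ (Fin n)) x₀).symm y) (chartD x₀ y v) := by
  obtain ⟨h1, h2⟩ := mem_chartRep_source.1 hy
  have h3 := ((mdifferentiable_chart_real x₀).mdifferentiableAt_symm h1).hasMFDerivAt
  have h4 := ((hΦ.smooth.contMDiffAt (Φ.open_source.mem_nhds h2)).mdifferentiableAt
    (by simp)).hasMFDerivAt
  have h5 := (h4.comp y h3).mfderiv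
  rw [← mfderiv_eq_fderiv]
  exact DFunLike.congr_fun h5 v

theorem IsSmoothChart.bijective_fderiv_chartRep {Φ : OpenPartialHomeomorph M F}
    (hΦ : IsSmoothChart (n := n) Φ) {x₀ : M} {y : EuclideanSpace ℂ (Fin n)}
    (hy : y ∈ (chartRep Φ x₀).source) : Function.Bijective (fderiv ℝ (chartRep Φ x₀) y) := by
  obtain ⟨h1, h2⟩ := mem_chartRep_source.1 hy
  have h3 : ⇑(fderiv ℝ (chartRep Φ x₀) y) =
      modelDiff Φ ((chartAt (EuclideanSpace ℂ (Fin n)) x₀).symm y) ∘ chartD x₀ y :=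
    funext (hΦ.fderiv_chartRep hy)
  rw [h3]
  exact (hΦ.bijective h2).comp (Function.bijective_iff_has_inverse.2
    ⟨chartDinv x₀ y, chartDinv_chartD h1, chartD_chartDinv h1⟩)

theorem isSmoothChart_trans {Φ : OpenPartialHomeomorph (EuclideanSpace ℂ (Fin n)) F}
    (hs : ContDiffOn ℝ ∞ Φ Φ.source) (hs' : ContDiffOn ℝ ∞ Φ.symm Φ.target) (x₀ : M) :
    IsSmoothChart (n := n) ((chartAt (EuclideanSpace ℂ (Fin n)) x₀).trans Φ) where
  smooth := by
    rw [OpenPartialHomeomorph.trans_source]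
    exact (contMDiffOn_iff_contDiffOn.2 hs).comp
      (contMDiffOn_chart.mono inter_subset_left) fun x hx => hx.2
  smooth_symm := by
    rw [OpenPartialHomeomorph.trans_target]
    exact (contMDiffOn_chart_symm (n := ∞) (I := 𝓘(ℝ, EuclideanSpace ℂ (Fin n))) (x := x₀)).comp
      (contMDiffOn_iff_contDiffOn.2 (hs'.mono inter_subset_left)) fun x hx => hx.2

theorem modelDiff_trans {Φ : OpenPartialHomeomorph (EuclideanSpace ℂ (Fin n)) F}
    (hs : ContDiffOn ℝ ∞ Φ Φ.source) {x₀ x : M}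
    (hx : x ∈ (chartAt (EuclideanSpace ℂ (Fin n)) x₀).source)
    (hx' : chartAt (EuclideanSpace ℂ (Fin n)) x₀ x ∈ Φ.source) (v : EuclideanSpace ℂ (Fin n)) :
    modelDiff ((chartAt (EuclideanSpace ℂ (Fin n)) x₀).trans Φ) x v =
      fderiv ℝ Φ (chartAt (EuclideanSpace ℂ (Fin n)) x₀ x)
        (chartDinv x₀ (chartAt (EuclideanSpace ℂ (Fin n)) x₀ x) v) := by
  have h3 := ((mdifferentiable_chart_real x₀).mdifferentiableAt hx).hasMFDerivAt
  have h4 := (((hs _ hx').contDiffAt (Φ.open_source.mem_nhds hx')).differentiableAt_infty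
    ).hasFDerivAt.hasMFDerivAt
  have h5 := (h4.comp x h3).mfderiv
  rw [chartDinv, (chartAt (EuclideanSpace ℂ (Fin n)) x₀).left_inv hx]
  exact DFunLike.congr_fun h5 v

end ComplexManifold

/-! ### Local products along a splitting -/

namespace ComplexManifold

open CoordMetric

variable {n : ℕ} {M : Type*} [TopologicalSpace M] [ChartedSpace (EuclideanSpace ℂ (Fin n)) M]
  {P : EndField n M}

theorem twist_eq_cplx_iff {x : M} {v : EuclideanSpace ℂ (Fin n)} :
    modelEnd (twist P) x v = mulI n v ↔ modelEnd P x v = 0 := by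
  rw [modelEnd_twist, map_sub, sub_eq_self, map_smul, smul_eq_zero_iff_right two_ne_zero]
  refine ⟨fun h => ?_, fun h => by rw [h, map_zero]⟩
  rw [← neg_eq_zero, ← mulI_mulI, h, map_zero]

theorem twist_eq_neg_cplx_iff {x : M} {v : EuclideanSpace ℂ (Fin n)} :
    modelEnd (twist P) x v = -mulI n v ↔ modelEnd P x v = v := by
  rw [modelEnd_twist, ← map_neg]
  refine ⟨fun h => ?_, fun h => by rw [h]; congr 1; module⟩
  have h1 := congrArg (mulI n) h
  rw [mulI_mulI, mulI_mulI, neg_inj, ← sub_eq_zero] at h1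
  rw [← sub_eq_zero, ← smul_eq_zero_iff_right (two_ne_zero (α := ℝ)), ← neg_eq_zero, ← h1]
  module

variable [IsManifold 𝓘(ℂ, EuclideanSpace ℂ (Fin n)) ω M] {g : Metric n M} {lam mu : ℝ}

theorem IsKEProductChart.isSmoothChart {p q : ℕ}
    {Φ : OpenPartialHomeomorph M (EuclideanSpace ℂ (Fin p) × EuclideanSpace ℂ (Fin q))}
    {U₁ : Set (EuclideanSpace ℂ (Fin p))} {U₂ : Set (EuclideanSpace ℂ (Fin q))}
    {h₁ : EuclideanSpace ℂ (Fin p) →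
      EuclideanSpace ℂ (Fin p) →L[ℝ] EuclideanSpace ℂ (Fin p) →L[ℝ] ℝ}
    {h₂ : EuclideanSpace ℂ (Fin q) →
      EuclideanSpace ℂ (Fin q) →L[ℝ] EuclideanSpace ℂ (Fin q) →L[ℝ] ℝ}
    (H : IsKEProductChart g Φ U₁ U₂ h₁ h₂) : IsSmoothChart (n := n) Φ :=
  ⟨H.smooth, H.smooth_symm⟩

theorem IsRicciSplitting.coordEnd_ricciEnd (H : IsRicciSplitting g P lam mu) {x₀ : M}
    {y : EuclideanSpace ℂ (Fin n)} (hy : y ∈ (chartAt (EuclideanSpace ℂ (Fin n)) x₀).target)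
    (v : EuclideanSpace ℂ (Fin n)) : coordEnd (ricciEnd g) x₀ y v =
      lam • (v - coordEnd P x₀ y v) + mu • coordEnd P x₀ y v := by
  rw [coordEnd_apply, H.ricci_eq, coordEnd_apply]
  simp only [map_add, map_sub, map_smul, chartDinv_chartD hy]

/-- If `J (1 - 2 P)` is integrable, then the metric is locally the product of two Kähler–Einstein
metrics on the leaves tangent to the kernel and to the image of `P`. -/
theorem IsRicciSplitting.isLocallyKEProductAlong (H : IsRicciSplitting g P lam mu)
    (hN : IsIntegrable (twist P)) : IsLocallyKEProductAlong g (twist P) := by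
  intro x
  have hA := (H.splitting.isAlmostKahler_twist H.kahler).almostComplex
  have HK := isKahler_iff.1 H.kahler x
  obtain ⟨a, b, Φ, U₁, U₂, h₁, h₂, hxΦ, hΦU, hU₁, hU₂, hΦt, hs, hs', hh₁, hh₂, hΦ⟩ :=
    exists_product_chart (mem_chart_target (EuclideanSpace ℂ (Fin n)) x) HK (H.splitting x)
      (fun y hy => (H.splitting x).fderiv_holomorphic HK hy
        (fun z hz v => coordEnd_twist P hz v) fun X Y => hN.nijenhuis_coordEnd hA hy X Y)
      (lam := lam) (mu := mu) (fun y hy v w => by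
        rw [← coord_coordEnd_ricciEnd g hy, H.coordEnd_ricciEnd hy]
        simp only [map_add, map_smul, add_apply, smul_apply, smul_eq_mul])
  have hsc := isSmoothChart_trans hs hs' x
  have hsrc : ∀ y ∈ ((chartAt (EuclideanSpace ℂ (Fin n)) x).trans Φ).source,
      chartAt (EuclideanSpace ℂ (Fin n)) x y ∈ Φ.source := fun y hy => hy.2
  have hd : ∀ y ∈ ((chartAt (EuclideanSpace ℂ (Fin n)) x).trans Φ).source,
      ∀ v : EuclideanSpace ℂ (Fin n),
      modelDiff ((chartAt (EuclideanSpace ℂ (Fin n)) x).trans Φ) y v =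
        fderiv ℝ Φ (chartAt (EuclideanSpace ℂ (Fin n)) x y)
          (chartDinv x (chartAt (EuclideanSpace ℂ (Fin n)) x y) v) :=
    fun y hy v => modelDiff_trans hs hy.1 hy.2 v
  have hcoord : ∀ y ∈ ((chartAt (EuclideanSpace ℂ (Fin n)) x).trans Φ).source,
      ∀ v : EuclideanSpace ℂ (Fin n),
      coordEnd P x (chartAt (EuclideanSpace ℂ (Fin n)) x y)
          (chartDinv x (chartAt (EuclideanSpace ℂ (Fin n)) x y) v) =
        chartDinv x (chartAt (EuclideanSpace ℂ (Fin n)) x y) (modelEnd P y v) := fun y hy v => by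
    rw [coordEnd_apply, chartD_chartDinv (hΦU (hsrc y hy)),
      (chartAt (EuclideanSpace ℂ (Fin n)) x).left_inv hy.1]
  have hinj : ∀ y ∈ ((chartAt (EuclideanSpace ℂ (Fin n)) x).trans Φ).source,
      Function.Injective (chartDinv x (chartAt (EuclideanSpace ℂ (Fin n)) x y)) := fun y hy =>
    Function.LeftInverse.injective (chartD_chartDinv (hΦU (hsrc y hy)))
  have key : ∀ y ∈ ((chartAt (EuclideanSpace ℂ (Fin n)) x).trans Φ).source,
      ∀ v : EuclideanSpace ℂ (Fin n),
      modelDiff ((chartAt (EuclideanSpace ℂ (Fin n)) x).trans Φ) y (mulI n v) =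
        (mulI a (modelDiff ((chartAt (EuclideanSpace ℂ (Fin n)) x).trans Φ) y v).1,
          mulI b (modelDiff ((chartAt (EuclideanSpace ℂ (Fin n)) x).trans Φ) y v).2) ∧
      ((modelDiff ((chartAt (EuclideanSpace ℂ (Fin n)) x).trans Φ) y v).1 = 0 ↔
        modelEnd P y v = v) ∧
      ((modelDiff ((chartAt (EuclideanSpace ℂ (Fin n)) x).trans Φ) y v).2 = 0 ↔
        modelEnd P y v = 0) := fun y hy v => by
    obtain ⟨-, -, h3⟩ := hΦ _ (hsrc y hy)
    rw [hd y hy, hd y hy, chartDinv_mulI (hΦU (hsrc y hy))]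
    obtain ⟨h4, h5, h6⟩ := h3 (chartDinv x (chartAt (EuclideanSpace ℂ (Fin n)) x y) v)
    refine ⟨h4, h5.trans ?_, h6.trans ?_⟩
    · rw [hcoord y hy, (hinj y hy).eq_iff]
    · rw [hcoord y hy, map_eq_zero_iff _ (hinj y hy)]
  have hx : x ∈ ((chartAt (EuclideanSpace ℂ (Fin n)) x).trans Φ).source :=
    ⟨mem_chart_source _ x, hxΦ⟩
  refine ⟨a, b, (chartAt (EuclideanSpace ℂ (Fin n)) x).trans Φ, U₁, U₂, h₁, h₂, hx,
    { pos₁ := ?_, pos₂ := ?_, open₁ := hU₁, open₂ := hU₂, target_eq := ?_,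
      smooth := hsc.smooth, smooth_symm := hsc.smooth_symm, kahlerEinstein₁ := hh₁,
      kahlerEinstein₂ := hh₂, isometry := fun y hy (v w : EuclideanSpace ℂ (Fin n)) => ?_ },
    fun y hy (v : EuclideanSpace ℂ (Fin n)) => ?_⟩
  -- If a factor had dimension zero, the corresponding component of the differential would vanish
  -- identically, and `P` would be the identity or zero at `x`.
  · rw [Nat.pos_iff_ne_zero]
    rintro rfl
    obtain ⟨v, hv0, hv⟩ := H.exists_kernel x
    exact hv0 (((key x hx v).2.1.1 (Subsingleton.elim _ _)).symm.trans hv)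
  · rw [Nat.pos_iff_ne_zero]
    rintro rfl
    obtain ⟨v, hv0, hv⟩ := H.exists_image x
    exact hv0 (hv.symm.trans ((key x hx v).2.2.1 (Subsingleton.elim _ _)))
  · rw [OpenPartialHomeomorph.trans_target, ← hΦt, inter_eq_left]
    exact fun z hz => hΦU (Φ.map_target hz)
  · obtain ⟨-, h2, -⟩ := hΦ _ (hsrc y hy)
    have h3 := h2 (chartDinv x (chartAt (EuclideanSpace ℂ (Fin n)) x y) v)
      (chartDinv x (chartAt (EuclideanSpace ℂ (Fin n)) x y) w)
    rw [coord_apply, chartD_chartDinv (hΦU (hsrc y hy)), chartD_chartDinv (hΦU (hsrc y hy)),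
      (chartAt (EuclideanSpace ℂ (Fin n)) x).left_inv hy.1, ← hd y hy, ← hd y hy] at h3
    exact h3
  · obtain ⟨h4, h5, h6⟩ := key y hy v
    exact ⟨congrArg Prod.fst h4, congrArg Prod.snd h4, twist_eq_cplx_iff.trans h6.symm,
      twist_eq_neg_cplx_iff.trans h5.symm⟩

theorem IsLocallyKEProductAlong.isLocallyKEProduct {A : EndField n M}
    (h : IsLocallyKEProductAlong g A) : IsLocallyKEProduct g := by
  intro x
  obtain ⟨p, q, Φ, U₁, U₂, h₁, h₂, hx, hΦ, -⟩ := h x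
  exact ⟨p, q, Φ, U₁, U₂, h₁, h₂, hx, hΦ⟩

/-- The same chart serves: only the second factor, tangent to the image of `P`, is multiplied by
`t`, and it remains Kähler–Einstein. -/
theorem IsLocallyKEProductAlong.rescale (S : IsSplitting g P)
    (h : IsLocallyKEProductAlong g (twist P)) {t : ℝ} (ht : 0 < t) :
    IsLocallyKEProductAlong (rescale S ht) (twist P) := by
  intro x
  obtain ⟨p, q, Φ, U₁, U₂, h₁, h₂, hx, hΦ, hD⟩ := h x
  refine ⟨p, q, Φ, U₁, U₂, h₁, fun z => t • h₂ z, hx,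
    { hΦ with
      kahlerEinstein₂ := hΦ.kahlerEinstein₂.const_smul hΦ.open₂ ht
      isometry := fun y hy (v w : EuclideanSpace ℂ (Fin n)) => ?_ }, hD⟩
  have hiso : ∀ v w : EuclideanSpace ℂ (Fin n), modelBilin g.inner y v w =
      h₁ (Φ y).1 (modelDiff Φ y v).1 (modelDiff Φ y w).1
        + h₂ (Φ y).2 (modelDiff Φ y v).2 (modelDiff Φ y w).2 := hΦ.isometry y hy
  have h1 : (modelDiff Φ y (modelEnd P y v)).1 = 0 :=
    ((hD y hy (modelEnd P y v)).2.2.2).1 (twist_eq_neg_cplx_iff.2 (S.idem y v))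
  have h2 : (modelDiff Φ y (modelEnd P y v)).2 = (modelDiff Φ y v).2 := by
    have h3 : (modelDiff Φ y (v - modelEnd P y v)).2 = 0 :=
      ((hD y hy (v - modelEnd P y v)).2.2.1).1 (twist_eq_cplx_iff.2 (by
        rw [map_sub, S.idem, sub_self]))
    rw [map_sub, Prod.snd_sub, sub_eq_zero] at h3
    exact h3.symm
  change modelBilin (ComplexManifold.rescale S ht).inner y v w =
    h₁ (Φ y).1 (modelDiff Φ y v).1 (modelDiff Φ y w).1
      + (t • h₂ (Φ y).2) (modelDiff Φ y v).2 (modelDiff Φ y w).2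
  rw [rescale_apply, map_add, map_smul, add_apply, smul_apply, hiso, hiso, h1, h2]
  simp only [map_zero, zero_apply, smul_apply, smul_eq_mul]
  ring

end ComplexManifold

/-! ### Equivalence of the integrability conditions -/

namespace CoordMetric

/-- The complex structure `(i, -i)` on `ℂᵃ × ℂᵇ` is isomorphic to `ℂⁿ`. -/
theorem exists_equiv_conj_snd {a b n : ℕ} (h : a + b = n) :
    ∃ L : (EuclideanSpace ℂ (Fin a) × EuclideanSpace ℂ (Fin b)) ≃L[ℝ] EuclideanSpace ℂ (Fin n),
      ∀ u w, L (mulI a u, -mulI b w) = mulI n (L (u, w)) := by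
  -- Complex conjugation of the second factor turns `-i` into `i`.
  let C : EuclideanSpace ℂ (Fin b) ≃L[ℝ] EuclideanSpace ℂ (Fin b) :=
    (LinearIsometryEquiv.piLpCongrRight 2 fun _ : Fin b => Complex.conjLIE).toContinuousLinearEquiv
  have hC : ∀ w, C (-mulI b w) = mulI b (C w) := by
    intro w
    ext i
    change star (-(Complex.I * w i)) = Complex.I * star (w i)
    simp
  have hf : Module.finrank ℂ (EuclideanSpace ℂ (Fin a) × EuclideanSpace ℂ (Fin b)) =
      Module.finrank ℂ (EuclideanSpace ℂ (Fin n)) := by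
    simp [h]
  let L := ContinuousLinearEquiv.ofFinrankEq hf
  let L' : (EuclideanSpace ℂ (Fin a) × EuclideanSpace ℂ (Fin b)) ≃L[ℝ] EuclideanSpace ℂ (Fin n) :=
    { L with map_smul' := fun c z => LinearMap.map_smul_of_tower L.toLinearEquiv.toLinearMap c z }
  refine ⟨((ContinuousLinearEquiv.refl ℝ _).prodCongr C).trans L',
    fun u w => ?_⟩
  change L (mulI a u, C (-mulI b w)) = mulI n (L (u, C w))
  rw [hC]
  exact L.map_smul Complex.I (u, C w)

theorem nijenhuis_const {V : Type*} [NormedAddCommGroup V] [NormedSpace ℝ V] (B : V →L[ℝ] V)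
    (y X Y : V) : nijenhuis (fun _ => B) y X Y = 0 := by
  simp [nijenhuis]

end CoordMetric

namespace ComplexManifold

open CoordMetric

variable {n : ℕ} {M : Type*} [TopologicalSpace M] [ChartedSpace (EuclideanSpace ℂ (Fin n)) M]
  [IsManifold 𝓘(ℂ, EuclideanSpace ℂ (Fin n)) ω M]
  {P : EndField n M} {g : Metric n M} {lam mu : ℝ}

theorem differentiableAt_coordEnd {A : EndField n M} (hA : IsSmoothEnd A) (x₀ : M)
    {y : EuclideanSpace ℂ (Fin n)} (hy : y ∈ (chartAt (EuclideanSpace ℂ (Fin n)) x₀).target) :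
    DifferentiableAt ℝ (coordEnd A x₀) y :=
  ((contDiffOn_coordEnd (isSmoothEnd_iff.1 hA) x₀ y hy).contDiffAt
    ((chartAt (EuclideanSpace ℂ (Fin n)) x₀).open_target.mem_nhds hy)).differentiableAt_infty

/-- The chart carries `A` to a constant endomorphism, whose Nijenhuis tensor is zero, and the tensor
is natural. -/
theorem HasComplexCharts.isIntegrable {A : EndField n M} (hA : IsAlmostComplex A)
    (h : HasComplexCharts A) : IsIntegrable A := by
  refine (isIntegrable_iff hA).2 fun x v w => ?_
  obtain ⟨Ψ, hx, hs, hs', hΨ⟩ := h x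
  have hΨs : IsSmoothChart (n := n) Ψ := ⟨hs, hs'⟩
  have hx' := mem_chartRep_source_self (n := n) hx
  refine (hΨs.bijective_fderiv_chartRep hx').1 ?_
  rw [map_zero, fderiv_nijenhuis (B := fun _ => mulI n) (hΨs.contDiffAt_chartRep hx')
    (differentiableAt_coordEnd hA.smooth x (mem_chart_target _ x)) (differentiableAt_const _) ?_,
    nijenhuis_const]
  filter_upwards [(chartRep Ψ x).open_source.mem_nhds hx'] with z hz u
  obtain ⟨h1, h2⟩ := mem_chartRep_source.1 hz
  rw [hΨs.fderiv_chartRep hz, hΨs.fderiv_chartRep hz, coordEnd_apply, chartD_chartDinv h1]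
  exact hΨ _ h2 _

/-- In a product chart `J (1 - 2P)` becomes `(i, -i)`; conjugating the second factor makes it
multiplication by `i`. -/
theorem IsLocallyKEProductAlong.hasComplexCharts (S : IsSplitting g P)
    (h : IsLocallyKEProductAlong g (twist P)) : HasComplexCharts (twist P) := by
  intro x
  obtain ⟨p, q, Φ, U₁, U₂, h₁, h₂, hx, hΦ, hD⟩ := h x
  have hΦs := hΦ.isSmoothChart
  have hn : p + q = n := by
    have h1 := (LinearEquiv.ofBijective (modelDiff (n := n) Φ x).toLinearMap
      (hΦs.bijective hx)).finrank_eq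
    rw [Module.finrank_prod, finrank_real_euclideanSpace, finrank_real_euclideanSpace,
      finrank_real_euclideanSpace] at h1
    omega
  obtain ⟨L, hL⟩ := exists_equiv_conj_snd hn
  have hkey : ∀ y ∈ Φ.source, ∀ v : EuclideanSpace ℂ (Fin n),
      modelDiff Φ y (modelEnd (twist P) y v) =
        (mulI p (modelDiff Φ y v).1, -mulI q (modelDiff Φ y v).2) := by
    intro y hy v
    have hJ : ∀ u : EuclideanSpace ℂ (Fin n), modelDiff Φ y (mulI n u) =
        (mulI p (modelDiff Φ y u).1, mulI q (modelDiff Φ y u).2) := fun u =>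
      Prod.ext (hD y hy u).1 (hD y hy u).2.1
    have h1 : (modelDiff Φ y (modelEnd P y v)).1 = 0 :=
      ((hD y hy (modelEnd P y v)).2.2.2).1 (twist_eq_neg_cplx_iff.2 (S.idem y v))
    have h3 : (modelDiff Φ y (v - modelEnd P y v)).2 = 0 :=
      ((hD y hy (v - modelEnd P y v)).2.2.1).1 (twist_eq_cplx_iff.2 (by
        rw [map_sub, S.idem, sub_self]))
    rw [map_sub, Prod.snd_sub, sub_eq_zero] at h3
    rw [modelEnd_twist, hJ, map_sub, map_smul, Prod.fst_sub, Prod.snd_sub, Prod.smul_fst,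
      Prod.smul_snd, h1, ← h3, ← map_neg]
    congr 2 <;> module
  refine ⟨Φ.trans L.toHomeomorph.toOpenPartialHomeomorph, by simpa using hx, ?_, ?_, ?_⟩
  · exact (L.contDiff.contMDiff.comp_contMDiffOn hΦs.smooth).mono (by simp)
  · refine hΦs.smooth_symm.comp (t := Φ.target) (L.symm.contDiff.contMDiff.contMDiffOn) ?_
    intro z hz
    simpa using hz
  · intro y hy (v : EuclideanSpace ℂ (Fin n))
    have hy' : y ∈ Φ.source := by simpa using hy
    have h4 := ((hΦs.smooth.contMDiffAt (Φ.open_source.mem_nhds hy')).mdifferentiableAt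
      (by simp)).hasMFDerivAt
    have h5 := ((L : (EuclideanSpace ℂ (Fin p) × EuclideanSpace ℂ (Fin q)) →L[ℝ]
      EuclideanSpace ℂ (Fin n)).hasFDerivAt.hasMFDerivAt.comp y h4).mfderiv
    have h6 : ∀ u : EuclideanSpace ℂ (Fin n),
        modelDiff (Φ.trans L.toHomeomorph.toOpenPartialHomeomorph) y u = L (modelDiff Φ y u) :=
      fun u => DFunLike.congr_fun h5 u
    change modelDiff (Φ.trans L.toHomeomorph.toOpenPartialHomeomorph) y
        (modelEnd (twist P) y v) =
      mulI n (modelDiff (Φ.trans L.toHomeomorph.toOpenPartialHomeomorph) y v)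
    rw [h6, h6, hkey y hy', hL]

/-- If a metric with two Ricci eigenvalues is locally a product of Kähler–Einstein metrics, then
its Ricci eigenspaces define an integrable almost complex structure. -/
theorem IsRicciSplitting.isIntegrable_of_isLocallyKEProduct (H : IsRicciSplitting g P lam mu)
    (hne : lam ≠ mu) (h : IsLocallyKEProduct g) : IsIntegrable (twist P) := by
  have hA := (H.splitting.isAlmostKahler_twist H.kahler).almostComplex
  refine (isIntegrable_iff hA).2 fun x v w => ?_
  obtain ⟨p, q, Φ, U₁, U₂, h₁, h₂, hx, hΦ⟩ := h x
  have hΦs := hΦ.isSmoothChart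
  have hsrc : ∀ {y}, y ∈ (chartRep (n := n) Φ x).source →
      y ∈ (chartAt (EuclideanSpace ℂ (Fin n)) x).target := fun hy =>
    (mem_chartRep_source.1 hy).1
  have hx' := mem_chartRep_source_self (n := n) hx
  have HJ := isKahler_iff.1 H.kahler x
  have HM := HJ.toIsMetricOn.mono (chartRep Φ x).open_source fun _ => hsrc
  have HK : IsKahlerOn (mulI n) (coord g.inner x) (chartRep (n := n) Φ x).source :=
    { HM with
      sq := HJ.sq
      hermitian := fun y hy => HJ.hermitian y (hsrc hy)
      closed := fun y hy => HJ.closed y (hsrc hy) }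
  have K₁ := (hΦ.kahlerEinstein₁.isKahlerOn hΦ.open₁).toIsMetricOn
  have K₂ := (hΦ.kahlerEinstein₂.isKahlerOn hΦ.open₂).toIsMetricOn
  have hf : IsLocalIsometryOn (chartRep Φ x) (coord g.inner x) (chartRep (n := n) Φ x).source
      (prodMetric h₁ h₂) (U₁ ×ˢ U₂) := {
    smooth := fun y hy => (hΦs.contDiffAt_chartRep hy).contDiffWithinAt
    mapsTo := fun y hy => by
      rw [← hΦ.target_eq]
      exact Φ.map_source (mem_chartRep_source.1 hy).2
    pullback := fun y hy v w => by
      rw [coord_apply, prodMetric_apply, hΦs.fderiv_chartRep hy, hΦs.fderiv_chartRep hy]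
      exact hΦ.isometry _ (mem_chartRep_source.1 hy).2 (chartD x y v) (chartD x y w)
    surjective := fun y hy => (hΦs.bijective_fderiv_chartRep hy).2 }
  obtain ⟨c₁, hc₁⟩ := hΦ.kahlerEinstein₁.einstein
  obtain ⟨c₂, hc₂⟩ := hΦ.kahlerEinstein₂.einstein
  -- The Ricci endomorphism of the product is `c₁` on one factor and `c₂` on the other. The chart
  -- need not be holomorphic, since this is a Riemannian statement.
  have hric : ∀ y ∈ (chartRep (n := n) Φ x).source, ∀ v : EuclideanSpace ℂ (Fin n),
      fderiv ℝ (chartRep Φ x) y (coordEnd (ricciEnd g) x y v) =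
        (c₁ • (fderiv ℝ (chartRep Φ x) y v).1, c₂ • (fderiv ℝ (chartRep Φ x) y v).2) := by
    intro y hy v
    refine (K₁.prod K₂).ext_left (hf.mapsTo hy) fun u => ?_
    obtain ⟨w, rfl⟩ := hf.surjective y hy u
    rw [← hf.pullback y hy, coord_coordEnd_ricciEnd g (hsrc hy),
      hf.ricci_eq HM (K₁.prod K₂) hy, ricci_prod K₁ K₂ (hf.mapsTo hy),
      hc₁ _ (hf.mapsTo hy).1, hc₂ _ (hf.mapsTo hy).2, prodMetric_apply, map_smul, map_smul]
    rfl
  have hne' : mu - lam ≠ 0 := sub_ne_zero.2 hne.symm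
  -- The constants `a` and `b` are the values of `(Ric - lam) / (mu - lam)` on the two factors.
  refine nijenhuis_eq_zero_of_prod HK K₁ K₂ hf (p := coordEnd P x)
    (a := (mu - lam)⁻¹ * (c₁ - lam)) (b := (mu - lam)⁻¹ * (c₂ - lam)) (fun y hy v => ?_) hx'
    (H.splitting.smooth (mem_chart_target _ x)).differentiableAt_infty
    (fun z hz v => coordEnd_twist P (hsrc hz) v) (fun v => ?_) v w
  · have h1 : coordEnd P x y v = (mu - lam)⁻¹ • (coordEnd (ricciEnd g) x y v - lam • v) := by
      rw [H.coordEnd_ricciEnd (hsrc hy)]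
      match_scalars <;> field_simp <;> ring
    rw [h1, map_smul, map_sub, hric y hy, map_smul]
    ext1
    · simp only [Prod.smul_fst, Prod.fst_sub]
      module
    · simp only [Prod.smul_snd, Prod.snd_sub]
      module
  · rw [coordEnd_self]
    exact hA.sq x v

theorem IsSplitting.isRescaling (S : IsSplitting g P) {t : ℝ} (ht : 0 < t) :
    IsRescaling (twist P) t g (rescale S ht) := by
  intro x (v : EuclideanSpace ℂ (Fin n)) (w : EuclideanSpace ℂ (Fin n))
  have h1 : ∀ u : EuclideanSpace ℂ (Fin n), projMinus (twist P) x u = modelEnd P x u := fun u =>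
    congrFun (congrArg (fun A : EndField n M => ⇑(modelEnd A x)) (projEnd_twist P)) u
  have h2 : ∀ u : EuclideanSpace ℂ (Fin n), projPlus (twist P) x u = u - modelEnd P x u := by
    intro u
    change (1 / 2 : ℝ) • (u - mulI n (modelEnd (twist P) x u)) = _
    rw [modelEnd_twist, mulI_mulI]
    module
  rw [h1, h1, h2, h2]
  change modelBilin g.inner x (v + (t - 1) • modelEnd P x v) w =
    modelBilin g.inner x (v - modelEnd P x v) (w - modelEnd P x w) +
      t * modelBilin g.inner x (modelEnd P x v) (modelEnd P x w)
  have h3 : modelBilin g.inner x v (modelEnd P x w) = modelBilin g.inner x (modelEnd P x v) w :=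
    (S.selfAdj x v w).symm
  have h4 : modelBilin g.inner x (modelEnd P x v) (modelEnd P x w) =
      modelBilin g.inner x (modelEnd P x v) w := by
    rw [← S.selfAdj, S.idem]
  simp only [map_add, map_smul, map_sub, add_apply, smul_apply, sub_apply, smul_eq_mul, h3, h4]
  ring

/-- Condition 5 is reached from 1 and implies 2, 4 and 6. The way back is by naturality from 2, by
parallelism of `P` from 3, and by the inverse rescaling from 6. -/
theorem IsRicciSplitting.tfae (H : IsRicciSplitting g P lam mu) (hne : lam ≠ mu) {t s : ℝ}
    (ht : 0 < t) (hs : 0 < s) (hts : t * s = 1) :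
    [IsIntegrable (twist P), HasComplexCharts (twist P), IsLocallyKEProduct g,
      IsLocallyKEProduct g ∧ IsLocallyKEProduct (rescale H.splitting ht),
      IsLocallyKEProductAlong g (twist P),
      IsLocallyKEProductAlong (rescale H.splitting ht) (twist P)].TFAE := by
  have S' := isSplitting_rescale H.splitting ht
  tfae_have 1 → 5 := H.isLocallyKEProductAlong
  tfae_have 5 → 6 := fun h => h.rescale H.splitting ht
  tfae_have 6 → 5 := fun h => rescale_rescale H.splitting ht hs hts S' ▸ h.rescale S' hs
  tfae_have 5 → 2 := fun h => h.hasComplexCharts H.splitting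
  tfae_have 2 → 1 := fun h =>
    h.isIntegrable (H.splitting.isAlmostKahler_twist H.kahler).almostComplex
  tfae_have 5 → 4 := fun h =>
    ⟨h.isLocallyKEProduct, (h.rescale H.splitting ht).isLocallyKEProduct⟩
  tfae_have 4 → 3 := And.left
  tfae_have 3 → 1 := H.isIntegrable_of_isLocallyKEProduct hne
  tfae_finish

end ComplexManifold

end

theorem corollary1 {n : ℕ} {M : Type*} [TopologicalSpace M]
    [ChartedSpace (EuclideanSpace ℂ (Fin n)) M]
    [IsManifold 𝓘(ℂ, EuclideanSpace ℂ (Fin n)) ω M]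
    [T2Space M] [SecondCountableTopology M] [ConnectedSpace M]
    (lam mu : ℝ) (hlt : lam < mu) (hpos : 0 < lam * mu) :
    ∃ F : {g : ComplexManifold.Metric n M //
          ComplexManifold.IsKahler g ∧ ComplexManifold.HasRicciEigenvalues g lam mu} ≃
        {P : ComplexManifold.Metric n M × ComplexManifold.EndField n M //
          ComplexManifold.IsKahlerEinstein P.1 ∧
          (∀ x, ComplexManifold.scalarCurvature P.1 x = 2 * n * lam) ∧
          ComplexManifold.IsAlmostKahler P.1 P.2 ∧
          (∀ x v, P.2 x (ComplexManifold.cplx x v) = ComplexManifold.cplx x (P.2 x v)) ∧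
          P.2 ≠ ComplexManifold.cplx ∧ P.2 ≠ -ComplexManifold.cplx},
      ∀ (g : {g : ComplexManifold.Metric n M //
          ComplexManifold.IsKahler g ∧ ComplexManifold.HasRicciEigenvalues g lam mu})
        (g' : ComplexManifold.Metric n M) (Jbar : ComplexManifold.EndField n M),
        (F g).1 = (g', Jbar) →
        (∀ x v, v ∈ ComplexManifold.ricciEigenspace g.1 lam x ↔
          Jbar x v = ComplexManifold.cplx x v) ∧
        (∀ x v, v ∈ ComplexManifold.ricciEigenspace g.1 mu x ↔
          Jbar x v = -ComplexManifold.cplx x v) ∧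
        ComplexManifold.IsRescaling Jbar (mu / lam) g.1 g' ∧
        ComplexManifold.IsRescaling Jbar (lam / mu) g' g.1 ∧
        ComplexManifold.IsAlmostKahler g.1 Jbar ∧
        [ComplexManifold.IsIntegrable Jbar,
          ComplexManifold.HasComplexCharts Jbar,
          ComplexManifold.IsLocallyKEProduct g.1,
          ComplexManifold.IsLocallyKEProduct g.1 ∧ ComplexManifold.IsLocallyKEProduct g',
          ComplexManifold.IsLocallyKEProductAlong g.1 Jbar,
          ComplexManifold.IsLocallyKEProductAlong g' Jbar].TFAE := by
  refine ⟨ComplexManifold.ricciCorrespondence hlt hpos, fun g g' Jbar hF => ?_⟩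
  have H := ComplexManifold.RicciMetric.ricciSplitting g hlt.ne
  have ht : 0 < mu / lam := ComplexManifold.div_pos_of_mul_pos (mul_comm lam mu ▸ hpos)
  have hs : 0 < lam / mu := ComplexManifold.div_pos_of_mul_pos hpos
  have hlam : lam ≠ 0 := left_ne_zero_of_mul hpos.ne'
  have hmu : mu ≠ 0 := right_ne_zero_of_mul hpos.ne'
  have hts : mu / lam * (lam / mu) = 1 := by field_simp
  obtain ⟨rfl, rfl⟩ := Prod.mk.inj hF
  have S' := ComplexManifold.isSplitting_rescale H.splitting ht
  refine ⟨fun x v => (H.mem_ricciEigenspace_lam hlt.ne).trans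
      ComplexManifold.twist_eq_cplx_iff.symm,
    fun x v => (H.mem_ricciEigenspace_mu hlt.ne).trans
      ComplexManifold.twist_eq_neg_cplx_iff.symm,
    H.splitting.isRescaling ht, ?_, H.splitting.isAlmostKahler_twist H.kahler,
    H.tfae hlt.ne ht hs hts⟩
  have h := S'.isRescaling hs
  rwa [ComplexManifold.rescale_rescale H.splitting ht hs hts S'] at h
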